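/- **Setting.** Let $H$ be a Hopf algebra over $\mathbb C$ with comultiplication $\Delta$, counit $\varepsilon$ and invertible antipode $S$; write $\omega_{(0)}\otimes\dots\otimes\omega_{(n)}$ for the iterated comultiplication of $\omega$. A unital right $H$-module algebra is a unital complex algebra $B$ with a right $H$-module structure $\triangleleft$ such that $(b_1b_2)\triangleleft\omega=(b_1\triangleleft\omega_{(0)})(b_2\triangleleft\omega_{(1)})$ and $1\triangleleft\omega=\varepsilon(\omega)1$. For such a $B$ and $n\ge 0$ let $C^n_H(B)$ be the space of linear functionals $f$ on $H\otimes B^{\otimes(n+1)}$ with $\omega\triangleright f=\varepsilon(\omega)f$ for all $\omega\in H$, where $$(\omega\triangleright f)(\eta\otimes b_0\otimes\dots\otimes b_n)=f\bigl(S^{-1}(\omega_{(0)})\,\eta\,\omega_{(1)}\otimes b_0\triangleleft\omega_{(2)}\otimes\dots\otimes b_n\triangleleft\omega_{(n+2)}\bigr).$$ It carries the cyclic operator $t_n\colon C^n_H(B)\to C^n_H(B)$ and the cofaces $d_i\colon C^{n-1}_H(B)\to C^n_H(B)$, $0\le i\le n$, $n\ge1$, given by $$(t_nf)(\omega\otimes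 b_0\otimes\dots\otimes b_n)=f(\omega_{(0)}\otimes b_n\triangleleft\omega_{(1)}\otimes b_0\otimes\dots\otimes b_{n-1}),$$ $$(d_if)(\omega\otimes b_0\otimes\dots\otimes b_n)=f(\omega\otimes b_0\otimes\dots\otimes b_ib_{i+1}\otimes\dots\otimes b_n)\quad(i<n),\qquad d_n=t_nd_0.$$ Put $b=\sum_{i=0}^n(-1)^id_i$ and $b'=\sum_{i=0}^{n-1}(-1)^id_i$ (as maps $C^{n-1}_H(B)\to C^n_H(B)$), $\lambda_n=(-1)^nt_n$ and $N_n=\sum_{i=0}^n\lambda_n^i$. The equivariant cyclic cohomology $HC^\bullet_H(B)$ is the cohomology of the total complex of the first-quadrant bicomplex that has $C^q_H(B)$ in column $p$ and row $q$ for all $p,q\ge0$, vertical differential $b$ in the even columns and $-b'$ in the odd columns, and horizontal differential $1-\lambda$ from even columns and $N$ from odd columns to the next one. Let $X$ be a finite-dimensional complex right $H$-module, and let $\pi_X(\omega)x=x\triangleleft\omega$. Then $\mathrm{End}(X)\otimes B$ is a unital right $H$-module algebra for $$(T\otimes b)\triangleleft\omega=\pi_X(\omega_{(0)})\,T\,\pi_X(S^{-1}(\omega_{(2)}))\otimes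 b\triangleleft\omega_{(1)},$$ and the maps $\Psi^n\colon C^n_H(B)\to C^n_H(\mathrm{End}(X)\otimes B)$, $$(\Psi^nf)\bigl(\omega\otimes(T_0\otimes b_0)\otimes\dots\otimes(T_n\otimes b_n)\bigr)=f(\omega_{(0)}\otimes b_0\otimes\dots\otimes b_n)\,\mathrm{Tr}\bigl(\pi_X(S^{-1}(\omega_{(1)}))T_0\cdots T_n\bigr),$$ commute with all $d_i$ and $t_n$, hence induce linear maps $[\Psi^n]\colon HC^n_H(B)\to HC^n_H(\mathrm{End}(X)\otimes B)$. If $p\in\mathrm{End}(X)$ is an idempotent with $\pi_X(\omega)p=p\,\pi_X(\omega)=\varepsilon(\omega)p$ for all $\omega\in H$, then $b\mapsto p\otimes b$ is a homomorphism of algebras $B\to\mathrm{End}(X)\otimes B$ (not unital in general) that respects the actions of $H$; pulling functionals back along it commutes with all $d_i$ and $t_n$ and induces linear maps $[\Phi^n_p]\colon HC^n_H(\mathrm{End}(X)\otimes B)\to HC^n_H(B)$. **Theorem (Morita invariance).** Let $H$ be a Hopf algebra over $\mathbb C$ with invertible antipode, let $B$ be a unital right $H$-module algebra, and let $X$ be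 a nonzero finite-dimensional complex vector space endowed with the trivial right action $x\triangleleft\omega=\varepsilon(\omega)x$ of $H$. Then for every $n\ge0$ the map $$[\Psi^n]\colon HC^n_H(B)\to HC^n_H(\mathrm{End}(X)\otimes B)$$ is an isomorphism of vector spaces, and for every idempotent $p\in\mathrm{End}(X)$ of rank one, $[\Phi^n_p]$ is its two-sided inverse. (For the trivial action the condition $\pi_X(\omega)p=p\,\pi_X(\omega)=\varepsilon(\omega)p$ holds for every $p$.) -/

import Mathlib

open scoped TensorProduct

namespace HopfCyclic

universe u v w

section Legs
variable {H : Type*} [Ring H] [HopfAlgebra ℂ H] {V W : Type*} [AddCommGroup V] [Module ℂ V]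
  [AddCommGroup W] [Module ℂ W]

/-- Sweedler notation: `legs F ω = F ω₍₀₎ ω₍₁₎` for a bilinear map `F`, that is, the linear map
`H ⊗ H → V` given by `F`, composed with the comultiplication. -/
noncomputable def legs (F : H →ₗ[ℂ] H →ₗ[ℂ] V) : H →ₗ[ℂ] V :=
  TensorProduct.lift F ∘ₗ Coalgebra.comul

open Coalgebra in
/-- The same for a plain function `F` of two variables, computed from a chosen representation of
`Δ(ω)`. It agrees with `legs` on bilinear maps and is used in calculations only. -/
noncomputable def sw (F : H → H → V) (ω : H) : V :=
  ∑ i ∈ (ℛ ℂ ω).index, F ((ℛ ℂ ω).left i) ((ℛ ℂ ω).right i)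

open Coalgebra in
theorem legs_eq_sw (F : H →ₗ[ℂ] H →ₗ[ℂ] V) (ω : H) : legs F ω = sw (fun a b => F a b) ω := by
  rw [legs, LinearMap.comp_apply, ← (ℛ ℂ ω).eq]
  simp [sw]

/-- `F` is bilinear. -/
def Bil (F : H → H → V) : Prop :=
  (∀ b, IsLinearMap ℂ fun a => F a b) ∧ ∀ a, IsLinearMap ℂ (F a)

/-- `F` is trilinear. -/
def Tri (F : H → H → H → V) : Prop :=
  (∀ c, Bil fun a b => F a b c) ∧ ∀ a b, IsLinearMap ℂ (F a b)

/-- The bundled form of a bilinear map. -/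
noncomputable def Bil.toLin {F : H → H → V} (h : Bil F) : H →ₗ[ℂ] H →ₗ[ℂ] V :=
  LinearMap.mk₂ ℂ F (fun a b c => (h.1 c).map_add a b) (fun c a b => (h.1 b).map_smul c a)
    (fun a => (h.2 a).map_add) (fun c a => (h.2 a).map_smul c)

/-- The bundled form of a trilinear map. -/
noncomputable def Tri.toLin {F : H → H → H → V} (h : Tri F) : H →ₗ[ℂ] H →ₗ[ℂ] H →ₗ[ℂ] V :=
  LinearMap.mk₂ ℂ (fun a b => IsLinearMap.mk' (F a b) (h.2 a b))
    (fun a b c => by ext d; exact ((h.1 d).1 c).map_add a b)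
    (fun c a b => by ext d; exact ((h.1 d).1 b).map_smul c a)
    (fun a b c => by ext d; exact ((h.1 d).2 a).map_add b c)
    (fun c a b => by ext d; exact ((h.1 d).2 a).map_smul c b)

theorem Bil.of {F : H → H → V} (al : ∀ a a' b, F (a + a') b = F a b + F a' b)
    (sl : ∀ (c : ℂ) a b, F (c • a) b = c • F a b) (ar : ∀ a b b', F a (b + b') = F a b + F a b')
    (sr : ∀ (c : ℂ) a b, F a (c • b) = c • F a b) : Bil F :=
  ⟨fun b => ⟨fun a a' => al a a' b, fun c a => sl c a b⟩,
    fun a => ⟨fun b b' => ar a b b', fun c b => sr c a b⟩⟩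

theorem Tri.of {F : H → H → H → V} (al : ∀ a a' b d, F (a + a') b d = F a b d + F a' b d)
    (sl : ∀ (c : ℂ) a b d, F (c • a) b d = c • F a b d)
    (am : ∀ a b b' d, F a (b + b') d = F a b d + F a b' d)
    (sm : ∀ (c : ℂ) a b d, F a (c • b) d = c • F a b d)
    (ar : ∀ a b d d', F a b (d + d') = F a b d + F a b d')
    (sr : ∀ (c : ℂ) a b d, F a b (c • d) = c • F a b d) : Tri F :=
  ⟨fun d => Bil.of (fun a a' b => al a a' b d) (fun c a b => sl c a b d)
    (fun a b b' => am a b b' d) (fun c a b => sm c a b d),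
    fun a b => ⟨fun d d' => ar a b d d', fun c d => sr c a b d⟩⟩

theorem isLinearMap_sw {U : Type*} [AddCommGroup U] [Module ℂ U] {F : U → H → H → V}
    (h : ∀ a b, IsLinearMap ℂ fun x => F x a b) (ω : H) :
    IsLinearMap ℂ fun x => sw (F x) ω := by
  constructor
  · intro x y
    simp only [sw, (h _ _).map_add, Finset.sum_add_distrib]
  · intro c x
    simp only [sw, (h _ _).map_smul, Finset.smul_sum]

theorem Bil.sw_eq {F : H → H → V} (h : Bil F) (ω : H) : sw F ω = legs h.toLin ω := by
  rw [legs_eq_sw]; rfl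

theorem Bil.sw_lin {F : H → H → V} (h : Bil F) : IsLinearMap ℂ (sw F) :=
  ⟨fun a b => by simp [h.sw_eq], fun a b => by simp [h.sw_eq]⟩

theorem sw_add_fun (F G : H → H → V) (ω : H) :
    sw (fun a b => F a b + G a b) ω = sw F ω + sw G ω := by
  simp [sw, Finset.sum_add_distrib]

theorem sw_smul_fun (c : ℂ) (F : H → H → V) (ω : H) :
    sw (fun a b => c • F a b) ω = c • sw F ω := by
  simp [sw, Finset.smul_sum]

theorem map_sw (L : V →ₗ[ℂ] W) (F : H → H → V) (ω : H) :
    L (sw F ω) = sw (fun a b => L (F a b)) ω := by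
  simp [sw]

theorem sw_comm (F : H → H → H → H → V) (ω η : H) :
    sw (fun a b => sw (fun c d => F a b c d) η) ω =
      sw (fun c d => sw (fun a b => F a b c d) ω) η := by
  simp only [sw]
  exact Finset.sum_comm

theorem sw_linApply (F : H → H → (W →ₗ[ℂ] V)) (ω : H) (w : W) :
    sw F ω w = sw (fun a b => F a b w) ω := by
  simp [sw]

theorem sw_multiApply {ι : Type*} {M : ι → Type*} [∀ i, AddCommGroup (M i)] [∀ i, Module ℂ (M i)]
    (F : H → H → MultilinearMap ℂ M V) (ω : H) (w : ∀ i, M i) :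
    sw F ω w = sw (fun a b => F a b w) ω := by
  simp [sw]

theorem sw_apply {ι : Type*} {V : ι → Type*} [∀ i, AddCommGroup (V i)] (F : H → H → ∀ i, V i) (ω : H) (i : ι) :
    sw F ω i = sw (fun a b => F a b i) ω := by
  simp [sw]

open Coalgebra in
theorem sw_assoc {F : H → H → H → V} (h : Tri F) (ω : H) :
    sw (fun a b => sw (fun c d => F c d b) a) ω = sw (fun a b => sw (fun c d => F a c d) b) ω := by
  have := congrArg (TensorProduct.lift ((TensorProduct.lift.equiv (.id ℂ) H H V).toLinearMap ∘ₗ h.toLin))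
    (sum_tmul_tmul_eq (ℛ ℂ ω) (fun i => ℛ ℂ _) (fun i => ℛ ℂ _))
  simpa [sw, Tri.toLin, TensorProduct.lift.equiv] using this

open Coalgebra in
theorem sw_counit_left {L : H → V} (h : IsLinearMap ℂ L) (ω : H) :
    sw (fun a b => (counit (R := ℂ) a : ℂ) • L b) ω = L ω := by
  have := congrArg h.mk' (sum_counit_smul (ℛ ℂ ω))
  simpa [sw] using this

open Coalgebra in
theorem sw_counit_right {L : H → V} (h : IsLinearMap ℂ L) (ω : H) :
    sw (fun a b => (counit (R := ℂ) b : ℂ) • L a) ω = L ω := by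
  have := congrArg ((TensorProduct.rid ℂ V).toLinearMap ∘ₗ (h.mk'.rTensor ℂ))
    (sum_tmul_counit_eq (ℛ ℂ ω))
  simpa [sw, -sum_tmul_counit_eq] using this

theorem sw_one {F : H → H → V} (h : Bil F) : sw F 1 = F 1 1 := by
  rw [h.sw_eq, legs, LinearMap.comp_apply, Bialgebra.comul_one, Algebra.TensorProduct.one_def]
  rfl

open Coalgebra in
theorem sw_mul {F : H → H → V} (h : Bil F) (ω η : H) :
    sw F (ω * η) = sw (fun a b => sw (fun c d => F (a * c) (b * d)) η) ω := by
  rw [h.sw_eq, legs, LinearMap.comp_apply, Bialgebra.comul_mul, ← (ℛ ℂ ω).eq, ← (ℛ ℂ η).eq]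
  simp [sw, Finset.sum_mul_sum, Bil.toLin]

variable (H) in
/-- The antipode of the Hopf algebra `H` is invertible. -/
class InvertibleAntipode : Prop where
  bijective : Function.Bijective (HopfAlgebra.antipode ℂ (A := H))

variable [InvertibleAntipode H]

variable (H) in
/-- The inverse `S⁻¹` of the antipode. -/
noncomputable def antipodeInv : H →ₗ[ℂ] H :=
  (LinearEquiv.ofBijective (HopfAlgebra.antipode ℂ (A := H)) InvertibleAntipode.bijective).symm

theorem antipode_antipodeInv (a : H) : HopfAlgebra.antipode ℂ (antipodeInv H a) = a :=
  (LinearEquiv.ofBijective (HopfAlgebra.antipode ℂ (A := H))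
    InvertibleAntipode.bijective).apply_symm_apply a

theorem antipodeInv_mul (a b : H) :
    antipodeInv H (a * b) = antipodeInv H b * antipodeInv H a := by
  apply InvertibleAntipode.bijective.1
  rw [HopfAlgebra.antipode_mul_antidistrib]
  simp only [antipode_antipodeInv]

theorem antipodeInv_one : antipodeInv H (1 : H) = 1 := by
  apply InvertibleAntipode.bijective.1
  rw [antipode_antipodeInv, HopfAlgebra.antipode_one]

open Coalgebra in
theorem sw_mul_antipodeInv (ω : H) :
    sw (fun a b => b * antipodeInv H a) ω = (counit (R := ℂ) ω : ℂ) • (1 : H) := by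
  apply InvertibleAntipode.bijective.1
  rw [map_sw, map_smul, HopfAlgebra.antipode_one, ← HopfAlgebra.sum_mul_antipode_eq_smul (ℛ ℂ ω)]
  simp only [HopfAlgebra.antipode_mul_antidistrib, antipode_antipodeInv, sw]

open Coalgebra in
theorem sw_antipodeInv_mul (ω : H) :
    sw (fun a b => antipodeInv H b * a) ω = (counit (R := ℂ) ω : ℂ) • (1 : H) := by
  apply InvertibleAntipode.bijective.1
  rw [map_sw, map_smul, HopfAlgebra.antipode_one, ← HopfAlgebra.sum_antipode_mul_eq_smul (ℛ ℂ ω)]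
  simp only [HopfAlgebra.antipode_mul_antidistrib, antipode_antipodeInv, sw]

end Legs

section Modules
variable (H : Type*) [Ring H] [HopfAlgebra ℂ H]

/-- A right `H`-module structure on `V`; `act v ω = v ◁ ω`. -/
structure RightModule (V : Type*) [AddCommGroup V] [Module ℂ V] where
  act : V →ₗ[ℂ] H →ₗ[ℂ] V
  act_one : ∀ v, act v 1 = v
  act_mul : ∀ v ω η, act v (ω * η) = act (act v ω) η

/-- A unital right `H`-module algebra structure on the unital algebra `B`:
`(b c) ◁ ω = (b ◁ ω₍₀₎) (c ◁ ω₍₁₎)` and `1 ◁ ω = ε(ω) 1`. -/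
structure RightModuleAlgebra (B : Type*) [Ring B] [Algebra ℂ B] extends RightModule H B where
  mul_act : ∀ b c ω, act (b * c) ω = legs ((LinearMap.mul ℂ B).compl₁₂ (act b) (act c)) ω
  one_act : ∀ ω, act 1 ω = Coalgebra.counit (R := ℂ) ω • (1 : B)

end Modules

section Cochains
variable {H : Type*} [Ring H] [HopfAlgebra ℂ H] {B : Type*} [AddCommGroup B] [Module ℂ B]
  {V : Type*} [AddCommGroup V] [Module ℂ V]

/-- Multilinear maps `Bⁿ → V`, that is, linear maps `B^{⊗ n} → V`. -/
abbrev Multi (B : Type*) [AddCommGroup B] [Module ℂ B] (n : ℕ)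
    (V : Type*) [AddCommGroup V] [Module ℂ V] :=
  MultilinearMap ℂ (fun _ : Fin n => B) V

theorem curryLeft_add (n : ℕ) (g g' : Multi B (n + 1) V) :
    (g + g').curryLeft = g.curryLeft + g'.curryLeft := rfl

theorem curryLeft_smul (n : ℕ) (c : ℂ) (g : Multi B (n + 1) V) :
    (c • g).curryLeft = c • g.curryLeft := rfl

/-- The recursion step for `tensorAct`: `(b, b₁, …, bₙ) ↦ T (g (b ◁ ω₍₀₎, ·)) ω₍₁₎ (b₁, …, bₙ)`. -/
noncomputable def tensorStep (ρ : RightModule H B) (n : ℕ)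
    (T : Multi B n V →ₗ[ℂ] H →ₗ[ℂ] Multi B n V) :
    Multi B (n + 1) V →ₗ[ℂ] H →ₗ[ℂ] Multi B (n + 1) V :=
  LinearMap.mk₂ ℂ
    (fun g ω => LinearMap.uncurryLeft
      { toFun := fun b => legs (T ∘ₗ g.curryLeft ∘ₗ ρ.act b) ω
        map_add' := fun b c => by
          simp only [legs_eq_sw, LinearMap.comp_apply, map_add, LinearMap.add_apply, sw_add_fun]
        map_smul' := fun b c => by
          simp only [legs_eq_sw, LinearMap.comp_apply, map_smul, LinearMap.smul_apply,
            sw_smul_fun, RingHom.id_apply] })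
    (by
      intro g g' ω
      apply MultilinearMap.ext; intro x
      change legs (T ∘ₗ (g + g').curryLeft ∘ₗ ρ.act (x 0)) (ω) (Fin.tail x) =
        legs (T ∘ₗ (g).curryLeft ∘ₗ ρ.act (x 0)) (ω) (Fin.tail x) +
        legs (T ∘ₗ (g').curryLeft ∘ₗ ρ.act (x 0)) (ω) (Fin.tail x)
      rw [← MultilinearMap.add_apply]
      congr 1
      simp only [legs_eq_sw, LinearMap.comp_apply, curryLeft_add, map_add, LinearMap.add_apply,
        sw_add_fun])
    (by
      intro c g ω
      apply MultilinearMap.ext; intro x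
      change legs (T ∘ₗ (c • g).curryLeft ∘ₗ ρ.act (x 0)) (ω) (Fin.tail x) =
        c • legs (T ∘ₗ (g).curryLeft ∘ₗ ρ.act (x 0)) (ω) (Fin.tail x)
      rw [← MultilinearMap.smul_apply]
      congr 1
      simp only [legs_eq_sw, LinearMap.comp_apply, curryLeft_smul, map_smul, LinearMap.smul_apply,
        sw_smul_fun])
    (by
      intro g ω ω'
      apply MultilinearMap.ext; intro x
      change legs (T ∘ₗ (g).curryLeft ∘ₗ ρ.act (x 0)) (ω + ω') (Fin.tail x) =
        legs (T ∘ₗ (g).curryLeft ∘ₗ ρ.act (x 0)) (ω) (Fin.tail x) +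
        legs (T ∘ₗ (g).curryLeft ∘ₗ ρ.act (x 0)) (ω') (Fin.tail x)
      rw [map_add, MultilinearMap.add_apply])
    (by
      intro c g ω
      apply MultilinearMap.ext; intro x
      change legs (T ∘ₗ (g).curryLeft ∘ₗ ρ.act (x 0)) (c • ω) (Fin.tail x) =
        c • legs (T ∘ₗ (g).curryLeft ∘ₗ ρ.act (x 0)) (ω) (Fin.tail x)
      rw [map_smul, MultilinearMap.smul_apply])

/-- `tensorAct ρ n g ω (b₁, …, bₙ) = g (b₁ ◁ ω₍₀₎, …, bₙ ◁ ω₍ₙ₋₁₎)` -/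
noncomputable def tensorAct (ρ : RightModule H B) :
    ∀ n : ℕ, Multi B n V →ₗ[ℂ] H →ₗ[ℂ] Multi B n V
  | 0 => (LinearMap.lsmul ℂ (Multi B 0 V) ∘ₗ Coalgebra.counit).flip
  | n + 1 => tensorStep ρ n (tensorAct ρ n)

theorem tensorAct_zero (ρ : RightModule H B) (g : Multi B 0 V) (ω : H) :
    tensorAct ρ 0 g ω = Coalgebra.counit (R := ℂ) ω • g := rfl

theorem tensorAct_succ (ρ : RightModule H B) (n : ℕ) (g : Multi B (n + 1) V) (ω : H) (b : B) :
    (tensorAct ρ (n + 1) g ω).curryLeft b =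
      sw (fun u v => tensorAct ρ n (g.curryLeft (ρ.act b u)) v) ω := by
  have : (tensorAct ρ (n + 1) g ω).curryLeft b =
    legs (tensorAct ρ n ∘ₗ g.curryLeft ∘ₗ ρ.act b) ω := by
      rfl
  rw [this, legs_eq_sw]; rfl

variable [InvertibleAntipode H]
/-- `adj η ω = S⁻¹(ω₍₀₎) η ω₍₁₎` -/
noncomputable def adj (η : H) : H →ₗ[ℂ] H :=
  legs ((LinearMap.mul ℂ H).compl₁₂ (antipodeInv H) (LinearMap.mulLeft ℂ η))

theorem adj_eq (η ω : H) : adj η ω = sw (fun a b => antipodeInv H a * (η * b)) ω := by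
  rw [adj, legs_eq_sw]; rfl

/-- The left action of `H` on the linear maps `f : H ⊗ B^{⊗ n} → V`,
`(ω ▷ f)(η, b₁, …, bₙ) = f (S⁻¹(ω₍₀₎) η ω₍₁₎, b₁ ◁ ω₍₂₎, …, bₙ ◁ ω₍ₙ₊₁₎)`. -/
noncomputable def cochainAct (ρ : RightModule H B) (n : ℕ) (ω : H)
   (f : H →ₗ[ℂ] Multi B n V) (η : H) : Multi B n V :=
  legs (tensorAct ρ n ∘ₗ f ∘ₗ adj η) ω
end Cochains

section Abstract
variable {H : Type*} [Ring H] [HopfAlgebra ℂ H] [InvertibleAntipode H]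
  {V W : Type*} [AddCommGroup V] [Module ℂ V]
  [AddCommGroup W] [Module ℂ W]

theorem invariant_iff (A : W →ₗ[ℂ] H →ₗ[ℂ] W) (f : H →ₗ[ℂ] W) :
    (∀ ω η, legs (A ∘ₗ f ∘ₗ adj η) ω = Coalgebra.counit (R := ℂ) ω • f η) ↔
    ∀ ω η, sw (fun a b => A (f (η * a)) b) ω = f (ω * η) := by
  have key : ∀ ω η, legs (A ∘ₗ f ∘ₗ adj η) ω =
      sw (fun a b => sw (fun c d => A (f (antipodeInv H a * η * c)) d) b) ω := by
    intro ω η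
    rw [legs_eq_sw, ← sw_assoc (F := fun a c d => A (f (antipodeInv H a * η * c)) d)]
    · congr; ext a b
      simp only [LinearMap.comp_apply, adj_eq, map_sw, ← mul_assoc, sw_linApply]
    · apply Tri.of <;> intros <;> simp [mul_add, add_mul]
  constructor
  · intro h ω η
    have hL : ∀ q, IsLinearMap ℂ fun x => sw (fun e k => A (f (x * η * e)) k) q := fun q =>
      isLinearMap_sw (fun a b => ⟨by intros; simp [add_mul], by intros; simp⟩) q
    have hB : ∀ x, Bil fun e k => A (f (x * η * e)) k := fun x => by
      apply Bil.of <;> intros <;> simp [mul_add]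
    have h1 : sw (fun a b => sw (fun c d => sw (fun e k =>
        A (f (antipodeInv H c * a * η * e)) k) d) b) ω = f (ω * η) := by
      rw [← sw_counit_right (L := fun x => f (x * η)) ⟨by simp [add_mul], by simp⟩ ω]
      congr; ext a b
      rw [← h, key]
      simp only [mul_assoc]
    rw [← h1, ← sw_assoc (F := fun a c d => sw (fun e k =>
        A (f (antipodeInv H c * a * η * e)) k) d)]
    · rw [← sw_counit_left (L := fun q => sw (fun e k => A (f (η * e)) k) q)]
      · congr; ext a b
        have := map_sw (hL b).mk' (fun c d => antipodeInv H d * c) a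
        simp only [IsLinearMap.mk'_apply] at this
        rw [← this, sw_antipodeInv_mul, (hL b).map_smul, one_mul]
      · simpa using (hB 1).sw_lin
    · refine ⟨fun d => ⟨fun b => ?_, fun a => ?_⟩, fun a b => (hB _).sw_lin⟩
      · exact isLinearMap_sw (fun e k => ⟨by intros; simp [add_mul, mul_add], by intros; simp⟩) d
      · exact isLinearMap_sw (fun e k => ⟨by intros; simp [add_mul], by intros; simp⟩) d
  · intro h ω η
    rw [key]
    simp only [h]
    have := map_sw (f ∘ₗ LinearMap.mulRight ℂ η) (fun a b => b * antipodeInv H a) ω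
    simp only [LinearMap.comp_apply, LinearMap.mulRight_apply, mul_assoc] at this
    rw [← this, sw_mul_antipodeInv]
    simp
end Abstract

section Ops
variable {H : Type*} [Ring H] [HopfAlgebra ℂ H] {B : Type*} [AddCommGroup B] [Module ℂ B]
  {V : Type*} [AddCommGroup V] [Module ℂ V]

/-- `rotate ρ n g v (b₀, …, bₙ) = g (bₙ ◁ v, b₀, …, bₙ₋₁)` -/
noncomputable def rotate (ρ : RightModule H B) (n : ℕ) :
    Multi B (n + 1) V →ₗ[ℂ] H →ₗ[ℂ] Multi B (n + 1) V :=
  LinearMap.mk₂ ℂ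
    (fun g v =>
      { toFun := fun b => g.curryLeft (ρ.act (b (Fin.last n)) v) (Fin.init b)
        map_update_add' := fun b i x y => by
          rename_i inst
          obtain rfl : inst = instDecidableEqFin _ := Subsingleton.elim _ _
          cases i using Fin.lastCases with
          | last => simp [Fin.init_update_last]
          | cast i =>
            have e : ∀ z, Function.update b i.castSucc z (Fin.last n) = b (Fin.last n) := fun z =>
              Function.update_of_ne (Fin.castSucc_lt_last i).ne' _ _
            simp only [e, Fin.init_update_castSucc, MultilinearMap.map_update_add,
              MultilinearMap.map_update_smul]
        map_update_smul' := fun b i c x => by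
          rename_i inst
          obtain rfl : inst = instDecidableEqFin _ := Subsingleton.elim _ _
          cases i using Fin.lastCases with
          | last => simp [Fin.init_update_last]
          | cast i =>
            have e : ∀ z, Function.update b i.castSucc z (Fin.last n) = b (Fin.last n) := fun z =>
              Function.update_of_ne (Fin.castSucc_lt_last i).ne' _ _
            simp only [e, Fin.init_update_castSucc, MultilinearMap.map_update_add,
              MultilinearMap.map_update_smul] })
    (by intros; ext; simp) (by intros; ext; simp) (by intros; ext; simp) (by intros; ext; simp)

theorem rotate_apply (ρ : RightModule H B) (n : ℕ) (g : Multi B (n + 1) V) (v : H)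
    (b : Fin (n + 1) → B) : rotate ρ n g v b =
      g (Fin.cons (α := fun _ => B) (ρ.act (b (Fin.last n)) v) (Fin.init b)) := rfl

/-- `fixLast n g c (b₁, …, bₙ) = g (b₁, …, bₙ, c)` -/
noncomputable def fixLast (n : ℕ) (g : Multi B (n + 1) V) (c : B) : Multi B n V :=
  (LinearMap.applyₗ c).compMultilinearMap g.curryRight

theorem fixLast_apply (n : ℕ) (g : Multi B (n + 1) V) (c : B) (y : Fin n → B) :
    fixLast n g c y = g (Fin.snoc (α := fun _ => B) y c) := rfl

theorem apply_snoc (n : ℕ) (g : Multi B (n + 1) V) (c : B) (y : Fin n → B) :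
    g (Fin.snoc (α := fun _ => B) y c) = fixLast n g c y := rfl

theorem apply_cons (n : ℕ) (g : Multi B (n + 1) V) (c : B) (y : Fin n → B) :
    g (Fin.cons (α := fun _ => B) c y) = g.curryLeft c y := rfl

theorem fixLast_curryLeft (n : ℕ) (g : Multi B (n + 2) V) (b c : B) :
    (fixLast (n + 1) g c).curryLeft b = fixLast n (g.curryLeft b) c := by
  ext y
  rw [← apply_cons, fixLast_apply, fixLast_apply, ← apply_cons, Fin.cons_snoc_eq_snoc_cons]

theorem fixLast_add (n : ℕ) (g : Multi B (n + 1) V) (c c' : B) :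
    fixLast n g (c + c') = fixLast n g c + fixLast n g c' := by
  ext; simp [fixLast]

theorem fixLast_smul (n : ℕ) (g : Multi B (n + 1) V) (r : ℂ) (c : B) :
    fixLast n g (r • c) = r • fixLast n g c := by
  ext; simp [fixLast]

theorem fixLast_add_left (n : ℕ) (g g' : Multi B (n + 1) V) (c : B) :
    fixLast n (g + g') c = fixLast n g c + fixLast n g' c := rfl

theorem fixLast_smul_left (n : ℕ) (g : Multi B (n + 1) V) (r : ℂ) (c : B) :
    fixLast n (r • g) c = r • fixLast n g c := rfl

theorem fixLast_rotate (ρ : RightModule H B) (n : ℕ) (g : Multi B (n + 1) V) (v : H) (c : B) :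
    fixLast n (rotate ρ n g v) c = g.curryLeft (ρ.act c v) := by
  ext y
  rw [fixLast_apply, rotate_apply, ← apply_cons]
  simp

theorem ext_fixLast (n : ℕ) {g g' : Multi B (n + 1) V} (h : ∀ c, fixLast n g c = fixLast n g' c) :
    g = g' := by
  ext x
  rw [← Fin.snoc_init_self x]
  exact congrArg (fun z : Multi B n V => z (Fin.init x)) (h (x (Fin.last n)))

theorem ext_curryLeft (n : ℕ) {g g' : Multi B (n + 1) V}
    (h : ∀ c, g.curryLeft c = g'.curryLeft c) : g = g' := by
  ext x
  rw [← Fin.cons_self_tail x]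
  exact congrArg (fun z : Multi B n V => z (Fin.tail x)) (h (x 0))

theorem tensorAct_fixLast (ρ : RightModule H B) (n : ℕ) (g : Multi B (n + 1) V) (ω : H) (b : B) :
    fixLast n (tensorAct ρ (n + 1) g ω) b =
      sw (fun u v => tensorAct ρ n (fixLast n g (ρ.act b v)) u) ω := by
  induction n generalizing ω b with
  | zero =>
    have e : ∀ (g : Multi B 1 V) c, fixLast 0 g c = g.curryLeft c := fun g c => by
      ext y; rw [← apply_cons, fixLast_apply]; congr; ext i; fin_cases i; rfl
    simp only [e, tensorAct_succ, tensorAct_zero]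
    rw [sw_counit_left (L := fun v => g.curryLeft (ρ.act b v)),
      sw_counit_right (L := fun v => g.curryLeft (ρ.act b v))] <;>
      constructor <;> intros <;> simp
  | succ n ih =>
    apply ext_curryLeft
    intro c
    have l : ∀ (F : H → H → Multi B (n + 1) V) ω, (sw F ω).curryLeft c =
      sw (fun u v => (F u v).curryLeft c) ω := fun F ω => by
        ext y; simp [sw]
    have l' : ∀ (F : H → H → Multi B (n + 1) V) ω, fixLast n (sw F ω) b =
      sw (fun u v => fixLast n (F u v) b) ω := fun F ω => by
        ext y; simp [sw, fixLast_apply]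
    rw [fixLast_curryLeft, tensorAct_succ, l']
    simp only [ih]
    rw [l]
    simp only [tensorAct_succ, fixLast_curryLeft]
    rw [← sw_assoc (F := fun u v w => tensorAct ρ n (fixLast n (g.curryLeft (ρ.act c u)) (ρ.act b w)) v)]
    apply Tri.of <;> intros <;>
      simp [fixLast_add, fixLast_smul, fixLast_add_left, fixLast_smul_left]

theorem tensorAct_rotate (ρ : RightModule H B) (n : ℕ) (g : Multi B (n + 1) V) (v ω : H) :
    sw (fun a b => tensorAct ρ (n + 1) (rotate ρ n g (v * a)) b) ω =
    sw (fun a b => rotate ρ n (tensorAct ρ (n + 1) g a) (b * v)) ω := by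
  apply ext_fixLast
  intro b
  have l' : ∀ (F : H → H → Multi B (n + 1) V) ω, fixLast n (sw F ω) b =
      sw (fun u v => fixLast n (F u v) b) ω := fun F ω => by
        ext y; simp [sw, fixLast_apply]
  rw [l', l']
  simp only [fixLast_rotate, tensorAct_fixLast, tensorAct_succ, ← RightModule.act_mul]
  rw [← sw_assoc (F := fun u w x => tensorAct ρ n (g.curryLeft (ρ.act b (x * (v * u)))) w)]
  · simp only [mul_assoc]
  · apply Tri.of <;> intros <;> simp [add_mul, mul_add]

/-- `(t f)(ω, b₀, …, bₙ) = f (ω₍₀₎, bₙ ◁ ω₍₁₎, b₀, …, bₙ₋₁)` -/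
noncomputable def cyc (ρ : RightModule H B) (n : ℕ) (f : H →ₗ[ℂ] Multi B (n + 1) V) :
    H →ₗ[ℂ] Multi B (n + 1) V :=
  legs (rotate ρ n ∘ₗ f)

theorem cyc_apply (ρ : RightModule H B) (n : ℕ) (f : H →ₗ[ℂ] Multi B (n + 1) V) (ω : H) :
    cyc ρ n f ω = sw (fun a b => rotate ρ n (f a) b) ω := by
  rw [cyc, legs_eq_sw]; rfl

theorem cyc_invariant (ρ : RightModule H B) (n : ℕ) (f : H →ₗ[ℂ] Multi B (n + 1) V)
    (h : ∀ ω η, sw (fun a b => tensorAct ρ (n + 1) (f (η * a)) b) ω = f (ω * η)) (ω η : H) :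
    sw (fun a b => tensorAct ρ (n + 1) (cyc ρ n f (η * a)) b) ω = cyc ρ n f (ω * η) := by
  have hb : Bil fun a b => rotate ρ n (f a) b := by apply Bil.of <;> intros <;> simp
  have hA : ∀ F (ω q : H), tensorAct ρ (n + 1) (sw F ω) q =
      sw (fun a b => tensorAct ρ (n + 1) (F a b : Multi B (n + 1) V) q) ω := fun F ω q => by
    rw [map_sw, sw_linApply]
  have hR : ∀ F (ω q : H), rotate ρ n (sw F ω) q =
      sw (fun a b => rotate ρ n (F a b : Multi B (n + 1) V) q) ω := fun F ω q => by
    rw [map_sw, sw_linApply]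
  simp only [cyc_apply, sw_mul hb, hA]
  conv_rhs => enter [1, p, q, 1, a, b]; rw [← h, hR]
  conv_lhs => rw [sw_comm]
  conv_rhs => rw [sw_comm]
  congr; ext a b
  rw [sw_assoc (F := fun c d q => tensorAct ρ (n + 1) (rotate ρ n (f (a * c)) (b * d)) q),
    sw_assoc (F := fun c d q => rotate ρ n (tensorAct ρ (n + 1) (f (a * c)) d) (q * b))]
  · simp only [tensorAct_rotate]
  · apply Tri.of <;> intros <;> simp [mul_add, add_mul]
  · apply Tri.of <;> intros <;> simp [mul_add, add_mul]
end Ops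

section Faces
variable {H : Type*} [Ring H] [HopfAlgebra ℂ H] {B : Type*} [Ring B] [Algebra ℂ B]
  {V : Type*} [AddCommGroup V] [Module ℂ V]

theorem contractNth_update (n : ℕ) (i : Fin (n + 1)) (b : Fin (n + 2) → B) (j : Fin (n + 2)) :
    ∃ (k : Fin (n + 1)) (L : B →ₗ[ℂ] B), ∀ z,
      Fin.contractNth i.castSucc (· * ·) (Function.update b j z) =
        Function.update (Fin.contractNth i.castSucc (· * ·) b) k (L z) := by
  rcases lt_trichotomy j i.castSucc with h | h | h
  · refine ⟨⟨j, by have := i.2; have : (j : ℕ) < i := h; omega⟩, LinearMap.id, fun z => ?_⟩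
    ext m
    have : (j : ℕ) < i := h
    simp only [Fin.contractNth, Function.update_apply, Fin.ext_iff, Fin.val_castSucc, Fin.val_succ,
      LinearMap.id_apply]
    split_ifs <;> first | rfl | omega
  · refine ⟨i, LinearMap.mulRight ℂ (b i.succ), fun z => ?_⟩
    subst h
    ext m
    simp only [Fin.contractNth, Function.update_apply, Fin.ext_iff, Fin.val_castSucc, Fin.val_succ,
      LinearMap.mulRight_apply]
    split_ifs <;> first | rfl | omega | skip
    congr; apply Fin.ext; simpa using ‹_›
  · by_cases h' : j = i.succ
    · refine ⟨i, LinearMap.mulLeft ℂ (b i.castSucc), fun z => ?_⟩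
      subst h'
      ext m
      simp only [Fin.contractNth, Function.update_apply, Fin.ext_iff, Fin.val_castSucc,
        Fin.val_succ, LinearMap.mulLeft_apply]
      split_ifs <;> first | rfl | omega | skip
      congr; apply Fin.ext; simpa using ‹_›
    · have h1 : (i : ℕ) < j := h
      have h2 : (j : ℕ) ≠ i + 1 := fun e => h' (Fin.ext (by simpa using e))
      refine ⟨⟨j - 1, by have := j.2; omega⟩, LinearMap.id, fun z => ?_⟩
      ext m
      simp only [Fin.contractNth, Function.update_apply, Fin.ext_iff, Fin.val_castSucc,
        Fin.val_succ, LinearMap.id_apply]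
      split_ifs <;> first | rfl | omega

/-- `face n i g (b₀, …, bₙ₊₁) = g (b₀, …, bᵢ bᵢ₊₁, …, bₙ₊₁)` for `0 ≤ i ≤ n`. -/
noncomputable def face (n : ℕ) (i : Fin (n + 1)) : Multi B (n + 1) V →ₗ[ℂ] Multi B (n + 2) V where
  toFun g :=
    { toFun := fun b => g (Fin.contractNth i.castSucc (· * ·) b)
      map_update_add' := fun b j x y => by
        rename_i inst
        obtain rfl : inst = instDecidableEqFin _ := Subsingleton.elim _ _
        obtain ⟨k, L, h⟩ := contractNth_update n i b j
        simp only [h, map_add, MultilinearMap.map_update_add]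
      map_update_smul' := fun b j c x => by
        rename_i inst
        obtain rfl : inst = instDecidableEqFin _ := Subsingleton.elim _ _
        obtain ⟨k, L, h⟩ := contractNth_update n i b j
        simp only [h, map_smul, MultilinearMap.map_update_smul] }
  map_add' _ _ := rfl
  map_smul' _ _ := rfl

theorem face_apply (n : ℕ) (i : Fin (n + 1)) (g : Multi B (n + 1) V) (b : Fin (n + 2) → B) :
    face n i g b = g (Fin.contractNth i.castSucc (· * ·) b) := rfl

theorem contractNth_cons_succ (n : ℕ) (i : Fin (n + 1)) (x : B) (b : Fin (n + 2) → B) :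
    Fin.contractNth i.succ.castSucc (· * ·) (Fin.cons (α := fun _ => B) x b) =
      Fin.cons (α := fun _ => B) x (Fin.contractNth i.castSucc (· * ·) b) := by
  ext m
  cases m using Fin.cases with
  | zero => simp [Fin.contractNth]
  | succ m =>
    simp only [Fin.contractNth, Fin.cons_succ, Fin.val_castSucc, Fin.val_succ, add_lt_add_iff_right,
      add_left_inj, ← Fin.succ_castSucc]

theorem contractNth_cons_zero (n : ℕ) (x y : B) (b : Fin n → B) :
    Fin.contractNth (Fin.castSucc 0) (· * ·)
      (Fin.cons (α := fun _ => B) x (Fin.cons (α := fun _ => B) y b)) =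
      Fin.cons (α := fun _ => B) (x * y) b := by
  ext m
  cases m using Fin.cases with
  | zero => simp [Fin.contractNth]
  | succ m => simp [Fin.contractNth]

theorem face_succ_curryLeft (n : ℕ) (i : Fin (n + 1)) (g : Multi B (n + 2) V) (x : B) :
    (face (n + 1) i.succ g).curryLeft x = face n i (g.curryLeft x) := by
  ext b
  rw [← apply_cons, face_apply, face_apply, contractNth_cons_succ, apply_cons]

theorem face_zero_curryLeft (n : ℕ) (g : Multi B (n + 1) V) (x y : B) :
    ((face n 0 g).curryLeft x).curryLeft y = g.curryLeft (x * y) := by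
  ext b
  rw [← apply_cons, ← apply_cons, face_apply, contractNth_cons_zero, apply_cons]

theorem curryLeft_sw (n : ℕ) (F : H → H → Multi B (n + 1) V) (ω : H) (c : B) :
    (sw F ω).curryLeft c = sw (fun u v => (F u v).curryLeft c) ω := by
  ext y; simp [sw]

theorem RightModuleAlgebra.mul_act' (β : RightModuleAlgebra H B) (x y : B) (ω : H) :
    β.act (x * y) ω = sw (fun u v => β.act x u * β.act y v) ω := by
  rw [β.mul_act, legs_eq_sw]; rfl

theorem tensorAct_face_zero (β : RightModuleAlgebra H B) (n : ℕ)
    (g : Multi B (n + 1) V) (ω : H) : tensorAct β.toRightModule (n + 2) (face n 0 g) ω =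
      face n 0 (tensorAct β.toRightModule (n + 1) g ω) := by
  apply ext_curryLeft; intro x
  apply ext_curryLeft; intro y
  rw [face_zero_curryLeft, tensorAct_succ, curryLeft_sw]
  simp only [tensorAct_succ, face_zero_curryLeft, β.mul_act', map_sw, sw_linApply]
  rw [← sw_assoc (F := fun u v w =>
    tensorAct β.toRightModule n (g.curryLeft (β.act x u * β.act y v)) w)]
  apply Tri.of <;> intros <;> simp [mul_add, add_mul]

theorem tensorAct_face (β : RightModuleAlgebra H B) (n : ℕ) (i : Fin (n + 1))
    (g : Multi B (n + 1) V) (ω : H) :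
    tensorAct β.toRightModule (n + 2) (face n i g) ω =
      face n i (tensorAct β.toRightModule (n + 1) g ω) := by
  induction n generalizing ω with
  | zero => fin_cases i; exact tensorAct_face_zero β 0 g ω
  | succ n ih =>
    cases i using Fin.cases with
    | zero => exact tensorAct_face_zero β _ g ω
    | succ i =>
      apply ext_curryLeft; intro x
      rw [face_succ_curryLeft, tensorAct_succ, tensorAct_succ, map_sw]
      congr; ext u v : 2
      rw [face_succ_curryLeft, ih]

end Faces

section Order
variable {H : Type*} [Ring H] [HopfAlgebra ℂ H] {B : Type*} [AddCommGroup B] [Module ℂ B]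
  {V : Type*} [AddCommGroup V] [Module ℂ V]

/-- The value of a multilinear map on the entries of a list (`0` if the length is wrong). -/
noncomputable def evl (N : ℕ) (g : Multi B N V) (l : List B) : V :=
  if h : l.length = N then g (fun i => l.get (i.cast h.symm)) else 0

theorem evl_cons (N : ℕ) (g : Multi B (N + 1) V) (b : B) (l : List B) :
    evl (N + 1) g (b :: l) = evl N (g.curryLeft b) l := by
  by_cases h : l.length = N
  · subst h
    simp only [evl, List.length_cons, dite_true]
    rw [← apply_cons]
    congr
    ext i
    cases i using Fin.cases <;> simp
  · simp [evl, h]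

theorem evl_rotate (ρ : RightModule H B) (n : ℕ) (g : Multi B (n + 1) V) (v : H) (b : B)
    (l : List B) : evl (n + 1) (rotate ρ n g v) (l ++ [b]) = evl (n + 1) g (ρ.act b v :: l) := by
  by_cases h : l.length = n
  · subst h
    simp only [evl, List.length_append, List.length_cons, List.length_nil, zero_add, dite_true,
      rotate_apply]
    congr
    ext i
    cases i using Fin.cases <;> simp [Fin.init]
  · simp [evl, h]

/-- `actList ρ z G v = G (z₁ ◁ v₍₀₎, …)` -/
noncomputable def actList (ρ : RightModule H B) : List B → (List B → V) → H → V
  | [], G, v => Coalgebra.counit (R := ℂ) v • G []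
  | b :: z, G, v => sw (fun u w => actList ρ z (fun l => G (ρ.act b u :: l)) w) v

theorem actList_add (ρ : RightModule H B) (z : List B) (G G' : List B → V) (v : H) :
    actList ρ z (fun l => G l + G' l) v = actList ρ z G v + actList ρ z G' v := by
  induction z generalizing G G' v with
  | nil => simp [actList]
  | cons b z ih => simp [actList, ih, sw_add_fun]

theorem actList_smul (ρ : RightModule H B) (z : List B) (c : ℂ) (G : List B → V) (v : H) :
    actList ρ z (fun l => c • G l) v = c • actList ρ z G v := by
  induction z generalizing G v with
  | nil => simp [actList, smul_comm c]
  | cons b z ih => simp [actList, ih, sw_smul_fun]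

theorem actList_sw (ρ : RightModule H B) (z : List B) (G : H → H → List B → V) (v ω : H) :
    actList ρ z (fun l => sw (fun a b => G a b l) ω) v =
      sw (fun a b => actList ρ z (G a b) v) ω := by
  induction z generalizing G v with
  | nil => simp [actList, sw, Finset.smul_sum]
  | cons b z ih =>
    simp only [actList, ih]
    rw [sw_comm]

theorem evl_add (N : ℕ) (g g' : Multi B N V) (l : List B) :
    evl N (g + g') l = evl N g l + evl N g' l := by
  unfold evl; split_ifs <;> simp

theorem evl_smul (N : ℕ) (c : ℂ) (g : Multi B N V) (l : List B) :
    evl N (c • g) l = c • evl N g l := by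
  unfold evl; split_ifs <;> simp

theorem evl_sw (N : ℕ) (F : H → H → Multi B N V) (ω : H) (l : List B) :
    evl N (sw F ω) l = sw (fun a b => evl N (F a b) l) ω := by
  unfold evl; split_ifs <;> simp [sw]

theorem evl_tensorAct (ρ : RightModule H B) (N : ℕ) (g : Multi B N V) (v : H) (z : List B)
    (hz : z.length = N) : evl N (tensorAct ρ N g v) z = actList ρ z (evl N g) v := by
  induction N generalizing z v with
  | zero =>
    obtain rfl := List.length_eq_zero_iff.1 hz
    simp [actList, tensorAct_zero, evl_smul]
  | succ N ih =>
    cases z with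
    | nil => simp at hz
    | cons b z =>
      simp only [List.length_cons, add_left_inj] at hz
      simp only [evl_cons, tensorAct_succ, actList, evl_sw]
      congr; ext u w
      exact ih _ _ _ hz

theorem actList_lin (ρ : RightModule H B) (n : ℕ) (g : Multi B n V) (y z : List B) :
    IsLinearMap ℂ (actList ρ z (fun l => evl n g (l ++ y))) := by
  induction z generalizing n with
  | nil => constructor <;> intros <;> simp [actList, add_smul, mul_smul]
  | cons b z ih =>
    cases n with
    | zero =>
      have : ∀ (z : List B) (v : H), actList ρ z (fun _ => (0 : V)) v = 0 := fun z v => by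
        simpa using actList_smul ρ z 0 (fun _ => (0 : V)) v
      constructor <;> intros <;> simp [actList, evl, this, sw]
    | succ n =>
      simp only [actList, List.cons_append, evl_cons]
      apply Bil.sw_lin
      refine ⟨fun w => ?_, fun u => ih _ _⟩
      constructor <;> intros <;> simp [evl_add, evl_smul, actList_add, actList_smul]

theorem cyc_iterate (ρ : RightModule H B) (n : ℕ) (y z : List B) (f : H →ₗ[ℂ] Multi B (n + 1) V)
    (η : H) : evl (n + 1) ((cyc ρ n)^[z.length] f η) (y ++ z) =
      sw (fun a b => actList ρ z (fun l => evl (n + 1) (f a) (l ++ y)) b) η := by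
  induction z generalizing y f with
  | nil =>
    simp only [actList, List.length_nil, Function.iterate_zero, id, List.append_nil, List.nil_append]
    rw [sw_counit_right (L := fun a => evl (n + 1) (f a) y)]
    constructor <;> intros <;> simp [evl_add, evl_smul]
  | cons b z ih =>
    rw [List.length_cons, Function.iterate_succ_apply, List.append_cons, ih]
    simp only [cyc_apply, ← List.append_assoc, evl_sw, actList_sw, actList, evl_rotate]
    rw [sw_assoc (F := fun u v w => actList ρ z (fun l => evl (n + 1) (f u) (ρ.act b v :: (l ++ y))) w)]
    · rfl
    · simp only [evl_cons]
      refine ⟨fun w => Bil.of ?_ ?_ ?_ ?_, fun u v => actList_lin ρ n _ y z⟩ <;> intros <;>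
        simp [evl_add, evl_smul, actList_add, actList_smul, curryLeft_add, curryLeft_smul]

theorem cyc_pow (ρ : RightModule H B) (n : ℕ) (f : H →ₗ[ℂ] Multi B (n + 1) V)
    (h : ∀ ω η, sw (fun a b => tensorAct ρ (n + 1) (f (η * a)) b) ω = f (ω * η)) :
    (cyc ρ n)^[n + 1] f = f := by
  ext η b
  have e : ∀ g : Multi B (n + 1) V, g b = evl (n + 1) g (List.ofFn b) := fun g => by
    rw [evl, dif_pos List.length_ofFn]
    congr; ext i; simp [-List.ofFn_succ]
  have := cyc_iterate ρ n [] (List.ofFn b) f η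
  simp only [List.append_nil, List.length_ofFn, List.nil_append] at this
  rw [e, this, e]
  have h1 := h η 1
  simp only [one_mul, mul_one] at h1
  conv_rhs => rw [← h1, evl_sw]
  congr; ext u v
  rw [evl_tensorAct _ _ _ _ _ (by simp)]

end Order

/-- The part of a cocyclic vector space that enters its cyclic bicomplex: spaces `C n`, the cofaces
`d n i : C n → C (n + 1)` for `0 ≤ i ≤ n + 1` and the cyclic operators `t n : C n → C n`. The
codegeneracies occur neither in the bicomplex nor in its cohomology, and they are not preserved by
maps induced by non-unital algebra homomorphisms, so they are left out. -/
structure PrecocyclicModule where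
  C : ℕ → Type u
  [addCommGroup : ∀ n, AddCommGroup (C n)]
  [module : ∀ n, Module ℂ (C n)]
  d : ∀ n, Fin (n + 2) → C n →ₗ[ℂ] C (n + 1)
  t : ∀ n, C n →ₗ[ℂ] C n
  d_d : ∀ n (i j : Fin (n + 2)), i ≤ j → ∀ f,
    d (n + 1) j.succ (d n i f) = d (n + 1) i.castSucc (d n j f)
  t_d : ∀ n (i : Fin (n + 1)) f, t (n + 1) (d n i.succ f) = d n i.castSucc (t n f)
  t_d_zero : ∀ n f, t (n + 1) (d n 0 f) = d n (Fin.last (n + 1)) f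
  t_pow : ∀ n, t n ^ (n + 1) = 1

namespace PrecocyclicModule
attribute [instance] addCommGroup module

variable (M : PrecocyclicModule.{u})

/-- `b = ∑ (-1)ⁱ dᵢ`, the sum of all cofaces `dᵢ : C n → C (n + 1)`, `0 ≤ i ≤ n + 1`. -/
def b (n : ℕ) : M.C n →ₗ[ℂ] M.C (n + 1) := ∑ i : Fin (n + 2), (-1 : ℂ) ^ (i : ℕ) • M.d n i

/-- `b'`, the same alternating sum without the last coface. -/
def b' (n : ℕ) : M.C n →ₗ[ℂ] M.C (n + 1) :=
  ∑ i : Fin (n + 1), (-1 : ℂ) ^ (i : ℕ) • M.d n i.castSucc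

/-- `λ = (-1)ⁿ t` on `C n`. -/
def lam (n : ℕ) : Module.End ℂ (M.C n) := (-1 : ℂ) ^ n • M.t n

/-- `N = 1 + λ + ⋯ + λⁿ` on `C n`. -/
def norm (n : ℕ) : Module.End ℂ (M.C n) := ∑ i ∈ Finset.range (n + 1), M.lam n ^ i

theorem alt_sum_zero {A : Type*} [AddCommGroup A] [Module ℂ A] (m : ℕ) (e : ℕ → ℕ → A)
    (h : ∀ i j, i ≤ j → j < m → e (j + 1) i = e i j) :
    ∑ j ∈ Finset.range (m + 1), ∑ i ∈ Finset.range m, (-1 : ℂ) ^ (i + j) • e j i = 0 := by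
  rw [Finset.sum_sigma']
  refine Finset.sum_involution (fun x _ => if x.2 < x.1 then ⟨x.2, x.1 - 1⟩ else ⟨x.2 + 1, x.1⟩)
    ?_ ?_ ?_ ?_
  · rintro ⟨j, i⟩ hx
    simp only [Finset.mem_sigma, Finset.mem_range] at hx
    dsimp only
    split_ifs with hij
    · obtain ⟨k, rfl⟩ : ∃ k, j = k + 1 := ⟨j - 1, by omega⟩
      rw [h i k (by omega) (by omega)]
      simp only [add_tsub_cancel_right, ← add_smul]
      rw [← add_assoc, pow_succ, add_comm k i]; simp
    · simp only
      rw [h j i (by omega) (by omega), ← add_smul, ← add_assoc, pow_succ, add_comm j i]; simp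
  · rintro ⟨j, i⟩ hx - heq
    dsimp only at heq
    split_ifs at heq with hij
    · simp only [Sigma.mk.injEq, heq_eq_eq] at heq; omega
    · simp only [Sigma.mk.injEq, heq_eq_eq] at heq; omega
  · rintro ⟨j, i⟩ hx
    simp only [Finset.mem_sigma, Finset.mem_range] at hx
    dsimp only
    split_ifs <;> simp only [Finset.mem_sigma, Finset.mem_range] <;> omega
  · rintro ⟨j, i⟩ hx
    simp only [Finset.mem_sigma, Finset.mem_range] at hx
    by_cases hij : i < j
    · have : ¬ (j - 1 < i) := by omega
      simp only [hij, if_true, this, if_false]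
      congr 1; omega
    · have : j < i + 1 := by omega
      simp only [hij, if_true, this, if_false]
      congr 1

/-- The coface `dᵢ` with a natural number as its index. -/
def dn (n i : ℕ) : M.C n →ₗ[ℂ] M.C (n + 1) := if h : i < n + 2 then M.d n ⟨i, h⟩ else 0

theorem dn_d (n i j : ℕ) (hij : i ≤ j) (hj : j < n + 2) (f : M.C n) :
    M.dn (n + 1) (j + 1) (M.dn n i f) = M.dn (n + 1) i (M.dn n j f) := by
  simp only [dn, hj, lt_of_le_of_lt hij hj, (by omega : j + 1 < n + 1 + 2),
    (by omega : i < n + 1 + 2), dite_true]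
  exact M.d_d n ⟨i, _⟩ ⟨j, hj⟩ hij f

theorem b_eq (n : ℕ) (f : M.C n) :
    M.b n f = ∑ i ∈ Finset.range (n + 2), (-1 : ℂ) ^ i • M.dn n i f := by
  rw [← Fin.sum_univ_eq_sum_range (fun i => (-1 : ℂ) ^ i • M.dn n i f)]
  simp [b, dn]

theorem b'_eq (n : ℕ) (f : M.C n) :
    M.b' n f = ∑ i ∈ Finset.range (n + 1), (-1 : ℂ) ^ i • M.dn n i f := by
  rw [← Fin.sum_univ_eq_sum_range (fun i => (-1 : ℂ) ^ i • M.dn n i f)]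
  simp only [b', dn, LinearMap.sum_apply, LinearMap.smul_apply]
  refine Finset.sum_congr rfl fun i _ => ?_
  rw [dif_pos (by omega : (i : ℕ) < n + 2)]; rfl

theorem b_b (n : ℕ) (f : M.C n) : M.b (n + 1) (M.b n f) = 0 := by
  rw [b_eq M (n + 1), b_eq M n]
  simp only [map_sum, map_smul, Finset.smul_sum, smul_smul, ← pow_add]
  rw [← alt_sum_zero (n + 2) (fun j i => M.dn (n + 1) j (M.dn n i f))
    (fun i j hij hj => M.dn_d n i j hij hj f)]
  exact Finset.sum_congr rfl fun j _ => Finset.sum_congr rfl fun i _ => by rw [add_comm j i]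

theorem b'_b' (n : ℕ) (f : M.C n) : M.b' (n + 1) (M.b' n f) = 0 := by
  rw [b'_eq M (n + 1), b'_eq M n]
  simp only [map_sum, map_smul, Finset.smul_sum, smul_smul, ← pow_add]
  rw [← alt_sum_zero (n + 1) (fun j i => M.dn (n + 1) j (M.dn n i f))
    (fun i j hij hj => M.dn_d n i j hij (by omega) f)]
  exact Finset.sum_congr rfl fun j _ => Finset.sum_congr rfl fun i _ => by rw [add_comm j i]

theorem b_eq_b' (n : ℕ) (f : M.C n) : M.b n f = M.b' n f + M.lam (n + 1) (M.d n 0 f) := by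
  rw [b, Fin.sum_univ_castSucc]
  simp [b', lam, M.t_d_zero]

theorem lam_b (n : ℕ) (f : M.C n) :
    M.lam (n + 1) (M.b n f) = M.b' n (M.lam n f) + M.lam (n + 1) (M.d n 0 f) := by
  rw [b, Fin.sum_univ_succ]
  simp only [b', lam, Fin.val_zero, pow_zero, one_smul, Fin.val_succ, LinearMap.add_apply,
    LinearMap.sum_apply, LinearMap.smul_apply, map_add, map_sum, map_smul,
    Finset.smul_sum, smul_smul, M.t_d]
  refine (add_comm _ _).trans ?_
  congr 1
  refine Finset.sum_congr rfl fun i _ => ?_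
  congr 1
  ring

theorem b_sub_lam (n : ℕ) (f : M.C n) :
    M.b n f - M.lam (n + 1) (M.b n f) = M.b' n (f - M.lam n f) := by
  rw [lam_b, b_eq_b', map_sub]; abel

theorem lam_pow (n : ℕ) : M.lam n ^ (n + 1) = 1 := by
  rw [lam, smul_pow, M.t_pow, ← pow_mul, Even.neg_one_pow (Nat.even_mul_succ_self n), one_smul]

theorem one_sub_mul_norm (n : ℕ) : (1 - M.lam n) * M.norm n = 0 := by
  rw [norm, mul_neg_geom_sum, lam_pow, sub_self]

theorem norm_mul_one_sub (n : ℕ) : M.norm n * (1 - M.lam n) = 0 := by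
  rw [norm, geom_sum_mul_neg, lam_pow, sub_self]

theorem lam_dn (n i : ℕ) (hi : i < n + 1) (f : M.C n) :
    M.lam (n + 1) ((-1 : ℂ) ^ (i + 1) • M.dn n (i + 1) f) = (-1 : ℂ) ^ i • M.dn n i (M.lam n f) := by
  have := M.t_d n ⟨i, hi⟩ f
  simp only [dn, lam, (by omega : i + 1 < n + 2), (by omega : i < n + 2), dite_true]
  simp only [LinearMap.smul_apply, map_smul, smul_smul]
  rw [show M.t (n + 1) (M.d n ⟨i + 1, _⟩ f) = M.d n ⟨i, _⟩ (M.t n f) from this]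
  congr 1
  ring

theorem norm_dn (n i : ℕ) (hi : i < n + 2) (f : M.C n) :
    M.norm (n + 1) ((-1 : ℂ) ^ i • M.dn n i f) = M.norm (n + 1) (M.d n 0 ((M.lam n ^ i) f)) := by
  have hN : ∀ x, M.norm (n + 1) (M.lam (n + 1) x) = M.norm (n + 1) x := fun x => by
    have := congrArg (fun z => z x) (M.norm_mul_one_sub (n + 1))
    simp only [mul_sub, mul_one, LinearMap.sub_apply, Module.End.mul_apply, LinearMap.zero_apply] at this
    exact (sub_eq_zero.1 this).symm
  induction i generalizing f with
  | zero => simp [dn]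
  | succ i ih =>
    rw [← hN, lam_dn _ _ _ (by omega), ih (by omega), pow_succ, Module.End.mul_apply]

theorem norm_b' (n : ℕ) (f : M.C n) : M.norm (n + 1) (M.b' n f) = M.b n (M.norm n f) := by
  have h1 : M.norm (n + 1) (M.b' n f) = M.norm (n + 1) (M.d n 0 (M.norm n f)) := by
    rw [b'_eq, map_sum, Finset.sum_congr rfl fun i hi =>
      M.norm_dn n i (by have := Finset.mem_range.1 hi; omega) f]
    simp [norm]
  have hl : M.lam n (M.norm n f) = M.norm n f := by
    have := congrArg (fun z => z f) (M.one_sub_mul_norm n)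
    simp only [sub_mul, one_mul, LinearMap.sub_apply, Module.End.mul_apply, LinearMap.zero_apply] at this
    exact (sub_eq_zero.1 this).symm
  have h2 : ∀ x, M.lam n x = x → ∀ k, k ≤ n + 1 →
      (M.lam (n + 1) ^ k) ((-1 : ℂ) ^ k • M.dn n k x) = M.d n 0 x := fun x hx k => by
    induction k with
    | zero => intro; simp [dn]
    | succ k ih =>
      intro hk
      rw [pow_succ, Module.End.mul_apply, lam_dn _ _ _ (by omega), hx, ih (by omega)]
  rw [h1, b_eq]
  set x := M.norm n f
  have h3 : ∀ k, k ≤ n + 1 → (-1 : ℂ) ^ k • M.dn n k x = (M.lam (n + 1) ^ (n + 2 - k)) (M.d n 0 x) :=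
    fun k hk => by
      rw [← h2 x hl k hk, ← Module.End.mul_apply, ← pow_add, Nat.sub_add_cancel (by omega), lam_pow]
      rfl
  rw [Finset.sum_congr rfl fun i hi => h3 i (by have := Finset.mem_range.1 hi; omega)]
  rw [Finset.sum_range_succ', ← Finset.sum_range_reflect, norm, Finset.sum_range_succ']
  simp only [LinearMap.add_apply, LinearMap.sum_apply]
  congr 1
  · refine Finset.sum_congr rfl fun i hi => ?_
    have := Finset.mem_range.1 hi
    congr 2; omega
  · rw [Nat.sub_zero, lam_pow]; rfl

/-- The vertical differential of the bicomplex, from row `q` to row `q + 1` in column `p`: it is `b`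
in the even columns and `-b'` in the odd ones. -/
def vert (p q : ℕ) : M.C q →ₗ[ℂ] M.C (q + 1) := if Even p then M.b q else -M.b' q

/-- The horizontal differential of the bicomplex, from column `p` to column `p + 1` in row `q`: it is
`1 - λ` for even `p` and `N` for odd `p`. -/
def horiz (p q : ℕ) : M.C q →ₗ[ℂ] M.C q := if Even p then 1 - M.lam q else M.norm q

/-- Families `x` of elements of the bicomplex, which has `C q` in row `q` of each column `p ≥ 0`;
`x p q` is the component in column `p` and row `q`. -/
abbrev Bigraded := ∀ _p q : ℕ, M.C q

/-- The total differential: the sum of the vertical and the horizontal differential. -/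
def totD : M.Bigraded →ₗ[ℂ] M.Bigraded where
  toFun x
    | 0, 0 => 0
    | 0, q + 1 => M.vert 0 q (x 0 q)
    | p + 1, 0 => M.horiz p 0 (x p 0)
    | p + 1, q + 1 => M.vert (p + 1) q (x (p + 1) q) + M.horiz p (q + 1) (x p (q + 1))
  map_add' x y := by
    funext p q
    rcases p with _ | p <;> rcases q with _ | q <;> simp [add_add_add_comm]
  map_smul' c x := by
    funext p q
    rcases p with _ | p <;> rcases q with _ | q <;> simp

theorem totD_totD (x : M.Bigraded) : M.totD (M.totD x) = 0 := by
  have hv : ∀ p q (x : M.C q), M.vert p (q + 1) (M.vert p q x) = 0 := fun p q x => by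
    unfold vert; split_ifs <;> simp [b_b, b'_b']
  have hh : ∀ p q (x : M.C q), M.horiz (p + 1) q (M.horiz p q x) = 0 := fun p q x => by
    by_cases h : Even p
    · have h' : ¬ Even (p + 1) := by simpa [Nat.even_add_one] using h
      simp only [horiz, h, h', if_true, if_false, ← Module.End.mul_apply, norm_mul_one_sub]; rfl
    · have h' : Even (p + 1) := by simpa [Nat.even_add_one] using h
      simp only [horiz, h, h', if_true, if_false, ← Module.End.mul_apply, one_sub_mul_norm]; rfl
  have hvh : ∀ p q (x : M.C q),
      M.vert (p + 1) q (M.horiz p q x) + M.horiz p (q + 1) (M.vert p q x) = 0 := fun p q x => by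
    by_cases h : Even p
    · have h' : ¬ Even (p + 1) := by simpa [Nat.even_add_one] using h
      simp only [horiz, vert, h, h', if_true, if_false]
      have := M.b_sub_lam q x
      simp only [LinearMap.neg_apply, LinearMap.sub_apply, Module.End.one_apply] at this ⊢
      rw [this]; simp
    · have h' : Even (p + 1) := by simpa [Nat.even_add_one] using h
      simp only [horiz, vert, h, h', if_true, if_false]
      simp [norm_b']
  funext p q
  rcases p with _ | _ | p <;> rcases q with _ | _ | q <;>
    simp only [totD, LinearMap.coe_mk, AddHom.coe_mk, map_zero, map_add, hv, hh, zero_add,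
      add_zero, Pi.zero_apply, hvh]

/-- The families concentrated in total degree `n`, that is, the sum of the `C q` over the finitely
many places `(p, q)` with `p + q = n`. -/
def Tot (n : ℕ) : Submodule ℂ M.Bigraded where
  carrier := {x | ∀ p q, p + q ≠ n → x p q = 0}
  add_mem' hx hy p q h := by simp [hx p q h, hy p q h]
  zero_mem' _ _ _ := rfl
  smul_mem' c x hx p q h := by simp [hx p q h]

theorem totD_mem {n : ℕ} {x : M.Bigraded} (hx : x ∈ M.Tot n) : M.totD x ∈ M.Tot (n + 1) := by
  intro p q h
  rcases p with _ | p <;> rcases q with _ | q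
  · rfl
  · simp [totD, hx 0 q (by omega)]
  · simp [totD, hx p 0 (by omega)]
  · simp [totD, hx p (q + 1) (by omega), hx (p + 1) q (by omega)]

/-- The cocycles of degree `n` of the total complex. -/
def cocycles (n : ℕ) : Submodule ℂ M.Bigraded := M.Tot n ⊓ LinearMap.ker M.totD

/-- The coboundaries of degree `n` of the total complex. -/
def coboundaries : ℕ → Submodule ℂ M.Bigraded
  | 0 => ⊥
  | n + 1 => (M.Tot n).map M.totD

theorem coboundaries_le (n : ℕ) : M.coboundaries n ≤ M.cocycles n := by
  cases n with
  | zero => exact bot_le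
  | succ n =>
    rintro _ ⟨x, hx, rfl⟩
    exact ⟨M.totD_mem hx, M.totD_totD x⟩

/-- Cyclic cohomology `HC^n`: the cohomology of the total complex in degree `n`. -/
abbrev HC (n : ℕ) : Type u := M.cocycles n ⧸ (M.coboundaries n).submoduleOf (M.cocycles n)

end PrecocyclicModule

/-- Families of linear maps that commute with the cofaces and the cyclic operators. -/
structure PrecocyclicHom (M : PrecocyclicModule.{u}) (N : PrecocyclicModule.{v}) where
  app : ∀ n, M.C n →ₗ[ℂ] N.C n
  app_d : ∀ n i f, app (n + 1) (M.d n i f) = N.d n i (app n f)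
  app_t : ∀ n f, app n (M.t n f) = N.t n (app n f)

namespace PrecocyclicHom
variable {M : PrecocyclicModule.{u}} {N : PrecocyclicModule.{v}} (φ : PrecocyclicHom M N)

/-- The induced map of bicomplexes. -/
def bigraded : M.Bigraded →ₗ[ℂ] N.Bigraded where
  toFun x p q := φ.app q (x p q)
  map_add' _ _ := by ext; simp
  map_smul' _ _ := by ext; simp

theorem app_lam_pow (n k : ℕ) (f : M.C n) :
    φ.app n ((M.lam n ^ k) f) = (N.lam n ^ k) (φ.app n f) := by
  induction k generalizing f with
  | zero => rfl
  | succ k ih =>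
    rw [pow_succ, pow_succ, Module.End.mul_apply, Module.End.mul_apply, ih]
    simp [PrecocyclicModule.lam, φ.app_t]

theorem app_vert (p q : ℕ) (f : M.C q) : φ.app (q + 1) (M.vert p q f) = N.vert p q (φ.app q f) := by
  unfold PrecocyclicModule.vert
  split_ifs <;> simp [PrecocyclicModule.b, PrecocyclicModule.b', φ.app_d]

theorem app_horiz (p q : ℕ) (f : M.C q) : φ.app q (M.horiz p q f) = N.horiz p q (φ.app q f) := by
  unfold PrecocyclicModule.horiz
  split_ifs
  · simpa using φ.app_lam_pow q 1 f
  · simp [PrecocyclicModule.norm, app_lam_pow]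

theorem bigraded_totD (x : M.Bigraded) : φ.bigraded (M.totD x) = N.totD (φ.bigraded x) := by
  funext p q
  rcases p with _ | p <;> rcases q with _ | q <;>
    simp [bigraded, PrecocyclicModule.totD, app_vert, app_horiz]

theorem bigraded_mem {n : ℕ} {x : M.Bigraded} (hx : x ∈ M.Tot n) : φ.bigraded x ∈ N.Tot n :=
  fun p q h => by simp [bigraded, hx p q h]

theorem bigraded_cocycles {n : ℕ} {x : M.Bigraded} (hx : x ∈ M.cocycles n) :
    φ.bigraded x ∈ N.cocycles n :=
  ⟨φ.bigraded_mem hx.1, by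
    have h : M.totD x = 0 := hx.2
    change N.totD (φ.bigraded x) = 0
    rw [← bigraded_totD, h, map_zero]⟩

theorem bigraded_coboundaries {n : ℕ} {x : M.Bigraded} (hx : x ∈ M.coboundaries n) :
    φ.bigraded x ∈ N.coboundaries n := by
  cases n with
  | zero => rw [(Submodule.mem_bot ℂ).1 hx, map_zero]; exact zero_mem _
  | succ n =>
    obtain ⟨y, hy, rfl⟩ := hx
    exact ⟨φ.bigraded y, φ.bigraded_mem hy, (φ.bigraded_totD y).symm⟩

/-- The induced map in cyclic cohomology. -/
def mapHC (n : ℕ) : M.HC n →ₗ[ℂ] N.HC n :=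
  Submodule.mapQ _ _ (φ.bigraded.restrict fun _ hx => φ.bigraded_cocycles hx)
    fun _ hx => φ.bigraded_coboundaries hx

end PrecocyclicHom

section Faces2
variable {H : Type*} [Ring H] [HopfAlgebra ℂ H] {B : Type*} [Ring B] [Algebra ℂ B]
  {V : Type*} [AddCommGroup V] [Module ℂ V]

theorem face_face (n : ℕ) (i j : Fin (n + 1)) (hij : i ≤ j) (g : Multi B (n + 1) V) :
    face (n + 1) j.succ (face n i g) = face (n + 1) i.castSucc (face n j g) := by
  have h0 : ∀ n (j : Fin (n + 1)) (g : Multi B (n + 1) V),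
      face (n + 1) j.succ (face n 0 g) = face (n + 1) 0 (face n j g) := fun n j g => by
    apply ext_curryLeft; intro x
    apply ext_curryLeft; intro y
    rw [face_zero_curryLeft, face_succ_curryLeft]
    cases j using Fin.cases with
    | zero =>
      apply ext_curryLeft; intro z
      rw [face_zero_curryLeft, face_zero_curryLeft, face_zero_curryLeft, mul_assoc]
    | succ j =>
      obtain ⟨n, rfl⟩ : ∃ m, n = m + 1 := ⟨n - 1, by have := j.2; omega⟩
      rw [face_succ_curryLeft, face_succ_curryLeft, face_zero_curryLeft]
  induction n with
  | zero =>
    fin_cases i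
    exact h0 _ _ _
  | succ n ih =>
    cases i using Fin.cases with
    | zero => exact h0 _ _ _
    | succ i =>
      cases j using Fin.cases with
      | zero => simp at hij
      | succ j =>
        apply ext_curryLeft; intro x
        rw [face_succ_curryLeft, face_succ_curryLeft, ih i j (by simpa using hij),
          ← Fin.succ_castSucc, face_succ_curryLeft, face_succ_curryLeft]

theorem fixLast_face_castSucc (n : ℕ) (i : Fin (n + 1)) (g : Multi B (n + 2) V) (c : B) :
    fixLast (n + 2) (face (n + 1) i.castSucc g) c = face n i (fixLast (n + 1) g c) := by
  ext y
  rw [fixLast_apply, face_apply, face_apply, fixLast_apply]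
  congr 1
  ext m
  cases m using Fin.lastCases with
  | last =>
    have h : ¬ (n + 1 < (i : ℕ)) := by have := i.2; omega
    have h' : ¬ (n + 1 = (i : ℕ)) := by have := i.2; omega
    simp [Fin.contractNth, h, h']
  | cast m =>
    simp only [Fin.contractNth, Fin.snoc_castSucc, Fin.val_castSucc, Fin.succ_castSucc]

theorem fixLast_face_last (n : ℕ) (g : Multi B (n + 1) V) (b c : B) :
    fixLast n (fixLast (n + 1) (face n (Fin.last n) g) c) b = fixLast n g (b * c) := by
  ext y
  rw [fixLast_apply, fixLast_apply, face_apply, fixLast_apply]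
  congr 1
  ext m
  cases m using Fin.lastCases with
  | last =>
    simp [Fin.contractNth]
  | cast m =>
    have := m.2
    simp [Fin.contractNth]

theorem rotate_face_succ (β : RightModuleAlgebra H B) (n : ℕ) (i : Fin n)
    (g : Multi B (n + 1) V) (v : H) : rotate β.toRightModule (n + 1) (face n i.succ g) v =
      face n i.castSucc (rotate β.toRightModule n g v) := by
  obtain ⟨n, rfl⟩ : ∃ m, n = m + 1 := ⟨n - 1, by have := i.2; omega⟩
  apply ext_fixLast; intro c
  rw [fixLast_rotate, face_succ_curryLeft, fixLast_face_castSucc, fixLast_rotate]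

theorem cyc_face_succ (β : RightModuleAlgebra H B) (n : ℕ) (i : Fin n)
    (f : H →ₗ[ℂ] Multi B (n + 1) V) : cyc β.toRightModule (n + 1) (face n i.succ ∘ₗ f) =
      face n i.castSucc ∘ₗ cyc β.toRightModule n f := by
  apply LinearMap.ext; intro ω
  simp only [cyc_apply, LinearMap.comp_apply, map_sw, rotate_face_succ]

theorem fixLast_sw (n : ℕ) (F : H → H → Multi B (n + 1) V) (ω : H) (b : B) :
    fixLast n (sw F ω) b = sw (fun u v => fixLast n (F u v) b) ω := by
  ext y; simp [sw, fixLast_apply]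

theorem cyc_cyc_face_zero (β : RightModuleAlgebra H B) (n : ℕ)
    (f : H →ₗ[ℂ] Multi B (n + 1) V) :
    cyc β.toRightModule (n + 1) (cyc β.toRightModule (n + 1) (face n 0 ∘ₗ f)) =
      face n (Fin.last n) ∘ₗ cyc β.toRightModule n f := by
  apply LinearMap.ext; intro ω
  apply ext_fixLast; intro c
  apply ext_fixLast; intro b
  rw [LinearMap.comp_apply, fixLast_face_last]
  simp only [cyc_apply, LinearMap.comp_apply, map_sw, sw_linApply, fixLast_sw, fixLast_rotate,
    β.mul_act']
  simp only [← fixLast_curryLeft, fixLast_rotate, face_zero_curryLeft]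
  rw [sw_assoc (F := fun u v w => (f u).curryLeft (β.act b v * β.act c w))]
  apply Tri.of <;> intros <;> simp [mul_add, add_mul, curryLeft_add, curryLeft_smul]

end Faces2

section Cochains
variable {H : Type u} [Ring H] [HopfAlgebra ℂ H] {B : Type v} [Ring B] [Algebra ℂ B]

/-- All linear functionals on `H ⊗ B^{⊗ (n + 1)}`, written as `f ω (b₀, …, bₙ)`. -/
abbrev Functional (H : Type*) [Ring H] [HopfAlgebra ℂ H] (B : Type*) [Ring B] [Algebra ℂ B] (n : ℕ) :=
  H →ₗ[ℂ] Multi B (n + 1) ℂ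

/-- `(t f)(ω, b₀, …, bₙ) = f (ω₍₀₎, bₙ ◁ ω₍₁₎, b₀, …, bₙ₋₁)` -/
noncomputable def cycOp (β : RightModuleAlgebra H B) (n : ℕ) :
    Functional H B n →ₗ[ℂ] Functional H B n where
  toFun f := cyc β.toRightModule n f
  map_add' f g := by ext1 ω; simp [cyc_apply, sw_add_fun]
  map_smul' f g := by ext1 ω; simp [cyc_apply, sw_smul_fun]

/-- `(dᵢ f)(ω, b₀, …, bₙ₊₁) = f (ω, b₀, …, bᵢ bᵢ₊₁, …, bₙ₊₁)` for `0 ≤ i ≤ n` -/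
noncomputable def mergeOp (n : ℕ) (i : Fin (n + 1)) :
    Functional H B n →ₗ[ℂ] Functional H B (n + 1) where
  toFun f := face n i ∘ₗ f
  map_add' f g := by ext1 ω; simp
  map_smul' f g := by ext1 ω; simp

/-- All cofaces: `dᵢ` as above for `0 ≤ i ≤ n`, and `dₙ₊₁ = t d₀`. -/
noncomputable def cofaceOp (β : RightModuleAlgebra H B) (n : ℕ) (i : Fin (n + 2)) :
    Functional H B n →ₗ[ℂ] Functional H B (n + 1) :=
  Fin.lastCases (motive := fun _ => Functional H B n →ₗ[ℂ] Functional H B (n + 1))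
    (cycOp β (n + 1) ∘ₗ mergeOp n 0) (fun i => mergeOp n i) i

theorem cofaceOp_last (β : RightModuleAlgebra H B) (n : ℕ) (f : Functional H B n) :
    cofaceOp β n (Fin.last (n + 1)) f = cycOp β (n + 1) (mergeOp n 0 f) := by
  simp [cofaceOp]

theorem cofaceOp_castSucc (β : RightModuleAlgebra H B) (n : ℕ) (i : Fin (n + 1))
    (f : Functional H B n) : cofaceOp β n i.castSucc f = mergeOp n i f := by
  simp [cofaceOp]

theorem cofaceOp_zero (β : RightModuleAlgebra H B) (n : ℕ) (f : Functional H B n) :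
    cofaceOp β n 0 f = mergeOp n 0 f := cofaceOp_castSucc β n 0 f

theorem cycOp_coface (β : RightModuleAlgebra H B) (n : ℕ) (i : Fin (n + 1))
    (f : Functional H B n) :
    cycOp β (n + 1) (cofaceOp β n i.succ f) = cofaceOp β n i.castSucc (cycOp β n f) := by
  rw [cofaceOp_castSucc]
  cases i using Fin.lastCases with
  | last => rw [Fin.succ_last, cofaceOp_last]; exact cyc_cyc_face_zero β n f
  | cast i => rw [Fin.succ_castSucc, cofaceOp_castSucc]; exact cyc_face_succ β n i f

theorem mergeOp_mergeOp (n : ℕ) (i j : Fin (n + 1)) (hij : i ≤ j) (f : Functional H B n) :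
    mergeOp (n + 1) j.succ (mergeOp n i f) = mergeOp (n + 1) i.castSucc (mergeOp n j f) := by
  apply LinearMap.ext; intro ω
  exact face_face n i j hij (f ω)

theorem cofaceOp_cofaceOp (β : RightModuleAlgebra H B) (n : ℕ) (i j : Fin (n + 2)) (hij : i ≤ j)
    (f : Functional H B n) :
    cofaceOp β (n + 1) j.succ (cofaceOp β n i f) =
      cofaceOp β (n + 1) i.castSucc (cofaceOp β n j f) := by
  rw [cofaceOp_castSucc]
  cases j using Fin.lastCases with
  | cast j =>
    cases i using Fin.lastCases with
    | last => exact absurd hij (by simp)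
    | cast i =>
      rw [Fin.succ_castSucc, cofaceOp_castSucc, cofaceOp_castSucc, cofaceOp_castSucc]
      exact mergeOp_mergeOp n i j hij f
  | last =>
    rw [Fin.succ_last, cofaceOp_last, cofaceOp_last]
    cases i using Fin.lastCases with
    | last =>
      rw [cofaceOp_last, ← cofaceOp_castSucc β (n + 1) (Fin.last (n + 1)), ← cycOp_coface,
        Fin.succ_last, cofaceOp_last, ← cofaceOp_zero β (n + 1) (cycOp _ _ _),
        ← Fin.castSucc_zero, ← cycOp_coface, Fin.succ_zero_eq_one]
      have : (1 : Fin (n + 3)) = Fin.castSucc (Fin.succ 0) := rfl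
      rw [this, cofaceOp_castSucc, mergeOp_mergeOp n 0 0 le_rfl]; rfl
    | cast i =>
      rw [cofaceOp_castSucc, ← cofaceOp_castSucc β (n + 1) (i.castSucc), ← cycOp_coface,
        Fin.succ_castSucc, cofaceOp_castSucc, mergeOp_mergeOp n 0 i (Fin.zero_le _)]; rfl

variable [InvertibleAntipode H]

/-- `C^n_H(B)`: the functionals `f` with `ω ▷ f = ε(ω) f` for all `ω`. -/
noncomputable def Cochain (β : RightModuleAlgebra H B) (n : ℕ) : Submodule ℂ (Functional H B n) where
  carrier := {f | ∀ ω η, cochainAct β.toRightModule (n + 1) ω f η =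
    Coalgebra.counit (R := ℂ) ω • f η}
  add_mem' {f g} hf hg ω η := by
    have := hf ω η
    have := hg ω η
    simp_all [cochainAct, legs_eq_sw, sw_add_fun]
  zero_mem' ω η := by simp [cochainAct, legs_eq_sw, sw]
  smul_mem' c f hf ω η := by
    have := hf ω η
    simp_all [cochainAct, legs_eq_sw, sw_smul_fun, smul_comm c]

theorem mem_Cochain (β : RightModuleAlgebra H B) (n : ℕ) (f : Functional H B n) :
    f ∈ Cochain β n ↔ ∀ ω η, sw (fun a b => tensorAct β.toRightModule (n + 1) (f (η * a)) b) ω =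
      f (ω * η) :=
  invariant_iff _ _

theorem cycOp_mem (β : RightModuleAlgebra H B) (n : ℕ) {f : Functional H B n}
    (hf : f ∈ Cochain β n) : cycOp β n f ∈ Cochain β n := by
  rw [mem_Cochain] at hf ⊢
  exact cyc_invariant _ _ _ hf

theorem mergeOp_mem (β : RightModuleAlgebra H B) (n : ℕ) (i : Fin (n + 1)) {f : Functional H B n}
    (hf : f ∈ Cochain β n) : mergeOp n i f ∈ Cochain β (n + 1) := by
  rw [mem_Cochain] at hf ⊢
  intro ω η
  change sw (fun a b => tensorAct _ _ (face n i (f (η * a))) b) ω = face n i (f (ω * η))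
  rw [← hf, map_sw]
  simp only [tensorAct_face]

theorem cofaceOp_mem (β : RightModuleAlgebra H B) (n : ℕ) (i : Fin (n + 2)) {f : Functional H B n}
    (hf : f ∈ Cochain β n) : cofaceOp β n i f ∈ Cochain β (n + 1) := by
  cases i using Fin.lastCases with
  | last => rw [cofaceOp_last]; exact cycOp_mem β _ (mergeOp_mem β _ _ hf)
  | cast i => rw [cofaceOp_castSucc]; exact mergeOp_mem β _ _ hf

/-- The spaces `C^n_H(B)` with their cofaces and cyclic operators; `HC^n_H(B)` is the cyclic
cohomology `(equivariantCochains β).HC n`. -/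
noncomputable def equivariantCochains (β : RightModuleAlgebra H B) :
    PrecocyclicModule.{max u v} where
  C n := Cochain β n
  d n i := (cofaceOp β n i).restrict fun _ hf => cofaceOp_mem β n i hf
  t n := (cycOp β n).restrict fun _ hf => cycOp_mem β n hf
  d_d n i j hij f := Subtype.ext (cofaceOp_cofaceOp β n i j hij f)
  t_d n i f := Subtype.ext (cycOp_coface β n i f)
  t_d_zero n f := Subtype.ext (by
    change cycOp β (n + 1) (cofaceOp β n 0 f) = cofaceOp β n (Fin.last (n + 1)) f
    rw [cofaceOp_last, cofaceOp_zero])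
  t_pow n := by
    apply LinearMap.ext; intro f
    apply Subtype.ext
    have h : ∀ k (f : Cochain β n), (((cycOp β n).restrict (fun _ hf => cycOp_mem β n hf) ^ k) f :
        Functional H B n) = (cyc β.toRightModule n)^[k] f := fun k => by
      induction k with
      | zero => intro f; rfl
      | succ k ih =>
        intro f
        rw [pow_succ, Module.End.mul_apply, ih, Function.iterate_succ_apply]; rfl
    rw [h, cyc_pow _ _ _ ((mem_Cochain β n f.1).1 f.2)]
    rfl

end Cochains

section EndTensor
variable {H : Type*} [Ring H] [HopfAlgebra ℂ H]
  {X : Type*} [AddCommGroup X] [Module ℂ X] {V : Type*} [AddCommGroup V] [Module ℂ V]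

/-- `π_X : H → End(X)`, `π_X(ω) x = x ◁ ω` -/
noncomputable def RightModule.pi (χ : RightModule H X) : H →ₗ[ℂ] Module.End ℂ X := χ.act.flip

theorem RightModule.pi_one (χ : RightModule H X) : χ.pi 1 = 1 := by
  ext x; exact χ.act_one x

theorem RightModule.pi_mul (χ : RightModule H X) (a b : H) : χ.pi (a * b) = χ.pi b * χ.pi a := by
  ext x; exact χ.act_mul x a b

variable [InvertibleAntipode H]

theorem counit_antipodeInv (ω : H) :
    Coalgebra.counit (R := ℂ) (antipodeInv H ω) = Coalgebra.counit (R := ℂ) ω := by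
  rw [← HopfAlgebra.counit_antipode, antipode_antipodeInv]

/-- `π_X S⁻¹` -/
noncomputable def RightModule.piS (χ : RightModule H X) : H →ₗ[ℂ] Module.End ℂ X :=
  χ.pi ∘ₗ antipodeInv H

theorem RightModule.piS_one (χ : RightModule H X) : χ.piS 1 = 1 := by
  simp [RightModule.piS, antipodeInv_one, χ.pi_one]

theorem RightModule.piS_mul (χ : RightModule H X) (a b : H) :
    χ.piS (a * b) = χ.piS a * χ.piS b := by
  simp [RightModule.piS, antipodeInv_mul, χ.pi_mul]

theorem RightModule.sw_piS_mul_pi (χ : RightModule H X) (ω : H) :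
    sw (fun a b => χ.piS a * χ.pi b) ω = Coalgebra.counit (R := ℂ) ω • 1 := by
  have := congrArg χ.pi (sw_mul_antipodeInv ω)
  rw [map_sw, map_smul, χ.pi_one] at this
  simp only [χ.pi_mul] at this; exact this

theorem RightModule.sw_pi_mul_piS (χ : RightModule H X) (ω : H) :
    sw (fun a b => χ.pi a * χ.piS b) ω = Coalgebra.counit (R := ℂ) ω • 1 := by
  have := congrArg χ.pi (sw_antipodeInv_mul ω)
  rw [map_sw, map_smul, χ.pi_one] at this
  simp only [χ.pi_mul] at this; exact this

/-- `T ↦ π_X(u) T π_X S⁻¹(w)` -/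
noncomputable def RightModule.conj (χ : RightModule H X) :
    H →ₗ[ℂ] H →ₗ[ℂ] Module.End ℂ X →ₗ[ℂ] Module.End ℂ X :=
  LinearMap.mk₂ ℂ (fun u w => LinearMap.mulLeft ℂ (χ.pi u) ∘ₗ LinearMap.mulRight ℂ (χ.piS w))
    (by intros; ext1; simp [add_mul]) (by intros; ext1; simp)
    (by intros; ext1; simp [mul_add]) (by intros; ext1; simp)

theorem RightModule.conj_apply (χ : RightModule H X) (u w : H) (T : Module.End ℂ X) :
    χ.conj u w T = χ.pi u * T * χ.piS w := by
  simp [RightModule.conj, mul_assoc]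

theorem contraction (χ : RightModule H X) (Γ : H → Module.End ℂ X → H → V)
    (h1 : ∀ M y, IsLinearMap ℂ fun a => Γ a M y) (h2 : ∀ a y, IsLinearMap ℂ fun M => Γ a M y)
    (h3 : ∀ a M, IsLinearMap ℂ fun y => Γ a M y) (ω : H) :
    sw (fun p q => sw (fun a c => sw (fun e y => Γ a (χ.piS c * χ.pi e) y) q) p) ω =
      sw (fun a y => Γ a 1 y) ω := by
  have hc : ∀ a y, IsLinearMap ℂ fun c => Γ a (χ.piS c) y := fun a y =>
    ((h2 a y).mk' ∘ₗ χ.piS).isLinear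
  have h2l : ∀ a y N, IsLinearMap ℂ fun c => Γ a (χ.piS c * N) y := fun a y N =>
    ((h2 a y).mk' ∘ₗ LinearMap.mulRight ℂ N ∘ₗ χ.piS).isLinear
  have h2r : ∀ a y N, IsLinearMap ℂ fun c => Γ a (N * χ.pi c) y := fun a y N =>
    ((h2 a y).mk' ∘ₗ LinearMap.mulLeft ℂ N ∘ₗ χ.pi).isLinear
  rw [sw_assoc (F := fun a c q => sw (fun e y => Γ a (χ.piS c * χ.pi e) y) q)]
  · congr; ext a q
    rw [← sw_assoc (F := fun c e y => Γ a (χ.piS c * χ.pi e) y)]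
    · rw [← sw_counit_left (h3 a 1)]
      congr; ext r y
      have := map_sw (h2 a y).mk' (fun c e => χ.piS c * χ.pi e) r
      simp only [IsLinearMap.mk'_apply] at this
      rw [← this, χ.sw_piS_mul_pi, (h2 a y).map_smul]
    · exact ⟨fun y => ⟨fun _ => h2l _ _ _, fun _ => h2r _ _ _⟩, fun _ _ => h3 _ _⟩
  · exact ⟨fun q => ⟨fun c => isLinearMap_sw (fun _ _ => h1 _ _) _,
      fun a => isLinearMap_sw (fun _ _ => h2l _ _ _) _⟩,
      fun a c => Bil.sw_lin ⟨fun _ => h2r _ _ _, fun _ => h3 _ _⟩⟩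

variable {B : Type*} [Ring B] [Algebra ℂ B]

/-- `(T ⊗ b) ↦ π_X(ω₍₀₎) T π_X S⁻¹(ω₍₂₎) ⊗ b ◁ ω₍₁₎` -/
noncomputable def endAct (χ : RightModule H X) (ρ : RightModule H B) :
    H →ₗ[ℂ] Module.End ℂ (Module.End ℂ X ⊗[ℂ] B) :=
  legs (V := Module.End ℂ (Module.End ℂ X ⊗[ℂ] B))
    { toFun := fun u => legs (V := Module.End ℂ (Module.End ℂ X ⊗[ℂ] B))
        (LinearMap.mk₂ ℂ (fun v w => TensorProduct.map (χ.conj u w) (ρ.act.flip v))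
          (by intros; simp [TensorProduct.map_add_right])
          (by intros; simp [TensorProduct.map_smul_right])
          (by intros; simp [TensorProduct.map_add_left])
          (by intros; simp [TensorProduct.map_smul_left]))
      map_add' := fun a b => by
        apply LinearMap.ext; intro ω
        simp [legs_eq_sw, sw_add_fun, TensorProduct.map_add_left]
      map_smul' := fun c b => by
        apply LinearMap.ext; intro ω
        simp [legs_eq_sw, sw_smul_fun, TensorProduct.map_smul_left] }

theorem endAct_tmul (χ : RightModule H X) (ρ : RightModule H B) (ω : H) (T : Module.End ℂ X)
    (b : B) : endAct χ ρ ω (T ⊗ₜ b) = sw (fun u y => sw (fun v w =>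
      (χ.pi u * T * χ.piS w) ⊗ₜ[ℂ] ρ.act b v) y) ω := by
  simp [endAct, legs_eq_sw, sw_linApply, RightModule.conj_apply]

/-- The right `H`-module `End(X) ⊗ B`. -/
noncomputable def endModule (χ : RightModule H X) (ρ : RightModule H B) :
    RightModule H (Module.End ℂ X ⊗[ℂ] B) where
  act := (endAct χ ρ).flip
  act_one z := by
    induction z with
    | zero => simp
    | add x y hx hy => rw [map_add, LinearMap.add_apply, hx, hy]
    | tmul T b =>
      rw [LinearMap.flip_apply, endAct_tmul, sw_one, sw_one]
      · simp [χ.pi_one, χ.piS_one, ρ.act_one]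
      · apply Bil.of <;> intros <;>
          simp [mul_add, TensorProduct.add_tmul, TensorProduct.tmul_add, TensorProduct.smul_tmul']
      · refine ⟨fun y => isLinearMap_sw (fun _ _ => ?_) _, fun u => Bil.sw_lin ?_⟩
        · constructor <;> intros <;>
            simp [add_mul, TensorProduct.add_tmul, TensorProduct.smul_tmul']
        · apply Bil.of <;> intros <;>
            simp [mul_add, TensorProduct.add_tmul, TensorProduct.tmul_add,
              TensorProduct.smul_tmul']
  act_mul z ω η := by
    induction z with
    | zero => simp
    | add x y hx hy =>
      simp only [map_add, LinearMap.add_apply] at hx hy ⊢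
      rw [hx, hy]
    | tmul T b =>
      simp only [LinearMap.flip_apply, endAct_tmul, map_sw]
      rw [sw_mul]
      · congr; ext u y
        conv_rhs => rw [sw_comm]
        congr; ext u' y'
        rw [sw_mul]
        · simp only [χ.pi_mul, χ.piS_mul, ρ.act_mul, mul_assoc]
        · apply Bil.of <;> intros <;>
            simp [mul_add, TensorProduct.add_tmul, TensorProduct.tmul_add,
              TensorProduct.smul_tmul']
      · refine ⟨fun y => isLinearMap_sw (fun _ _ => ?_) _, fun u => Bil.sw_lin ?_⟩
        · constructor <;> intros <;>
            simp [add_mul, TensorProduct.add_tmul, TensorProduct.smul_tmul']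
        · apply Bil.of <;> intros <;>
            simp [mul_add, TensorProduct.add_tmul, TensorProduct.tmul_add,
              TensorProduct.smul_tmul']

theorem endModule_act_tmul (χ : RightModule H X) (ρ : RightModule H B) (ω : H)
    (T : Module.End ℂ X) (b : B) :
    (endModule χ ρ).act (T ⊗ₜ b) ω = sw (fun u y => sw (fun v w =>
      (χ.pi u * T * χ.piS w) ⊗ₜ[ℂ] ρ.act b v) y) ω := endAct_tmul χ ρ ω T b

theorem contraction' (χ : RightModule H X) (Γ : H → H → Module.End ℂ X → H → H → V)
    (h1 : ∀ v M d f, IsLinearMap ℂ fun u => Γ u v M d f)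
    (h2 : ∀ u M d f, IsLinearMap ℂ fun v => Γ u v M d f)
    (h3 : ∀ u v d f, IsLinearMap ℂ fun M => Γ u v M d f)
    (h4 : ∀ u v M f, IsLinearMap ℂ fun d => Γ u v M d f)
    (h5 : ∀ u v M d, IsLinearMap ℂ fun f => Γ u v M d f) (ω : H) :
    sw (fun p q => sw (fun u y => sw (fun v w => sw (fun c x => sw (fun d f =>
      Γ u v (χ.piS w * χ.pi c) d f) x) q) y) p) ω =
    sw (fun u y => sw (fun m f => sw (fun v d => Γ u v 1 d f) m) y) ω := by
  have hl : ∀ u v w d f, IsLinearMap ℂ fun c => Γ u v (χ.piS w * χ.pi c) d f := fun u v w d f =>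
    ((h3 u v d f).mk' ∘ₗ LinearMap.mulLeft ℂ (χ.piS w) ∘ₗ χ.pi).isLinear
  have hr : ∀ u v c d f, IsLinearMap ℂ fun w => Γ u v (χ.piS w * χ.pi c) d f := fun u v c d f =>
    ((h3 u v d f).mk' ∘ₗ LinearMap.mulRight ℂ (χ.pi c) ∘ₗ χ.piS).isLinear
  have e1 := contraction χ (fun a M x => sw (fun u v => sw (fun d f => Γ u v M d f) x) a)
    (fun M y => Bil.sw_lin ⟨fun _ => isLinearMap_sw (fun _ _ => h1 _ _ _ _) _,
      fun _ => isLinearMap_sw (fun _ _ => h2 _ _ _ _) _⟩)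
    (fun a y => isLinearMap_sw (fun _ _ => isLinearMap_sw (fun _ _ => h3 _ _ _ _) _) _)
    (fun a M => isLinearMap_sw (fun _ _ => Bil.sw_lin ⟨fun _ => h4 _ _ _ _,
      fun _ => h5 _ _ _ _⟩) _) ω
  have e2 : ∀ p q, sw (fun u y => sw (fun v w => sw (fun c x => sw (fun d f =>
      Γ u v (χ.piS w * χ.pi c) d f) x) q) y) p =
      sw (fun a w => sw (fun c x => sw (fun u v => sw (fun d f =>
        Γ u v (χ.piS w * χ.pi c) d f) x) a) q) p := fun p q => by
    rw [← sw_assoc (F := fun u v w => sw (fun c x => sw (fun d f =>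
      Γ u v (χ.piS w * χ.pi c) d f) x) q)]
    · congr; ext a w
      rw [sw_comm]
    · refine ⟨fun w => ⟨fun _ => isLinearMap_sw (fun _ _ => isLinearMap_sw
        (fun _ _ => h1 _ _ _ _) _) _, fun _ => isLinearMap_sw (fun _ _ => isLinearMap_sw
        (fun _ _ => h2 _ _ _ _) _) _⟩, fun _ _ => isLinearMap_sw (fun _ _ => isLinearMap_sw
        (fun _ _ => hr _ _ _ _ _) _) _⟩
  simp only [e2]
  rw [e1, sw_assoc (F := fun u v x => sw (fun d f => Γ u v 1 d f) x)]
  · congr; ext u y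
    rw [← sw_assoc (F := fun v d f => Γ u v 1 d f)]
    exact ⟨fun _ => ⟨fun _ => h2 _ _ _ _, fun _ => h4 _ _ _ _⟩, fun _ _ => h5 _ _ _ _⟩
  · exact ⟨fun x => ⟨fun _ => isLinearMap_sw (fun _ _ => h1 _ _ _ _) _,
      fun _ => isLinearMap_sw (fun _ _ => h2 _ _ _ _) _⟩,
      fun _ _ => Bil.sw_lin ⟨fun _ => h4 _ _ _ _, fun _ => h5 _ _ _ _⟩⟩

/-- The right `H`-module algebra `End(X) ⊗ B` with the action
`(T ⊗ b) ◁ ω = π_X(ω₍₀₎) T π_X S⁻¹(ω₍₂₎) ⊗ b ◁ ω₍₁₎`. -/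
noncomputable def endModuleAlgebra (χ : RightModule H X) (β : RightModuleAlgebra H B) :
    RightModuleAlgebra H (Module.End ℂ X ⊗[ℂ] B) where
  toRightModule := endModule χ β.toRightModule
  mul_act z z' ω := by
    rw [legs_eq_sw]
    change _ = sw (fun a b => (endModule χ β.toRightModule).act z a *
      (endModule χ β.toRightModule).act z' b) ω
    induction z with
    | zero => simp [sw]
    | add x y hx hy => simp only [add_mul, map_add, LinearMap.add_apply, hx, hy, sw_add_fun]
    | tmul T b =>
    induction z' with
    | zero => simp [sw]
    | add x y hx hy => simp only [mul_add, map_add, LinearMap.add_apply, hx, hy, sw_add_fun]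
    | tmul R c =>
    rw [Algebra.TensorProduct.tmul_mul_tmul]
    have hm : ∀ (z : Module.End ℂ X ⊗[ℂ] B) F (ω : H), sw F ω * z =
      sw (fun a b => F a b * z) ω := fun z F ω => by simp [sw, Finset.sum_mul]
    have hm' : ∀ (z : Module.End ℂ X ⊗[ℂ] B) F (ω : H), z * sw F ω =
      sw (fun a b => z * F a b) ω := fun z F ω => by simp [sw, Finset.mul_sum]
    simp only [endModule_act_tmul, hm, hm', Algebra.TensorProduct.tmul_mul_tmul]
    have := contraction' χ (fun u v M d f =>
      (χ.pi u * T * M * R * χ.piS f) ⊗ₜ[ℂ] (β.act b v * β.act c d)) ?_ ?_ ?_ ?_ ?_ ω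
    · simp only [mul_assoc, one_mul] at this ⊢
      rw [this]
      congr; ext u y; congr; ext m f
      rw [β.mul_act']
      rw [← TensorProduct.mk_apply, map_sw]; rfl
    all_goals
      intros; constructor <;> intros <;>
        simp [mul_add, add_mul, TensorProduct.add_tmul, TensorProduct.tmul_add,
              TensorProduct.smul_tmul']
  one_act ω := by
    rw [Algebra.TensorProduct.one_def, endModule_act_tmul]
    simp only [β.one_act, mul_one, TensorProduct.tmul_smul]
    have h : ∀ u, IsLinearMap ℂ fun w => (χ.pi u * χ.piS w) ⊗ₜ[ℂ] (1 : B) := fun u => by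
      constructor <;> intros <;> simp [mul_add, TensorProduct.add_tmul, TensorProduct.smul_tmul']
    have := congrArg ((TensorProduct.mk ℂ (Module.End ℂ X) B).flip 1) (χ.sw_pi_mul_piS ω)
    rw [map_sw, map_smul] at this
    simp only [sw_counit_left (h _)]
    exact this
end EndTensor

section Psi

/-- `Multi` for algebras. -/
abbrev RMulti (B : Type*) [Ring B] [Algebra ℂ B] (n : ℕ)
    (V : Type*) [AddCommGroup V] [Module ℂ V] := Multi B n V

variable {H : Type*} [Ring H] [HopfAlgebra ℂ H]
  {X : Type*} [AddCommGroup X] [Module ℂ X] {B : Type*} [Ring B] [Algebra ℂ B]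
  {V : Type*} [AddCommGroup V] [Module ℂ V] {W : Type*} [AddCommGroup W] [Module ℂ W]

theorem ext_curryLeft_tmul (n : ℕ) {g g' : RMulti (Module.End ℂ X ⊗[ℂ] B) (n + 1) V}
    (h : ∀ T b, g.curryLeft (T ⊗ₜ b) = g'.curryLeft (T ⊗ₜ b)) : g = g' := by
  apply ext_curryLeft
  intro c
  induction c with
  | zero => simp
  | tmul T b => exact h T b
  | add x y hx hy => rw [map_add, map_add, hx, hy]

/-- `spread n g (T₁ ⊗ b₁, …, Tₙ ⊗ bₙ) = g (b₁, …, bₙ) • T₁ ⋯ Tₙ` -/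
noncomputable def spread : ∀ n : ℕ, Multi B n ℂ →ₗ[ℂ]
    RMulti (Module.End ℂ X ⊗[ℂ] B) n (Module.End ℂ X)
  | 0 =>
    { toFun := fun g => MultilinearMap.constOfIsEmpty ℂ _ (g 0 • 1)
      map_add' := fun g g' => by ext1; simp [add_smul]
      map_smul' := fun c g => by ext1; simp [mul_smul] }
  | n + 1 =>
    { toFun := fun g => LinearMap.uncurryLeft (TensorProduct.lift (LinearMap.mk₂ ℂ
        (fun T b => (LinearMap.mulLeft ℂ T).compMultilinearMap (spread n (g.curryLeft b)))
        (by intros; ext1; simp [add_mul]) (by intros; ext1; simp)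
        (by intros; ext1; simp) (by intros; ext1; simp)))
      map_add' := fun g g' => by
        apply ext_curryLeft_tmul; intro T b
        ext1 x
        change LinearMap.mulLeft ℂ T (spread n ((g + g').curryLeft b) x) =
          LinearMap.mulLeft ℂ T (spread n (g.curryLeft b) x) +
          LinearMap.mulLeft ℂ T (spread n (g'.curryLeft b) x)
        simp [curryLeft_add, mul_add]
      map_smul' := fun c g => by
        apply ext_curryLeft_tmul; intro T b
        ext1 x
        change LinearMap.mulLeft ℂ T (spread n ((c • g).curryLeft b) x) =
          c • LinearMap.mulLeft ℂ T (spread n (g.curryLeft b) x)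
        simp [curryLeft_smul] }

theorem spread_zero (g : Multi B 0 ℂ) (x : Fin 0 → Module.End ℂ X ⊗[ℂ] B) :
    spread 0 g x = g 0 • 1 := rfl

theorem spread_curryLeft (n : ℕ) (g : Multi B (n + 1) ℂ) (T : Module.End ℂ X) (b : B) :
    (spread (n + 1) g).curryLeft (T ⊗ₜ b) =
      (LinearMap.mulLeft ℂ T).compMultilinearMap (spread n (g.curryLeft b)) := rfl

theorem spread_tmul (n : ℕ) (g : Multi B n ℂ) (T : Fin n → Module.End ℂ X) (b : Fin n → B) :
    spread n g (fun i => T i ⊗ₜ b i) = g b • (List.ofFn T).prod := by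
  induction n with
  | zero => rw [spread_zero]; simp [Subsingleton.elim b 0]
  | succ n ih =>
    rw [← Fin.cons_self_tail (fun i => T i ⊗ₜ[ℂ] b i), apply_cons, spread_curryLeft,
      LinearMap.compMultilinearMap_apply]
    change LinearMap.mulLeft ℂ (T 0) (spread n _ (fun i => (T i.succ) ⊗ₜ[ℂ] (b i.succ))) = _
    rw [ih, ← apply_cons, List.ofFn_succ, List.prod_cons, map_smul]
    congr 2
    exact Fin.cons_self_tail b

theorem ext_fixLast_tmul (n : ℕ) {g g' : RMulti (Module.End ℂ X ⊗[ℂ] B) (n + 1) V}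
    (h : ∀ T b, fixLast n g (T ⊗ₜ b) = fixLast n g' (T ⊗ₜ b)) : g = g' := by
  apply ext_fixLast
  intro c
  induction c with
  | zero => have := fun g : RMulti (Module.End ℂ X ⊗[ℂ] B) (n + 1) V => fixLast_smul n g 0 (0 : Module.End ℂ X ⊗[ℂ] B)
            simp only [zero_smul] at this
            rw [this, this]
  | tmul T b => exact h T b
  | add x y hx hy => rw [fixLast_add, fixLast_add, hx, hy]

theorem tensorAct_sw (ρ : RightModule H B) (n : ℕ) (F : H → H → Multi B n V) (ω q : H) :
    tensorAct ρ n (sw F ω) q = sw (fun a b => tensorAct ρ n (F a b) q) ω := by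
  rw [map_sw, sw_linApply]

theorem comp_curryLeft (n : ℕ) (L : V →ₗ[ℂ] W) (g : Multi B (n + 1) V) (b : B) :
    (L.compMultilinearMap g).curryLeft b = L.compMultilinearMap (g.curryLeft b) := rfl

theorem comp_fixLast (n : ℕ) (L : V →ₗ[ℂ] W) (g : Multi B (n + 1) V) (b : B) :
    fixLast n (L.compMultilinearMap g) b = L.compMultilinearMap (fixLast n g b) := rfl

theorem comp_sw (n : ℕ) (L : V →ₗ[ℂ] W) (F : H → H → Multi B n V) (ω : H) :
    L.compMultilinearMap (sw F ω) = sw (fun a b => L.compMultilinearMap (F a b)) ω := by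
  ext x; simp [sw]

theorem tensorAct_comp (ρ : RightModule H B) (n : ℕ) (L : V →ₗ[ℂ] W) (g : Multi B n V) (ω : H) :
    tensorAct ρ n (L.compMultilinearMap g) ω = L.compMultilinearMap (tensorAct ρ n g ω) := by
  induction n generalizing ω with
  | zero => ext x; simp [tensorAct_zero]
  | succ n ih =>
    apply ext_curryLeft; intro b
    simp only [tensorAct_succ, comp_curryLeft, comp_sw, ih]

theorem face_comp (n : ℕ) (i : Fin (n + 1)) (L : V →ₗ[ℂ] W) (g : Multi B (n + 1) V) :
    face n i (L.compMultilinearMap g) = L.compMultilinearMap (face n i g) := rfl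

theorem spread_fixLast (n : ℕ) (g : Multi B (n + 1) ℂ) (T : Module.End ℂ X) (b : B) :
    fixLast n (spread (n + 1) g) (T ⊗ₜ b) =
      (LinearMap.mulRight ℂ T).compMultilinearMap (spread n (fixLast n g b)) := by
  induction n with
  | zero =>
    ext1 x
    have e : ∀ z : Module.End ℂ X ⊗[ℂ] B, fixLast 0 (spread 1 g) z x =
      (spread 1 g).curryLeft z x := fun z => by
        rw [fixLast_apply, ← apply_cons]; congr; ext i; fin_cases i; rfl
    rw [e, spread_curryLeft]
    simp only [LinearMap.compMultilinearMap_apply, spread_zero, fixLast_apply, ← apply_cons,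
      map_smul, LinearMap.mulLeft_apply, LinearMap.mulRight_apply, mul_one, one_mul]
    congr 2; ext i; fin_cases i; rfl
  | succ n ih =>
    apply ext_curryLeft_tmul
    intro R c
    rw [fixLast_curryLeft, spread_curryLeft, comp_curryLeft, comp_fixLast, ih, spread_curryLeft,
      fixLast_curryLeft]
    ext1 x; simp [mul_assoc]

theorem spread_face (n : ℕ) (i : Fin (n + 1)) (g : Multi B (n + 1) ℂ) :
    spread (X := X) (n + 2) (face n i g) = face n i (spread (n + 1) g) := by
  have h0 : ∀ n (g : Multi B (n + 1) ℂ),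
      spread (X := X) (n + 2) (face n 0 g) = face n 0 (spread (n + 1) g) := fun n g => by
    apply ext_curryLeft_tmul; intro T b
    apply ext_curryLeft_tmul; intro R c
    rw [face_zero_curryLeft, spread_curryLeft, comp_curryLeft, spread_curryLeft,
      face_zero_curryLeft, Algebra.TensorProduct.tmul_mul_tmul, spread_curryLeft]
    ext1 x; simp [mul_assoc]
  induction n with
  | zero => fin_cases i; exact h0 _ _
  | succ n ih =>
    cases i using Fin.cases with
    | zero => exact h0 _ _
    | succ i =>
      apply ext_curryLeft_tmul; intro T b
      rw [face_succ_curryLeft, spread_curryLeft, face_succ_curryLeft, ih, spread_curryLeft,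
        face_comp]

variable [InvertibleAntipode H]

theorem endModuleAlgebra_act_tmul (χ : RightModule H X) (β : RightModuleAlgebra H B) (ω : H)
    (T : Module.End ℂ X) (b : B) :
    (endModuleAlgebra χ β).act (T ⊗ₜ b) ω = sw (fun u y => sw (fun v w =>
      (χ.pi u * T * χ.piS w) ⊗ₜ[ℂ] β.act b v) y) ω := endAct_tmul χ β.toRightModule ω T b

theorem tensorAct_spread (χ : RightModule H X) (β : RightModuleAlgebra H B) (n : ℕ) (g : Multi B n ℂ)
    (ω : H) : tensorAct (endModuleAlgebra χ β).toRightModule n (spread n g) ω =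
      sw (fun u y => sw (fun v w => (χ.conj u w).compMultilinearMap
        (spread n (tensorAct β.toRightModule n g v))) y) ω := by
  induction n generalizing ω with
  | zero =>
    ext1 x
    simp only [tensorAct_zero, sw_multiApply, LinearMap.compMultilinearMap_apply, map_smul,
      smul_apply, spread_zero, RightModule.conj_apply, mul_one]
    have h : ∀ u, IsLinearMap ℂ fun w => g 0 • (χ.pi u * χ.piS w) := fun u => by
      constructor <;> intros <;> simp [mul_add] <;> rw [smul_comm]
    simp only [sw_counit_left (h _), sw_smul_fun, χ.sw_pi_mul_piS]
    rw [smul_comm]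
  | succ n ih =>
    apply ext_curryLeft_tmul; intro T b
    rw [tensorAct_succ]
    simp only [endModuleAlgebra_act_tmul, map_sw, spread_curryLeft,
      comp_sw, curryLeft_sw, comp_curryLeft, tensorAct_succ]
    have := contraction' χ (fun u v M d f => (LinearMap.mulLeft ℂ (χ.pi u * T * M) ∘ₗ
      LinearMap.mulRight ℂ (χ.piS f)).compMultilinearMap
        (spread n (tensorAct β.toRightModule n (g.curryLeft (β.act b v)) d))) ?_ ?_ ?_ ?_ ?_ ω
    · refine Eq.trans ?_ (this.trans ?_)
      · congr; ext1 u; ext1 v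
        refine (tensorAct_sw (endModuleAlgebra χ β).toRightModule n _ _ _).trans ?_
        congr; ext1 a; ext1 y
        refine (tensorAct_sw (endModuleAlgebra χ β).toRightModule n _ _ _).trans ?_
        congr; ext1 c; ext1 w
        rw [tensorAct_comp, ih, comp_sw]
        congr; ext1 p; ext1 q
        rw [comp_sw]
        congr
      · congr
    all_goals
      intros; constructor <;> intros <;> ext1 <;>
        simp [mul_add, add_mul, mul_assoc]

/-- `T ↦ Tr(π_X S⁻¹(v) T)` -/
noncomputable def trForm (χ : RightModule H X) : H →ₗ[ℂ] Module.End ℂ X →ₗ[ℂ] ℂ :=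
  LinearMap.mk₂ ℂ (fun v T => LinearMap.trace ℂ X (χ.piS v * T))
    (by intros; simp [add_mul]) (by intros; simp)
    (by intros; simp [mul_add]) (by intros; simp)

theorem trForm_apply (χ : RightModule H X) (v : H) (T : Module.End ℂ X) :
    trForm χ v T = LinearMap.trace ℂ X (χ.piS v * T) := rfl

/-- `(Ψ f)(ω, T₀ ⊗ b₀, …, Tₙ ⊗ bₙ) = f (ω₍₀₎, b₀, …, bₙ) Tr(π_X S⁻¹(ω₍₁₎) T₀ ⋯ Tₙ)`, see
`psiFun_tmul`. -/
noncomputable def psiFun (χ : RightModule H X) (n : ℕ) (f : Functional H B n) :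
    Functional H (Module.End ℂ X ⊗[ℂ] B) n :=
  legs (LinearMap.mk₂ ℂ (fun u v => (trForm χ v).compMultilinearMap (spread (n + 1) (f u)))
    (by intros; ext1; simp) (by intros; ext1; simp)
    (by intros; ext1; simp) (by intros; ext1; simp))

theorem psiFun_apply (χ : RightModule H X) (n : ℕ) (f : Functional H B n) (ω : H) :
    psiFun χ n f ω = sw (fun u v => (trForm χ v).compMultilinearMap (spread (n + 1) (f u))) ω := by
  rw [psiFun, legs_eq_sw]; rfl

theorem psiFun_tmul (χ : RightModule H X) (n : ℕ) (f : Functional H B n) (ω : H)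
    (T : Fin (n + 1) → Module.End ℂ X) (b : Fin (n + 1) → B) :
    psiFun χ n f ω (fun i => T i ⊗ₜ b i) =
      sw (fun u v => f u b * LinearMap.trace ℂ X (χ.piS v * (List.ofFn T).prod)) ω := by
  rw [psiFun_apply, sw_multiApply]
  simp only [LinearMap.compMultilinearMap_apply, spread_tmul, map_smul, trForm_apply, smul_eq_mul]

theorem psiFun_merge (χ : RightModule H X) (n : ℕ) (i : Fin (n + 1)) (f : Functional H B n) :
    psiFun χ (n + 1) (mergeOp n i f) = mergeOp n i (psiFun χ n f) := by
  apply LinearMap.ext; intro ω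
  change _ = face n i (psiFun χ n f ω)
  rw [psiFun_apply, psiFun_apply, map_sw]
  congr; ext1 u; ext1 v
  change (trForm χ v).compMultilinearMap (spread (n + 2) (face n i (f u))) = _
  rw [spread_face, face_comp]

theorem psiFun_mem (χ : RightModule H X) (β : RightModuleAlgebra H B) (n : ℕ)
    {f : Functional H B n} (hf : f ∈ Cochain β n) :
    psiFun χ n f ∈ Cochain (endModuleAlgebra χ β) n := by
  rw [mem_Cochain] at hf ⊢
  intro ω η
  have hb : Bil fun u v => (trForm χ v).compMultilinearMap (spread (n + 1) (f u)) := by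
    apply Bil.of <;> intros <;> ext1 <;> simp
  simp only [psiFun_apply, sw_mul hb]
  conv_rhs => rw [sw_comm]
  have key : ∀ a b, sw (fun p q => sw (fun c d => tensorAct (endModuleAlgebra χ β).toRightModule
      (n + 1) ((trForm χ (b * d)).compMultilinearMap (spread (n + 1) (f (a * c)))) q) p) ω =
      sw (fun m h => (trForm χ (h * b)).compMultilinearMap (spread (n + 1) (f (m * a)))) ω := by
    intro a b
    have := contraction χ (fun c M y => sw (fun g h =>
      (LinearMap.trace ℂ X ∘ₗ LinearMap.mulLeft ℂ (χ.piS b * M) ∘ₗ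
        LinearMap.mulRight ℂ (χ.piS h)).compMultilinearMap (spread (n + 1)
          (tensorAct β.toRightModule (n + 1) (f (a * c)) g))) y) ?_ ?_ ?_ ω
    · refine Eq.trans ?_ (this.trans ?_)
      · congr; ext1 p; ext1 q; congr; ext1 c; ext1 d
        rw [tensorAct_comp, tensorAct_spread, comp_sw]
        congr; ext1 e; ext1 y
        rw [comp_sw]
        congr; ext1 g; ext1 h
        ext1 x
        simp [RightModule.conj_apply, mul_assoc, trForm_apply, χ.piS_mul]
      · rw [← sw_assoc (F := fun c g h => (LinearMap.trace ℂ X ∘ₗ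
          LinearMap.mulLeft ℂ (χ.piS b * 1) ∘ₗ LinearMap.mulRight ℂ (χ.piS h)).compMultilinearMap
          (spread (n + 1) (tensorAct β.toRightModule (n + 1) (f (a * c)) g)))]
        · congr; ext1 m; ext1 h
          rw [← hf, map_sw, comp_sw]
          congr; ext1 c; ext1 g
          ext1 x
          simp only [LinearMap.compMultilinearMap_apply, trForm_apply, LinearMap.comp_apply,
            LinearMap.mulLeft_apply, LinearMap.mulRight_apply, χ.piS_mul, mul_one]
          rw [← mul_assoc, LinearMap.trace_mul_comm, ← mul_assoc]
        · apply Tri.of <;> intros <;> ext1 <;> simp [mul_add]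
    · exact fun M y => isLinearMap_sw (fun _ _ => by
        constructor <;> intros <;> ext1 <;> simp [mul_add]) _
    · exact fun M y => isLinearMap_sw (fun _ _ => by
        constructor <;> intros <;> ext1 <;> simp [mul_add, add_mul, mul_assoc]) _
    · exact fun M y => Bil.sw_lin (by
        apply Bil.of <;> intros <;> ext1 <;> simp [mul_add])
  rw [← funext fun a => funext fun b => key a b, sw_comm]
  congr; ext1 p; ext1 q
  refine (tensorAct_sw (endModuleAlgebra χ β).toRightModule (n + 1) _ _ _).trans ?_
  congr; ext1 a; ext1 b
  exact (tensorAct_sw (endModuleAlgebra χ β).toRightModule (n + 1) _ _ _)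

theorem psiFun_cyc (χ : RightModule H X) (β : RightModuleAlgebra H B) (n : ℕ)
    (f : Functional H B n) :
    psiFun χ n (cycOp β n f) = cycOp (endModuleAlgebra χ β) n (psiFun χ n f) := by
  apply LinearMap.ext; intro ω
  change _ = cyc (endModuleAlgebra χ β).toRightModule n (psiFun χ n f) ω
  apply ext_fixLast_tmul; intro T b
  rw [cyc_apply, fixLast_sw]
  simp only [fixLast_rotate, psiFun_apply, endModuleAlgebra_act_tmul, fixLast_sw, comp_fixLast,
    spread_fixLast]
  have := contraction χ (fun a M y => sw (fun v w => (LinearMap.trace ℂ X ∘ₗ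
    LinearMap.mulLeft ℂ M ∘ₗ LinearMap.mulLeft ℂ (T * χ.piS w)).compMultilinearMap
      (spread n ((f a).curryLeft (β.act b v)))) y) ?_ ?_ ?_ ω
  · refine Eq.trans ?_ (this.symm.trans ?_)
    · rw [← sw_assoc (F := fun a v w => (LinearMap.trace ℂ X ∘ₗ
        LinearMap.mulLeft ℂ 1 ∘ₗ LinearMap.mulLeft ℂ (T * χ.piS w)).compMultilinearMap
        (spread n ((f a).curryLeft (β.act b v))))]
      · congr; ext1 p; ext1 w
        change LinearMap.compMultilinearMap _ (LinearMap.compMultilinearMap _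
          (spread n (fixLast n (cyc β.toRightModule n f p) b))) = _
        rw [cyc_apply, fixLast_sw, map_sw, comp_sw, comp_sw]
        congr; ext1 a; ext1 v
        rw [fixLast_rotate]
        ext1 x
        simp only [LinearMap.compMultilinearMap_apply, trForm_apply, LinearMap.comp_apply,
            LinearMap.mulLeft_apply, LinearMap.mulRight_apply, one_mul]
        rw [← mul_assoc, LinearMap.trace_mul_comm, ← mul_assoc]
      · apply Tri.of <;> intros <;> ext1 <;> simp [mul_add, add_mul, mul_assoc, curryLeft_add, curryLeft_smul]
    · congr; ext1 p; ext1 q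
      rw [curryLeft_sw]
      congr; ext1 a; ext1 c
      rw [map_sw]
      congr; ext1 e; ext1 y
      rw [map_sw]
      congr
  · exact fun M y => isLinearMap_sw (fun _ _ => by
        constructor <;> intros <;> ext1 <;> simp [mul_add, curryLeft_add, curryLeft_smul]) _
  · exact fun M y => isLinearMap_sw (fun _ _ => by
        constructor <;> intros <;> ext1 <;> simp [mul_add, add_mul, mul_assoc]) _
  · exact fun M y => Bil.sw_lin (by
        apply Bil.of <;> intros <;> ext1 <;> simp [mul_add, add_mul, mul_assoc])
end Psi

section Morphisms
variable {H : Type*} [Ring H] [HopfAlgebra ℂ H] [InvertibleAntipode H]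
  {X : Type*} [AddCommGroup X] [Module ℂ X] {B : Type*} [Ring B] [Algebra ℂ B]
  {B' : Type*} [Ring B'] [Algebra ℂ B']
  {V : Type*} [AddCommGroup V] [Module ℂ V]

theorem psiFun_add (χ : RightModule H X) (n : ℕ) (f g : Functional H B n) :
    psiFun χ n (f + g) = psiFun χ n f + psiFun χ n g := by
  apply LinearMap.ext; intro ω
  rw [LinearMap.add_apply]
  simp only [psiFun_apply, ← sw_add_fun]
  congr; ext1 u; ext1 v
  ext1 x; simp

theorem psiFun_smul (χ : RightModule H X) (n : ℕ) (c : ℂ) (f : Functional H B n) :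
    psiFun χ n (c • f) = c • psiFun χ n f := by
  apply LinearMap.ext; intro ω
  rw [LinearMap.smul_apply]
  simp only [psiFun_apply, ← sw_smul_fun]
  congr; ext1 u; ext1 v
  ext1 x; simp

theorem psiFun_coface (χ : RightModule H X) (β : RightModuleAlgebra H B) (n : ℕ) (i : Fin (n + 2))
    (f : Functional H B n) :
    psiFun χ (n + 1) (cofaceOp β n i f) = cofaceOp (endModuleAlgebra χ β) n i (psiFun χ n f) := by
  cases i using Fin.lastCases with
  | last => rw [cofaceOp_last, cofaceOp_last, psiFun_cyc, psiFun_merge]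
  | cast i => rw [cofaceOp_castSucc, cofaceOp_castSucc, psiFun_merge]

/-- The morphism `Ψ` from the cochains of `B` to those of `End(X) ⊗ B`. -/
noncomputable def psi (χ : RightModule H X) (β : RightModuleAlgebra H B) :
    PrecocyclicHom (equivariantCochains β) (equivariantCochains (endModuleAlgebra χ β)) where
  app n := LinearMap.restrict
    { toFun := psiFun χ n, map_add' := psiFun_add χ n, map_smul' := psiFun_smul χ n }
    fun _ hf => psiFun_mem χ β n hf
  app_d n i f := Subtype.ext (psiFun_coface χ β n i f.1)
  app_t n f := Subtype.ext (psiFun_cyc χ β n f.1)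

/-- `(b₁, …, bₙ) ↦ g (φ b₁, …, φ bₙ)` -/
noncomputable def pullMulti (φ : B →ₙₐ[ℂ] B') (n : ℕ) : RMulti B' n V →ₗ[ℂ] RMulti B n V where
  toFun g := g.compLinearMap fun _ => (φ : B →ₗ[ℂ] B')
  map_add' _ _ := rfl
  map_smul' _ _ := rfl

theorem pullMulti_apply (φ : B →ₙₐ[ℂ] B') (n : ℕ) (g : RMulti B' n V) (b : Fin n → B) :
    pullMulti φ n g b = g fun i => φ (b i) := rfl

theorem pullMulti_curryLeft (φ : B →ₙₐ[ℂ] B') (n : ℕ) (g : RMulti B' (n + 1) V) (b : B) :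
    (pullMulti φ (n + 1) g).curryLeft b = pullMulti φ n (g.curryLeft (φ b)) := by
  ext x
  rw [← apply_cons, pullMulti_apply, pullMulti_apply, ← apply_cons]
  congr; ext i
  cases i using Fin.cases <;> rfl

theorem pullMulti_fixLast (φ : B →ₙₐ[ℂ] B') (n : ℕ) (g : RMulti B' (n + 1) V) (b : B) :
    fixLast n (pullMulti φ (n + 1) g) b = pullMulti φ n (fixLast n g (φ b)) := by
  ext x
  rw [fixLast_apply, pullMulti_apply, pullMulti_apply, fixLast_apply]
  congr; ext i
  cases i using Fin.lastCases <;> simp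

theorem pullMulti_face (φ : B →ₙₐ[ℂ] B') (n : ℕ) (i : Fin (n + 1)) (g : RMulti B' (n + 1) V) :
    pullMulti φ (n + 2) (face n i g) = face n i (pullMulti φ (n + 1) g) := by
  ext b
  rw [pullMulti_apply, face_apply, face_apply, pullMulti_apply]
  congr; ext j
  simp only [Fin.contractNth]
  split_ifs <;> simp

theorem pullMulti_tensorAct (ρ : RightModule H B) (ρ' : RightModule H B') (φ : B →ₙₐ[ℂ] B')
    (hφ : ∀ b ω, φ (ρ.act b ω) = ρ'.act (φ b) ω) (n : ℕ) (g : RMulti B' n V) (ω : H) :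
    pullMulti φ n (tensorAct ρ' n g ω) = tensorAct ρ n (pullMulti φ n g) ω := by
  induction n generalizing ω with
  | zero => rw [tensorAct_zero, tensorAct_zero, map_smul]
  | succ n ih =>
    apply ext_curryLeft; intro b
    rw [pullMulti_curryLeft, tensorAct_succ, tensorAct_succ, map_sw]
    simp only [ih, pullMulti_curryLeft, hφ]

theorem pullMulti_rotate (ρ : RightModule H B) (ρ' : RightModule H B') (φ : B →ₙₐ[ℂ] B')
    (hφ : ∀ b ω, φ (ρ.act b ω) = ρ'.act (φ b) ω) (n : ℕ) (g : RMulti B' (n + 1) V) (ω : H) :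
    pullMulti φ (n + 1) (rotate ρ' n g ω) = rotate ρ n (pullMulti φ (n + 1) g) ω := by
  apply ext_fixLast; intro b
  rw [pullMulti_fixLast, fixLast_rotate, fixLast_rotate, pullMulti_curryLeft, hφ]

/-- The pullback of functionals along `φ`. -/
noncomputable def pullFun (φ : B →ₙₐ[ℂ] B') (n : ℕ) :
    Functional H B' n →ₗ[ℂ] Functional H B n where
  toFun f := pullMulti φ (n + 1) ∘ₗ f
  map_add' f g := by ext1 ω; simp
  map_smul' c f := by ext1 ω; simp

theorem pullFun_apply (φ : B →ₙₐ[ℂ] B') (n : ℕ) (f : Functional H B' n) (ω : H) :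
    pullFun φ n f ω = pullMulti φ (n + 1) (f ω) := rfl

variable (β : RightModuleAlgebra H B) (β' : RightModuleAlgebra H B') (φ : B →ₙₐ[ℂ] B')

theorem pullFun_cyc (hφ : ∀ b ω, φ (β.act b ω) = β'.act (φ b) ω) (n : ℕ) (f : Functional H B' n) :
    pullFun φ n (cycOp β' n f) = cycOp β n (pullFun φ n f) := by
  apply LinearMap.ext; intro ω
  change pullMulti φ (n + 1) (cyc β'.toRightModule n f ω) =
    cyc β.toRightModule n (pullFun φ n f) ω
  rw [cyc_apply, cyc_apply, map_sw]
  simp only [pullMulti_rotate _ _ φ hφ, pullFun_apply]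

theorem pullFun_coface (hφ : ∀ b ω, φ (β.act b ω) = β'.act (φ b) ω) (n : ℕ) (i : Fin (n + 2)) (f : Functional H B' n) :
    pullFun φ (n + 1) (cofaceOp β' n i f) = cofaceOp β n i (pullFun φ n f) := by
  have h : ∀ i, pullFun φ (n + 1) (mergeOp n i f) = mergeOp n i (pullFun φ n f) := fun i => by
    apply LinearMap.ext; intro ω
    exact pullMulti_face φ n i (f ω)
  cases i using Fin.lastCases with
  | last => rw [cofaceOp_last, cofaceOp_last, pullFun_cyc β β' φ hφ, h]
  | cast i => rw [cofaceOp_castSucc, cofaceOp_castSucc, h]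

theorem pullFun_mem (hφ : ∀ b ω, φ (β.act b ω) = β'.act (φ b) ω) (n : ℕ) {f : Functional H B' n} (hf : f ∈ Cochain β' n) :
    pullFun φ n f ∈ Cochain β n := by
  rw [mem_Cochain] at hf ⊢
  intro ω η
  rw [pullFun_apply, ← hf, map_sw]
  simp only [pullMulti_tensorAct _ _ φ hφ, pullFun_apply]

/-- The morphism induced by an equivariant, not necessarily unital, algebra homomorphism. -/
noncomputable def pullback (hφ : ∀ b ω, φ (β.act b ω) = β'.act (φ b) ω) :
    PrecocyclicHom (equivariantCochains β') (equivariantCochains β) where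
  app n := (pullFun φ n).restrict fun _ hf => pullFun_mem β β' φ hφ n hf
  app_d n i f := Subtype.ext (pullFun_coface β β' φ hφ n i f.1)
  app_t n f := Subtype.ext (pullFun_cyc β β' φ hφ n f.1)

/-- `Φ_p (b) = p ⊗ b` -/
noncomputable def tmulHom (B : Type*) [Ring B] [Algebra ℂ B] (p : Module.End ℂ X) (hp : IsIdempotentElem p) :
    B →ₙₐ[ℂ] Module.End ℂ X ⊗[ℂ] B where
  toFun b := p ⊗ₜ b
  map_smul' c b := by simp
  map_zero' := by simp
  map_add' b c := by simp [TensorProduct.tmul_add]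
  map_mul' b c := by rw [Algebra.TensorProduct.tmul_mul_tmul, hp.eq]

theorem tmulHom_act (χ : RightModule H X) (p : Module.End ℂ X) (hp : IsIdempotentElem p)
    (hl : ∀ ω, χ.pi ω * p = Coalgebra.counit (R := ℂ) ω • p)
    (hr : ∀ ω, p * χ.pi ω = Coalgebra.counit (R := ℂ) ω • p) (b : B) (ω : H) :
    tmulHom B p hp (β.act b ω) = (endModuleAlgebra χ β).act (tmulHom B p hp b) ω := by
  change p ⊗ₜ[ℂ] β.act b ω = (endModuleAlgebra χ β).act (p ⊗ₜ[ℂ] b) ω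
  have hS : ∀ w, p * χ.piS w = Coalgebra.counit (R := ℂ) w • p := fun w => by
    rw [← counit_antipodeInv]; exact hr _
  have e : ∀ u v w, (χ.pi u * p * χ.piS w) ⊗ₜ[ℂ] β.act b v =
      Coalgebra.counit (R := ℂ) u • Coalgebra.counit (R := ℂ) w • p ⊗ₜ[ℂ] β.act b v :=
    fun u v w => by
      rw [hl, smul_mul_assoc, hS, TensorProduct.smul_tmul', TensorProduct.smul_tmul']
  have hL : IsLinearMap ℂ fun v => p ⊗ₜ[ℂ] β.act b v := by
    constructor <;> intros <;> simp [TensorProduct.tmul_add]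
  rw [endModuleAlgebra_act_tmul]
  simp only [e, sw_smul_fun, sw_counit_right hL, sw_counit_left hL]

/-- The morphism from the cochains of `End(X) ⊗ B` to those of `B` induced by `b ↦ p ⊗ b`, for an
idempotent `p` with `π_X(ω) p = p π_X(ω) = ε(ω) p`. -/
noncomputable def phi (χ : RightModule H X) (p : Module.End ℂ X) (hp : IsIdempotentElem p)
    (hl : ∀ ω, χ.pi ω * p = Coalgebra.counit (R := ℂ) ω • p)
    (hr : ∀ ω, p * χ.pi ω = Coalgebra.counit (R := ℂ) ω • p) :
    PrecocyclicHom (equivariantCochains (endModuleAlgebra χ β)) (equivariantCochains β) :=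
  pullback β (endModuleAlgebra χ β) (tmulHom B p hp) (tmulHom_act β χ p hp hl hr)
end Morphisms

section Trivial
variable (H : Type*) [Ring H] [HopfAlgebra ℂ H] (X : Type*) [AddCommGroup X] [Module ℂ X]

/-- The trivial action `x ◁ ω = ε(ω) x`. -/
noncomputable def RightModule.trivial : RightModule H X where
  act := (LinearMap.lsmul ℂ X ∘ₗ Coalgebra.counit).flip
  act_one v := by simp
  act_mul v ω η := by simp [mul_smul, smul_comm (Coalgebra.counit (R := ℂ) ω)]

variable {H X}
theorem RightModule.trivial_pi_mul (p : Module.End ℂ X) (ω : H) :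
    (RightModule.trivial H X).pi ω * p = Coalgebra.counit (R := ℂ) ω • p := by
  ext x; simp [RightModule.pi, RightModule.trivial]

theorem RightModule.mul_trivial_pi (p : Module.End ℂ X) (ω : H) :
    p * (RightModule.trivial H X).pi ω = Coalgebra.counit (R := ℂ) ω • p := by
  ext x; simp [RightModule.pi, RightModule.trivial]
end Trivial

end HopfCyclic

/-! A rank one idempotent has the form `p = ξ(·) x` with `ξ x = 1`. On cochains `Φ_p Ψ = 1`, because
`Tr(p^(n+1)) = ξ x = 1`. It remains to see that `Ψ Φ_p` is the identity in cohomology, that is, that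
every total cocycle killed by `Φ_p` is a coboundary.

The bicomplex lies in the first quadrant, so such a cocycle can be cleared column by column from the
left as soon as every column of `ker Φ_p` is exact (`mem_coboundaries_of_exact`). The vertical
primitives used for this need not be compatible with the cyclic operators. Moreover `Ψ Φ_p` is a
projection commuting with the differentials, so a primitive among all cochains can be corrected to
one in `ker Φ_p` (`mapHC_rightInverse`). Only the vertical complexes have to be studied.

In the odd columns the algebra is unital, and putting `1` in front of the arguments contracts `b'`.
In the even columns `Ψ Φ_p` has to be homotopic to the identity for `b`. Take a basis `eₗ` of `X`
with coordinates `eˡ`, and put `uₗ = ξ(·) eₗ ⊗ 1` and `vₗ = eˡ(·) x ⊗ 1`. Then `∑ uₗ vₗ = 1`,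
whereas `vₖ (T ⊗ b) uₗ = Tₖₗ (p ⊗ b)`. The operators `(Kⱼ f)(b₀, …, bₙ) = ∑ f (b₀ u_{k₁}, v_{k₁} b₁
u_{k₂}, …, v_{kⱼ₋₁} bⱼ₋₁ u_{kⱼ}, v_{kⱼ}, bⱼ, …, bₙ)` satisfy the identities of a presimplicial
homotopy (`b_homotopy`). At one end `K₀ d₀ = 1`. At the other end `Kₙ₊₁ dₙ₊₁ = Ψ Φ_p`: all arguments
have collapsed to matrix entries, and the cyclic last coface closes their chain to `Tr(T₀ ⋯ Tₙ)`
(`insOp_last_dn_last`).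

Triviality of the action on `X` makes every `T ⊗ 1` invariant under `H`. Hence the `Kⱼ` preserve
invariant functionals (`tensorAct_ins`), and `vₗ` passes through the last coface at the cost of a
counit only. -/

namespace HopfCyclic

universe u v

/-! ### Bicomplexes with exact columns, and presimplicial homotopies -/

namespace PrecocyclicModule
variable (M : PrecocyclicModule.{u})

/-- If `Φ` has the section `Ψ` and the columns of the kernel of `Φ` are exact, then every cocycle of
the total complex in the kernel of `Φ` is a coboundary. -/
theorem mem_coboundaries_of_exact {N : PrecocyclicModule.{v}} (Φ : PrecocyclicHom M N)
    (h0 : ∀ p (f : M.C 0), Φ.app 0 f = 0 → M.vert p 0 f = 0 → f = 0)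
    (hs : ∀ p q (f : M.C (q + 1)), Φ.app (q + 1) f = 0 → M.vert p (q + 1) f = 0 →
      ∃ g, Φ.app q g = 0 ∧ M.vert p q g = f)
    {n : ℕ} {x : M.Bigraded} (hx : x ∈ M.cocycles n) (hΦ : ∀ p q, Φ.app q (x p q) = 0) :
    x ∈ M.coboundaries n := by
  -- Induction on the number `k` of columns still to be cleared; the columns left of `p₀` already
  -- vanish. For `k = 0` nothing is left, since total degree `n` meets only the columns `0, …, n`.
  have key : ∀ k p₀, k + p₀ = n + 1 → ∀ x : M.Bigraded, x ∈ M.cocycles n →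
      (∀ p q, Φ.app q (x p q) = 0) → (∀ p q, p < p₀ → x p q = 0) → x ∈ M.coboundaries n := by
    intro k
    induction k with
    | zero =>
      intro p₀ hp x hx _ hv
      have : x = 0 := by
        funext p q
        by_cases h : p < p₀
        · exact hv p q h
        · exact hx.1 p q (by omega)
      rw [this]; exact zero_mem _
    | succ k ih =>
      intro p₀ hp x hx hΦ hv
      have hd : M.totD x = 0 := hx.2
      -- The first surviving column is vertically closed: the cocycle equation there has no
      -- horizontal contribution, as the column before it vanishes.
      have hvert : ∀ q, M.vert p₀ q (x p₀ q) = 0 := by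
        intro q
        have := congrFun (congrFun hd p₀) (q + 1)
        rcases p₀ with _ | p₀
        · exact this
        · simpa [totD, hv p₀ (q + 1) (by omega)] using this
      rcases k with _ | k
      -- Here `p₀ = n`, the entry sits in row `0`, and exactness means that it is already zero.
      · refine ih (p₀ + 1) (by omega) x hx hΦ fun p q hpq => ?_
        rcases Nat.lt_succ_iff_lt_or_eq.1 hpq with h | rfl
        · exact hv p q h
        · rcases q with _ | q
          · exact h0 p _ (hΦ p 0) (hvert 0)
          · exact hx.1 _ _ (by omega)
      · obtain ⟨m, rfl⟩ : ∃ m, n = m + 1 := ⟨n - 1, by omega⟩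
        have hk : k + p₀ = m := by omega
        obtain ⟨g, hg, hgx⟩ := hs p₀ k _ (hΦ p₀ (k + 1)) (hvert (k + 1))
        -- The vertical primitive `g`, placed at `(p₀, k)`. Its total differential lives in the
        -- columns `p₀` and `p₀ + 1` only, so subtracting it clears column `p₀` and leaves the
        -- earlier columns zero.
        let y : M.Bigraded := fun p q => if h : p = p₀ ∧ q = k then h.2 ▸ g else 0
        have hyg : y p₀ k = g := by simp [y]
        have hy0 : ∀ p q, ¬ (p = p₀ ∧ q = k) → y p q = 0 := fun p q h => by simp [y, h]
        have hym : y ∈ M.Tot m := fun p q h => hy0 p q (by rintro ⟨rfl, rfl⟩; omega)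
        have hyΦ : Φ.bigraded y = 0 := by
          funext p q
          change Φ.app q (y p q) = 0
          by_cases h : p = p₀ ∧ q = k
          · obtain ⟨rfl, rfl⟩ := h; rw [hyg, hg]
          · rw [hy0 p q h, map_zero]
        have hc : M.totD y ∈ M.coboundaries (m + 1) := ⟨y, hym, rfl⟩
        have : x - M.totD y ∈ M.coboundaries (m + 1) := by
          refine ih (p₀ + 1) (by omega) _ (sub_mem hx (M.coboundaries_le _ hc)) ?_ ?_
          -- The corrected cocycle is still killed by `Φ`, because `Φ` kills `y` and commutes with
          -- the total differential.
          · intro p q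
            have := congrFun (congrFun (Φ.bigraded_totD y) p) q
            rw [hyΦ, map_zero] at this
            change Φ.app q (M.totD y p q) = 0 at this
            rw [Pi.sub_apply, Pi.sub_apply, map_sub, hΦ, this, sub_zero]
          · intro p q hpq
            rw [Pi.sub_apply, Pi.sub_apply, sub_eq_zero]
            rcases Nat.lt_succ_iff_lt_or_eq.1 hpq with h | rfl
            · rw [hv p q h]
              rcases p with _ | p <;> rcases q with _ | q
              · rfl
              · simp [totD, hy0 0 q (by omega)]
              · simp [totD, hy0 p 0 (by omega)]
              · simp [totD, hy0 p (q + 1) (by omega), hy0 (p + 1) q (by omega)]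
            · by_cases hq : q = k + 1
              · subst hq
                rcases p with _ | p
                · simp [totD, hyg, hgx]
                · simp [totD, hyg, hgx, hy0 p (k + 1) (by omega)]
              · rw [hx.1 p q (by omega)]
                exact (M.totD_mem hym p q (by omega)).symm
        simpa using add_mem this hc
  exact key (n + 1) 0 rfl x hx hΦ (by simp)

/-- The combinatorics that turns a presimplicial homotopy into a chain homotopy. -/
theorem alt_sum_homotopy {A : Type*} [AddCommGroup A] [Module ℂ A] (N : ℕ) (e D : ℕ → ℕ → A)
    (P : ℕ → A) (hlt : ∀ i j, i < j + 1 → j < N → e (j + 1) i = D j i)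
    (hgt : ∀ i j, j < i → i < N + 1 → e j (i + 1) = D j i)
    (hP : ∀ j, j < N + 1 → e j j = P j) (hP' : ∀ j, j < N + 1 → e j (j + 1) = P (j + 1)) :
    ∑ j ∈ Finset.range (N + 1), ∑ i ∈ Finset.range (N + 2), (-1 : ℂ) ^ (i + j) • e j i =
      P 0 - P (N + 1) - ∑ j ∈ Finset.range N, ∑ i ∈ Finset.range (N + 1),
        (-1 : ℂ) ^ (i + j) • D j i := by
  -- Each row is cut into `i < j`, the two middle terms `i = j` and `i = j + 1`, and `i > j + 1`.
  -- The middle terms give `P j - P (j + 1)` and telescope over `j`. The last range is shifted by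
  -- one, which changes the sign and turns `e` into `D`.
  have row : ∀ j, j < N + 1 → ∑ i ∈ Finset.range (N + 2), (-1 : ℂ) ^ (i + j) • e j i =
      ∑ i ∈ Finset.range j, (-1 : ℂ) ^ (i + j) • e j i + (P j - P (j + 1)) -
        ∑ i ∈ Finset.Ico (j + 1) (N + 1), (-1 : ℂ) ^ (i + j) • D j i := fun j hj => by
    rw [Finset.range_eq_Ico, ← Finset.sum_Ico_consecutive _ (Nat.zero_le j) (by omega : j ≤ N + 2),
      Finset.sum_eq_sum_Ico_succ_bot (by omega : j < N + 2),
      Finset.sum_eq_sum_Ico_succ_bot (by omega : j + 1 < N + 2), hP j hj, hP' j hj,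
      ← Finset.sum_Ico_add' (fun i => (-1 : ℂ) ^ (i + j) • e j i) (j + 1) (N + 1) 1]
    have h1 : (-1 : ℂ) ^ (j + j) = 1 := Even.neg_one_pow ⟨j, rfl⟩
    have h2 : (-1 : ℂ) ^ (j + 1 + j) = -1 := Odd.neg_one_pow ⟨j, by ring⟩
    have h3 : ∑ i ∈ Finset.Ico (j + 1) (N + 1), (-1 : ℂ) ^ (i + 1 + j) • e j (i + 1) =
        -∑ i ∈ Finset.Ico (j + 1) (N + 1), (-1 : ℂ) ^ (i + j) • D j i := by
      rw [← Finset.sum_neg_distrib]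
      refine Finset.sum_congr rfl fun i hi => ?_
      have := Finset.mem_Ico.1 hi
      rw [hgt i j (by omega) (by omega), add_right_comm, pow_succ]; simp
    rw [h1, h2, h3, one_smul, neg_one_smul, ← Finset.range_eq_Ico]
    abel
  rw [Finset.sum_congr rfl fun j hj => row j (Finset.mem_range.1 hj), Finset.sum_sub_distrib,
    Finset.sum_add_distrib, Finset.sum_range_sub', Finset.sum_range_succ', Finset.sum_range_succ _ N]
  -- The part `i < j` is shifted by one in `j` instead, with the same change of sign. The two
  -- shifted parts together fill the whole rectangle of the terms `D j i`.
  have hl : ∀ j ∈ Finset.range N,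
      ∑ i ∈ Finset.range (j + 1), (-1 : ℂ) ^ (i + (j + 1)) • e (j + 1) i =
      -∑ i ∈ Finset.range (j + 1), (-1 : ℂ) ^ (i + j) • D j i := fun j hj => by
    rw [← Finset.sum_neg_distrib]
    refine Finset.sum_congr rfl fun i hi => ?_
    rw [hlt i j (Finset.mem_range.1 hi) (Finset.mem_range.1 hj), ← add_assoc, pow_succ]; simp
  have hr : ∀ j ∈ Finset.range N, ∑ i ∈ Finset.range (N + 1), (-1 : ℂ) ^ (i + j) • D j i =
      ∑ i ∈ Finset.range (j + 1), (-1 : ℂ) ^ (i + j) • D j i +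
      ∑ i ∈ Finset.Ico (j + 1) (N + 1), (-1 : ℂ) ^ (i + j) • D j i := fun j hj => by
    have := Finset.mem_range.1 hj
    rw [Finset.range_eq_Ico, Finset.range_eq_Ico,
      Finset.sum_Ico_consecutive _ (Nat.zero_le _) (by omega : j + 1 ≤ N + 1)]
  rw [Finset.sum_congr rfl hl, Finset.sum_congr rfl hr, Finset.sum_add_distrib]
  simp only [Finset.sum_neg_distrib, Finset.range_zero, Finset.sum_empty, Finset.Ico_self]
  abel

/-- A contraction of the `b'`-complex. -/
theorem b'_contraction (s : ∀ n, M.C (n + 1) →ₗ[ℂ] M.C n) (h0 : ∀ n f, s n (M.dn n 0 f) = f)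
    (hs : ∀ n i f, i < n + 1 → s (n + 1) (M.dn (n + 1) (i + 1) f) = M.dn n i (s n f)) :
    (∀ f, s 0 (M.b' 0 f) = f) ∧ ∀ n f, s (n + 1) (M.b' (n + 1) f) = f - M.b' n (s n f) := by
  refine ⟨fun f => by simp [b'_eq, h0], fun n f => ?_⟩
  rw [b'_eq, b'_eq, Finset.sum_range_succ', map_add, map_sum]
  simp only [map_smul, h0, pow_zero, one_smul]
  -- The face `0` has produced `f`; each other face drops its index by one when it passes `s`, so
  -- what remains is `-b' s f`.
  rw [Finset.sum_congr rfl fun i hi => by rw [hs n i f (Finset.mem_range.1 hi), pow_succ]]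
  simp [sub_eq_neg_add]

/-- The operators `K n j`, `0 < j`, form a homotopy of the `b`-complex from `1` to `θ`. -/
theorem b_homotopy (K : ∀ n, ℕ → M.C (n + 1) →ₗ[ℂ] M.C n) (θ : ∀ n, M.C n →ₗ[ℂ] M.C n)
    (h0 : ∀ n f, K n 0 (M.dn n 0 f) = f)
    (hd : ∀ n i f, i < n + 1 → K n (i + 1) (M.dn n i f) = K n i (M.dn n i f))
    (hlt : ∀ n i j f, i < j + 1 → j < n + 1 →
      K (n + 1) (j + 2) (M.dn (n + 1) i f) = M.dn n i (K n (j + 1) f))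
    (hgt : ∀ n i j f, j < i → i < n + 2 →
      K (n + 1) (j + 1) (M.dn (n + 1) (i + 1) f) = M.dn n i (K n (j + 1) f))
    (hθ : ∀ n f, K n (n + 1) (M.dn n (n + 1) f) = θ n f) :
    (∀ f, M.b 0 f = 0 → f = θ 0 f) ∧
      ∀ n f, M.b (n + 1) f = 0 → ∃ g, f = θ (n + 1) f + M.b n g := by
  constructor
  · intro f hf
    -- In degree `0` there is no room for a primitive: `K 0 1` sends `d₀ f` to `f` and `d₁ f` to `θ
    -- f`, so applying it to `b f = 0` gives `f - θ f = 0`.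
    have := congrArg (K 0 1) hf
    rw [b_eq, map_zero, Finset.sum_range_succ, Finset.sum_range_one] at this
    simp only [map_add, hd 0 0 f one_pos, h0, pow_zero, pow_one, one_smul, neg_one_smul,
      map_neg] at this
    exact add_neg_eq_zero.1 (hθ 0 f ▸ this)
  · intro n f hf
    -- The chain homotopy omits `K n 0`, which enters only through the boundary term `K n 0 d₀ = 1`.
    refine ⟨∑ j ∈ Finset.range (n + 1), (-1 : ℂ) ^ j • K n (j + 1) f, ?_⟩
    -- The telescoping quantity is `P j = Kⱼ dⱼ f`, which runs from `K₀ d₀ f = f` to `θ f`.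
    have := alt_sum_homotopy (n + 1) (fun j i => K (n + 1) (j + 1) (M.dn (n + 1) i f))
      (fun j i => M.dn n i (K n (j + 1) f)) (fun j => K (n + 1) j (M.dn (n + 1) j f))
      (fun i j hi hj => hlt n i j f hi hj) (fun i j hi hj => hgt n i j f hi hj)
      (fun j hj => hd (n + 1) j f hj) (fun j hj => rfl)
    have hl : ∀ j, ∑ i ∈ Finset.range (n + 1 + 2),
        (-1 : ℂ) ^ (i + j) • K (n + 1) (j + 1) (M.dn (n + 1) i f) = 0 := fun j => by
      have := congrArg (fun z => (-1 : ℂ) ^ j • K (n + 1) (j + 1) z) hf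
      simpa [b_eq, Finset.smul_sum, smul_smul, pow_add, mul_comm] using this
    simp only [hl, Finset.sum_const_zero, h0, hθ] at this
    have hb : M.b n (∑ j ∈ Finset.range (n + 1), (-1 : ℂ) ^ j • K n (j + 1) f) =
        ∑ j ∈ Finset.range (n + 1), ∑ i ∈ Finset.range (n + 1 + 1),
          (-1 : ℂ) ^ (i + j) • M.dn n i (K n (j + 1) f) := by
      simp [b_eq, Finset.smul_sum, smul_smul, pow_add, mul_comm]
    rw [hb, ← sub_eq_iff_eq_add', ← sub_eq_zero]
    exact this.symm
end PrecocyclicModule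

/-! ### Insertion operators on multilinear maps -/

section Insert
variable {H : Type*} [Ring H] [HopfAlgebra ℂ H] {B : Type*} [Ring B] [Algebra ℂ B]
  {V : Type*} [AddCommGroup V] [Module ℂ V] {ι : Type*} [Fintype ι] (u v : ι → B)

/-- `ins u v n j w g (b₁, …, bₙ)` is the sum over `k₁, …, kⱼ` of
`g (w b₁ u_{k₁}, v_{k₁} b₂ u_{k₂}, …, v_{kⱼ₋₁} bⱼ u_{kⱼ}, v_{kⱼ}, bⱼ₊₁, …, bₙ)` for `j ≤ n`. -/
noncomputable def ins : ∀ n : ℕ, ℕ → B → Multi B (n + 1) V →ₗ[ℂ] Multi B n V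
  | _, 0, w =>
    { toFun := fun g => g.curryLeft w
      map_add' := fun _ _ => rfl
      map_smul' := fun _ _ => rfl }
  -- A default value: no argument is left to be conjugated. The homotopy uses `ins` only for `j ≤
  -- n`.
  | 0, _ + 1, _ => 0
  | n + 1, j + 1, w =>
    -- The first slot is closed by `u l`, and the matching `v l` becomes the left factor of the next
    -- slot. This is why the recursion needs a general `w`, although only `w = 1` is wanted in the
    -- end.
    { toFun := fun g => LinearMap.uncurryLeft (∑ l, ins n j (v l) ∘ₗ g.curryLeft ∘ₗ
        LinearMap.mulLeft ℂ w ∘ₗ LinearMap.mulRight ℂ (u l))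
      map_add' := fun g g' => by
        ext x
        simp [curryLeft_add, Finset.sum_add_distrib]
      map_smul' := fun c g => by
        ext x
        simp [curryLeft_smul, Finset.smul_sum] }

theorem ins_zero (n : ℕ) (w : B) (g : Multi B (n + 1) V) : ins u v n 0 w g = g.curryLeft w := by
  cases n <;> rfl

theorem ins_succ_curryLeft (n j : ℕ) (w : B) (g : Multi B (n + 2) V) (b : B) :
    (ins u v (n + 1) (j + 1) w g).curryLeft b =
      ∑ l, ins u v n j (v l) (g.curryLeft (w * (b * u l))) := by
  change (∑ l, ins u v n j (v l) ∘ₗ g.curryLeft ∘ₗ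
        LinearMap.mulLeft ℂ w ∘ₗ LinearMap.mulRight ℂ (u l)) b = _
  simp

theorem curryLeft_sum (n : ℕ) (g : ι → Multi B (n + 1) V) (b : B) :
    (∑ l, g l).curryLeft b = ∑ l, (g l).curryLeft b := by
  ext x; simp

theorem fixLast_sum (n : ℕ) (g : ι → Multi B (n + 1) V) (b : B) :
    fixLast n (∑ l, g l) b = ∑ l, fixLast n (g l) b := by
  ext x; simp [fixLast_apply]

/-- The face glues the last conjugated slot `v b uₗ` to the bare `vₗ` after it, and `∑ uₗ vₗ = 1`
leaves `v b`. The operator with one conjugation fewer gives the same, by gluing the bare `v` to `b`.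
These are the terms that telescope in the homotopy. -/
theorem ins_succ_face (n : ℕ) (i : Fin (n + 1)) (h : ∑ l, u l * v l = 1) (w : B)
    (g : Multi B (n + 1) V) :
    ins u v (n + 1) (i + 1) w (face n i g) = ins u v (n + 1) i w (face n i g) := by
  -- The case `i = 0` with arbitrary left factor `w`; the slots in front of the face are then peeled
  -- off by induction, which replaces `w` by some `v l`.
  have h0 : ∀ n w (g : Multi B (n + 1) V), ins u v (n + 1) 1 w (face n 0 g) =
      ins u v (n + 1) 0 w (face n 0 g) := fun n w g => by
    apply ext_curryLeft; intro b
    simp only [ins_succ_curryLeft, ins_zero, face_zero_curryLeft, mul_assoc]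
    rw [← map_sum, ← Finset.mul_sum, ← Finset.mul_sum, h, mul_one]
  induction n generalizing w with
  | zero => fin_cases i; exact h0 0 w g
  | succ n ih =>
    cases i using Fin.cases with
    | zero => exact h0 _ w g
    | succ i =>
      apply ext_curryLeft; intro b
      simp only [Fin.val_succ, ins_succ_curryLeft, face_succ_curryLeft]
      exact Finset.sum_congr rfl fun l _ => ih i _ _

theorem ins_one_zero_face_zero (n : ℕ) (g : Multi B (n + 1) V) :
    ins u v (n + 1) 0 1 (face n 0 g) = g := by
  apply ext_curryLeft; intro b
  rw [ins_zero, face_zero_curryLeft, one_mul]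

/-- The face merges two neighbouring conjugated slots. Their product `(v a uₗ)(vₗ b u)`, summed over
the linking index `l`, is the conjugated product `v (a b) u`, so one conjugation disappears. -/
theorem ins_face_of_lt (n : ℕ) (i : Fin (n + 1)) (j : ℕ) (hij : i < j + 1)
    (h : ∑ l, u l * v l = 1) (w : B) (g : Multi B (n + 2) V) :
    ins u v (n + 2) (j + 2) w (face (n + 1) i.castSucc g) =
      face n i (ins u v (n + 1) (j + 1) w g) := by
  have h0 : ∀ n j w (g : Multi B (n + 2) V), ins u v (n + 2) (j + 2) w (face (n + 1) 0 g) =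
      face n 0 (ins u v (n + 1) (j + 1) w g) := fun n j w g => by
    apply ext_curryLeft; intro a
    apply ext_curryLeft; intro b
    simp only [face_zero_curryLeft, ins_succ_curryLeft, curryLeft_sum]
    -- The index `l` linking the two merged slots has to be summed first; `m` belongs to the right
    -- end of the product and survives.
    rw [Finset.sum_comm]
    refine Finset.sum_congr rfl fun m _ => ?_
    rw [← map_sum, ← map_sum]
    have : ∀ l, w * (a * u l) * (v l * (b * u m)) = w * a * (u l * v l) * (b * u m) := fun l => by
      simp only [mul_assoc]
    simp only [this, ← Finset.sum_mul, ← Finset.mul_sum, h, mul_one]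
    simp only [mul_assoc]
  induction n generalizing w j with
  | zero => fin_cases i; exact h0 0 j w g
  | succ n ih =>
    cases i using Fin.cases with
    | zero => exact h0 _ j w g
    | succ i =>
      obtain ⟨j, rfl⟩ : ∃ k, j = k + 1 := ⟨j - 1, by simp only [Fin.val_succ] at hij; omega⟩
      apply ext_curryLeft; intro b
      rw [ins_succ_curryLeft, face_succ_curryLeft, ins_succ_curryLeft, map_sum]
      refine Finset.sum_congr rfl fun l _ => ?_
      rw [← Fin.succ_castSucc, face_succ_curryLeft, ih i j (by simpa using hij)]

/-- The merged arguments lie to the right of the inserted element and are untouched by the operator.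
The insertion has moved them by one place, which accounts for the shift of the face index. -/
theorem ins_face_of_gt (n : ℕ) (i : Fin (n + 1)) (j : ℕ) (hij : j ≤ i) (w : B)
    (g : Multi B (n + 2) V) :
    ins u v (n + 2) j w (face (n + 1) i.succ g) = face n i (ins u v (n + 1) j w g) := by
  induction n generalizing w j with
  | zero =>
    obtain rfl : j = 0 := by omega
    rw [ins_zero, ins_zero, face_succ_curryLeft]
  | succ n ih =>
    cases j with
    | zero => rw [ins_zero, ins_zero, face_succ_curryLeft]
    | succ j =>
      cases i using Fin.cases with
      | zero => simp at hij
      | succ i =>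
        apply ext_curryLeft; intro b
        rw [ins_succ_curryLeft, face_succ_curryLeft, ins_succ_curryLeft, map_sum]
        refine Finset.sum_congr rfl fun l _ => ?_
        rw [face_succ_curryLeft, ih i j (by simpa using hij)]

/-- The bound on `j` says that the last argument is not among the conjugated ones. -/
theorem fixLast_ins (n j : ℕ) (hj : j ≤ n) (w : B) (g : Multi B (n + 2) V) (c : B) :
    fixLast n (ins u v (n + 1) j w g) c = ins u v n j w (fixLast (n + 1) g c) := by
  induction n generalizing w j with
  | zero =>
    obtain rfl : j = 0 := by omega
    rw [ins_zero, ins_zero, fixLast_curryLeft]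
  | succ n ih =>
    cases j with
    | zero => rw [ins_zero, ins_zero, fixLast_curryLeft]
    | succ j =>
      apply ext_curryLeft; intro b
      rw [fixLast_curryLeft, ins_succ_curryLeft, ins_succ_curryLeft, fixLast_sum]
      refine Finset.sum_congr rfl fun l _ => ?_
      rw [ih j (by omega), fixLast_curryLeft]

/-- The last coface multiplies the first slot from the left by the last argument `c ◁ ω`. Since `j ≤
n`, `c` carries no `u` or `v`; since the left factor is `1`, nothing separates it from `b₀ u`. So it
does not matter whether `c ◁ ω` is multiplied in before or after the insertion. -/
theorem ins_rotate_face (ρ : RightModule H B) (n j : ℕ) (hj : j ≤ n) (g : Multi B (n + 2) V)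
    (ω : H) : ins u v (n + 2) (j + 1) 1 (rotate ρ (n + 2) (face (n + 1) 0 g) ω) =
      rotate ρ (n + 1) (face n 0 (ins u v (n + 1) (j + 1) 1 g)) ω := by
  apply ext_fixLast; intro c
  rw [fixLast_ins _ _ _ _ (by omega), fixLast_rotate, fixLast_rotate]
  apply ext_curryLeft; intro b
  rw [ins_succ_curryLeft, face_zero_curryLeft, ins_succ_curryLeft]
  simp only [face_zero_curryLeft, one_mul, mul_assoc]

variable (β : RightModuleAlgebra H B)

theorem act_mul_of_invariant_left {x : B}
    (hx : ∀ ω, β.act x ω = Coalgebra.counit (R := ℂ) ω • x) (b : B) (ω : H) :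
    β.act (x * b) ω = x * β.act b ω := by
  rw [β.mul_act']
  simp only [hx, smul_mul_assoc]
  refine sw_counit_left (L := fun ω => x * β.act b ω) ?_ ω
  constructor <;> intros <;> simp [mul_add]

theorem act_mul_of_invariant_right {x : B}
    (hx : ∀ ω, β.act x ω = Coalgebra.counit (R := ℂ) ω • x) (b : B) (ω : H) :
    β.act (b * x) ω = β.act b ω * x := by
  rw [β.mul_act']
  simp only [hx, mul_smul_comm]
  refine sw_counit_right (L := fun ω => β.act b ω * x) ?_ ω
  constructor <;> intros <;> simp [add_mul]

/-- Invariant factors can be pulled out of the action, so in a slot `v b u` the Sweedler leg acts on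
`b` alone, and the leg that falls on the bare inserted element is absorbed by the counit. The
hypothesis on `w` is inherited in the recursion, where `w` becomes some `v l`. -/
theorem tensorAct_ins (hu : ∀ l ω, β.act (u l) ω = Coalgebra.counit (R := ℂ) ω • u l)
    (hv : ∀ l ω, β.act (v l) ω = Coalgebra.counit (R := ℂ) ω • v l) (n j : ℕ) {w : B}
    (hw : ∀ ω, β.act w ω = Coalgebra.counit (R := ℂ) ω • w) (g : Multi B (n + 1) V) (ω : H) :
    tensorAct β.toRightModule n (ins u v n j w g) ω =
      ins u v n j w (tensorAct β.toRightModule (n + 1) g ω) := by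
  induction n generalizing w j ω with
  | zero =>
    cases j with
    | succ j => change tensorAct _ 0 (0 : Multi B 0 V) ω = 0; simp
    | zero =>
      rw [ins_zero, ins_zero, tensorAct_succ]
      simp only [hw, map_smul, LinearMap.smul_apply]
      refine (sw_counit_left (L := fun ω => tensorAct β.toRightModule 0 (g.curryLeft w) ω) ?_ ω).symm
      constructor <;> intros <;> simp
  | succ n ih =>
    cases j with
    | zero =>
      rw [ins_zero, ins_zero, tensorAct_succ]
      simp only [hw, map_smul, LinearMap.smul_apply]
      refine (sw_counit_left (L := fun ω => tensorAct β.toRightModule _ (g.curryLeft w) ω) ?_ ω).symm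
      constructor <;> intros <;> simp
    | succ j =>
      apply ext_curryLeft; intro b
      rw [ins_succ_curryLeft, tensorAct_succ]
      simp only [ins_succ_curryLeft, map_sum, LinearMap.sum_apply, ih j (hv _), tensorAct_succ,
        map_sw, act_mul_of_invariant_left β hw, act_mul_of_invariant_right β (hu _)]
      simp only [sw]
      exact Finset.sum_comm
end Insert

/-! ### Insertion operators on equivariant cochains -/

section Operators
variable {H : Type*} [Ring H] [HopfAlgebra ℂ H] [InvertibleAntipode H]
  {B : Type*} [Ring B] [Algebra ℂ B] (β : RightModuleAlgebra H B)

/-- The inclusion of the invariant functionals into all functionals. -/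
noncomputable def toFunctional (n : ℕ) : (equivariantCochains β).C n →ₗ[ℂ] Functional H B n :=
  (Cochain β n).subtype

theorem ext_toFunctional {n : ℕ} {f g : (equivariantCochains β).C n}
    (h : ∀ ω, toFunctional β n f ω = toFunctional β n g ω) : f = g :=
  Subtype.ext (LinearMap.ext h)

theorem toFunctional_dn (n i : ℕ) (hi : i < n + 1) (f : (equivariantCochains β).C n) (ω : H) :
    toFunctional β (n + 1) ((equivariantCochains β).dn n i f) ω =
      face n ⟨i, hi⟩ (toFunctional β n f ω) := by
  rw [PrecocyclicModule.dn, dif_pos (by omega : i < n + 2)]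
  exact congrArg (fun z => z ω) (cofaceOp_castSucc β n ⟨i, hi⟩ (toFunctional β n f))

/-- Among the cofaces only this one involves the variable in `H`: one leg of `ω` acts on the
argument that is moved to the front. All the others act on `f ω` for each `ω` separately. -/
theorem toFunctional_dn_last (n : ℕ) (f : (equivariantCochains β).C n) (ω : H) :
    toFunctional β (n + 1) ((equivariantCochains β).dn n (n + 1) f) ω =
      sw (fun a b => rotate β.toRightModule (n + 1) (face n 0 (toFunctional β n f a)) b) ω := by
  rw [PrecocyclicModule.dn, dif_pos (by omega : n + 1 < n + 2)]
  exact (congrArg (fun z => z ω) (cofaceOp_last β n (toFunctional β n f))).trans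
    (cyc_apply _ _ _ _)

variable {ι : Type*} [Fintype ι] {u v : ι → B}

/-- The operator on cochains given by `ins u v (n + 1) j 1`. -/
noncomputable def insOp (hu : ∀ l ω, β.act (u l) ω = Coalgebra.counit (R := ℂ) ω • u l)
    (hv : ∀ l ω, β.act (v l) ω = Coalgebra.counit (R := ℂ) ω • v l) (n j : ℕ) :
    (equivariantCochains β).C (n + 1) →ₗ[ℂ] (equivariantCochains β).C n :=
  LinearMap.restrict (p := Cochain β (n + 1)) (q := Cochain β n)
    ((LinearMap.compRight ℂ (ins u v (n + 1) j 1) :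
      Functional H B (n + 1) →ₗ[ℂ] Functional H B n)) fun f hf => by
    rw [mem_Cochain] at hf ⊢
    intro ω η
    change sw (fun a b => tensorAct β.toRightModule (n + 1) (ins u v (n + 1) j 1 (f (η * a))) b) ω =
      ins u v (n + 1) j 1 (f (ω * η))
    rw [← hf, map_sw]
    simp only [tensorAct_ins u v β hu hv (n + 1) j β.one_act]

variable (hu : ∀ l ω, β.act (u l) ω = Coalgebra.counit (R := ℂ) ω • u l)
    (hv : ∀ l ω, β.act (v l) ω = Coalgebra.counit (R := ℂ) ω • v l)

theorem toFunctional_insOp (n j : ℕ) (f : (equivariantCochains β).C (n + 1)) (ω : H) :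
    toFunctional β n (insOp β hu hv n j f) ω =
      ins u v (n + 1) j 1 (toFunctional β (n + 1) f ω) := rfl

theorem insOp_zero_dn (n : ℕ) (f : (equivariantCochains β).C n) :
    insOp β hu hv n 0 ((equivariantCochains β).dn n 0 f) = f := by
  refine ext_toFunctional β fun ω => ?_
  rw [toFunctional_insOp, toFunctional_dn β n 0 (by omega)]
  exact ins_one_zero_face_zero u v n _

theorem insOp_succ_dn (h : ∑ l, u l * v l = 1) (n i : ℕ) (f : (equivariantCochains β).C n)
    (hi : i < n + 1) : insOp β hu hv n (i + 1) ((equivariantCochains β).dn n i f) =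
      insOp β hu hv n i ((equivariantCochains β).dn n i f) := by
  refine ext_toFunctional β fun ω => ?_
  rw [toFunctional_insOp, toFunctional_insOp, toFunctional_dn β n i hi]
  exact ins_succ_face u v n ⟨i, hi⟩ h 1 _

theorem insOp_dn_of_lt (h : ∑ l, u l * v l = 1) (n i j : ℕ) (f : (equivariantCochains β).C (n + 1))
    (hi : i < j + 1) (hj : j < n + 1) :
    insOp β hu hv (n + 1) (j + 2) ((equivariantCochains β).dn (n + 1) i f) =
      (equivariantCochains β).dn n i (insOp β hu hv n (j + 1) f) := by
  refine ext_toFunctional β fun ω => ?_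
  rw [toFunctional_insOp, toFunctional_dn β (n + 1) i (by omega),
    toFunctional_dn β n i (by omega), toFunctional_insOp]
  exact ins_face_of_lt u v n ⟨i, by omega⟩ j hi h 1 _

/-- Used twice: for `j = 0` it makes insertion of `1` a contraction of `b'`, and for positive `j` it
is one of the homotopy identities for `b`. -/
theorem insOp_dn_of_le (n i j : ℕ) (f : (equivariantCochains β).C (n + 1)) (hj : j ≤ i)
    (hi : i < n + 1) : insOp β hu hv (n + 1) j ((equivariantCochains β).dn (n + 1) (i + 1) f) =
      (equivariantCochains β).dn n i (insOp β hu hv n j f) := by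
  refine ext_toFunctional β fun ω => ?_
  rw [toFunctional_insOp, toFunctional_dn β (n + 1) (i + 1) (by omega),
    toFunctional_dn β n i (by omega), toFunctional_insOp]
  exact ins_face_of_gt u v n ⟨i, hi⟩ j hj 1 _

/-- The continuation of `insOp_dn_of_le` to the last coface, which the complex with `b` needs and
the one with `b'` does not. The value `j = n + 1` is excluded: there the operator conjugates the
last argument as well. -/
theorem insOp_dn_last (n j : ℕ) (f : (equivariantCochains β).C (n + 1)) (hj : j ≤ n) :
    insOp β hu hv (n + 1) (j + 1) ((equivariantCochains β).dn (n + 1) (n + 2) f) =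
      (equivariantCochains β).dn n (n + 1) (insOp β hu hv n (j + 1) f) := by
  refine ext_toFunctional β fun ω => ?_
  rw [toFunctional_insOp, toFunctional_dn_last, toFunctional_dn_last, map_sw]
  simp only [ins_rotate_face u v β.toRightModule n j hj, toFunctional_insOp]

end Operators

/-! ### Matrix units in `End(X) ⊗ B` for the trivial action -/

section MatrixUnits
variable {H : Type*} [Ring H] [HopfAlgebra ℂ H]
  {X : Type*} [AddCommGroup X] [Module ℂ X] {B : Type*} [Ring B] [Algebra ℂ B]
  {V : Type*} [AddCommGroup V] [Module ℂ V]

theorem trivial_pi (ω : H) :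
    (RightModule.trivial H X).pi ω = Coalgebra.counit (R := ℂ) ω • 1 := by
  simpa using RightModule.trivial_pi_mul (X := X) 1 ω

variable [InvertibleAntipode H] in
theorem trivial_piS (ω : H) :
    (RightModule.trivial H X).piS ω = Coalgebra.counit (R := ℂ) ω • 1 := by
  rw [← counit_antipodeInv]; exact trivial_pi _

variable [InvertibleAntipode H] in
-- Both `π_X` and `π_X S⁻¹` are given by the counit, so the outer legs of `ω` disappear and the
-- middle one is all of `ω`.
theorem endModuleAlgebra_trivial_act (β : RightModuleAlgebra H B) (ω : H) (T : Module.End ℂ X)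
    (b : B) : (endModuleAlgebra (RightModule.trivial H X) β).act (T ⊗ₜ b) ω = T ⊗ₜ β.act b ω := by
  have e : ∀ u v w, ((RightModule.trivial H X).pi u * T * (RightModule.trivial H X).piS w) ⊗ₜ[ℂ]
      β.act b v = Coalgebra.counit (R := ℂ) u • Coalgebra.counit (R := ℂ) w • T ⊗ₜ[ℂ] β.act b v :=
    fun u v w => by
      rw [trivial_pi, trivial_piS, smul_mul_assoc, one_mul, smul_mul_assoc, mul_smul_comm, mul_one,
        TensorProduct.smul_tmul', TensorProduct.smul_tmul']
  have hL : IsLinearMap ℂ fun v => T ⊗ₜ[ℂ] β.act b v := by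
    constructor <;> intros <;> simp [TensorProduct.tmul_add]
  rw [endModuleAlgebra_act_tmul]
  simp only [e, sw_smul_fun, sw_counit_right hL, sw_counit_left hL]

variable [InvertibleAntipode H] in
-- This supplies the invariant elements that the insertion operators require.
theorem endModuleAlgebra_trivial_act_one (β : RightModuleAlgebra H B) (T : Module.End ℂ X) (ω : H) :
    (endModuleAlgebra (RightModule.trivial H X) β).act (T ⊗ₜ 1) ω =
      Coalgebra.counit (R := ℂ) ω • (T ⊗ₜ[ℂ] (1 : B)) := by
  rw [endModuleAlgebra_trivial_act, β.one_act, TensorProduct.tmul_smul]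

theorem ext_multi_tmul (n : ℕ) {g g' : RMulti (Module.End ℂ X ⊗[ℂ] B) n V}
    (h : ∀ (T : Fin n → Module.End ℂ X) (b : Fin n → B),
      g (fun i => T i ⊗ₜ b i) = g' (fun i => T i ⊗ₜ b i)) : g = g' := by
  induction n with
  | zero =>
    ext x
    rw [Subsingleton.elim x fun i => (0 : Module.End ℂ X) ⊗ₜ (0 : B)]
    exact h _ _
  | succ n ih =>
    apply ext_curryLeft_tmul; intro T b
    refine ih fun T' b' => ?_
    have := h (Fin.cons T T') (Fin.cons b b')
    rw [← Fin.cons_self_tail fun i => (Fin.cons T T' : Fin (n + 1) → Module.End ℂ X) i ⊗ₜ[ℂ]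
      (Fin.cons b b' : Fin (n + 1) → B) i, apply_cons, apply_cons] at this
    exact this

/-- A rank one idempotent is of the form `y ↦ ξ y • x` with `ξ x = 1`. -/
theorem exists_rank_one {p : Module.End ℂ X} (hp : IsIdempotentElem p)
    (h : Module.finrank ℂ (LinearMap.range p) = 1) :
    ∃ (x : X) (ξ : Module.Dual ℂ X), ξ x = 1 ∧ p = ξ.smulRight x := by
  obtain ⟨⟨x, hx⟩, hx0, hspan⟩ := finrank_eq_one_iff'.1 h
  have hx0' : x ≠ 0 := fun e => hx0 (Subtype.ext e)
  have hy : ∀ y, ∃ c : ℂ, c • x = p y := fun y => by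
    obtain ⟨c, hc⟩ := hspan ⟨p y, y, rfl⟩
    exact ⟨c, congrArg Subtype.val hc⟩
  -- The functional `ξ` is the coordinate of `p y` along `x`. It is linear because `x ≠ 0` makes the
  -- coordinate unique, and `ξ x = 1` because `p` fixes its range.
  choose c hc using hy
  have inj : ∀ {a b : ℂ}, a • x = b • x → a = b := fun e => smul_left_injective ℂ hx0' e
  refine ⟨x, { toFun := c, map_add' := fun y z => inj ?_, map_smul' := fun a y => inj ?_ },
    inj ?_, ?_⟩
  · rw [hc, map_add, add_smul, hc, hc]
  · rw [hc, map_smul, smul_eq_mul, mul_smul, RingHom.id_apply, hc]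
  · change c x • x = _
    obtain ⟨y, rfl⟩ := hx
    rw [hc, one_smul, ← Module.End.mul_apply, hp.eq]
  · ext y
    exact (hc y).symm

variable {ι : Type*} (e : Module.Basis ι ℂ X) (x : X)
  (ξ : Module.Dual ℂ X)

/-- `y ↦ ξ(y) eₗ` in `End(X) ⊗ B` -/
noncomputable def unitCol (B : Type*) [Ring B] [Algebra ℂ B] (l : ι) : Module.End ℂ X ⊗[ℂ] B :=
  ξ.smulRight (e l) ⊗ₜ 1

/-- `y ↦ eˡ(y) x` in `End(X) ⊗ B` -/
noncomputable def unitRow (B : Type*) [Ring B] [Algebra ℂ B] (l : ι) : Module.End ℂ X ⊗[ℂ] B :=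
  (e.coord l).smulRight x ⊗ₜ 1

variable {x ξ}

/-- The product passes through the scalar `eᵏ(T eₗ)`, a matrix entry of `T`. What is left of the
operator is `ξ(·) x`, whatever `T` was. -/
theorem unitRow_mul_mul_unitCol (k l : ι) (T : Module.End ℂ X) (b : B) :
    unitRow e x B k * (T ⊗ₜ b * unitCol e ξ B l) =
      e.repr (T (e l)) k • (ξ.smulRight x ⊗ₜ b) := by
  simp only [unitCol, unitRow, Algebra.TensorProduct.tmul_mul_tmul, mul_one, one_mul]
  rw [TensorProduct.smul_tmul']
  congr
  ext y
  simp [smul_smul, mul_comm]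

variable [Fintype ι]

/-- In the opposite order the inner scalar is `ξ x = 1`, and the outer factors `eˡ(·) eₗ` sum to the
identity of `X`. -/
theorem sum_unitCol_mul_unitRow (h : ξ x = 1) :
    ∑ l, unitCol e ξ B l * unitRow e x B l = 1 := by
  simp only [unitCol, unitRow, Algebra.TensorProduct.tmul_mul_tmul, mul_one]
  rw [← TensorProduct.sum_tmul, Algebra.TensorProduct.one_def]
  congr
  ext y
  simp [h, e.sum_repr]

/-- Matrix times vector. With `y` a product of operators applied to a basis vector, it multiplies
matrices one factor at a time. -/
theorem sum_repr_mul_repr (T : Module.End ℂ X) (y : X) (k : ι) :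
    ∑ l, e.repr (T (e l)) k * e.repr y l = e.repr (T y) k := by
  conv_rhs => rw [← e.sum_repr y, map_sum, map_sum, Finsupp.finsetSum_apply]
  simp [mul_comm, -Module.Basis.sum_repr]

/-- With every argument conjugated, each slot becomes a matrix entry times `ξ(·) x ⊗ bᵢ`. Summing
over the linking indices multiplies the matrices, so only the entry of `T₁ ⋯ Tₙ` at `(k, m)`
remains, together with the last inserted row element, whose index `m` is still free. -/
theorem ins_unit_tmul (n : ℕ) (k : ι) (g : RMulti (Module.End ℂ X ⊗[ℂ] B) (n + 1) V)
    (T : Fin n → Module.End ℂ X) (b : Fin n → B) :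
    ins (unitCol e ξ B) (unitRow e x B) n n (unitRow e x B k) g (fun i => T i ⊗ₜ b i) =
      ∑ m, e.repr ((List.ofFn T).prod (e m)) k •
        fixLast n g (unitRow e x B m) (fun i => ξ.smulRight x ⊗ₜ b i) := by
  classical
  induction n generalizing k with
  | zero =>
    -- The empty product has the identity matrix, so only `m = k` contributes.
    rw [ins_zero, Finset.sum_eq_single k]
    · simp only [List.ofFn_zero, List.prod_nil, Module.End.one_apply, Module.Basis.repr_self,
        Finsupp.single_eq_same, one_smul]
      rw [fixLast_apply, ← apply_cons]
      congr; ext i; fin_cases i; rfl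
    · intro m _ hm
      simp [hm]
    · simp
  | succ n ih =>
    rw [← Fin.cons_self_tail (fun i => T i ⊗ₜ[ℂ] b i), apply_cons, ins_succ_curryLeft]
    simp only [unitRow_mul_mul_unitCol, map_smul, smul_apply, sum_apply]
    have := fun l => ih l (g.curryLeft (ξ.smulRight x ⊗ₜ[ℂ] b 0)) (Fin.tail T) (Fin.tail b)
    change ∑ l, _ • ins _ _ n n _ _ (fun i => Fin.tail T i ⊗ₜ[ℂ] Fin.tail b i) = _
    simp only [this, Finset.smul_sum, smul_smul]
    rw [Finset.sum_comm]
    refine Finset.sum_congr rfl fun m _ => ?_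
    rw [← Finset.sum_smul, List.ofFn_succ, List.prod_cons, Module.End.mul_apply]
    rw [← Fin.cons_self_tail (fun i => ξ.smulRight x ⊗ₜ[ℂ] b i), apply_cons, fixLast_curryLeft]
    congr 1
    exact sum_repr_mul_repr e (T 0) _ k
end MatrixUnits

/-! ### Retractions in cyclic cohomology -/

namespace PrecocyclicHom
variable {M : PrecocyclicModule.{u}} {N : PrecocyclicModule.{v}}

theorem mapHC_leftInverse (Ψ : PrecocyclicHom M N) (Φ : PrecocyclicHom N M)
    (h : ∀ q f, Φ.app q (Ψ.app q f) = f) (n : ℕ) :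
    Function.LeftInverse (Φ.mapHC n) (Ψ.mapHC n) := by
  intro z
  induction z using Submodule.Quotient.induction_on with
  | H x =>
    refine congrArg (Submodule.Quotient.mk (p := (M.coboundaries n).submoduleOf (M.cocycles n))) ?_
    refine Subtype.ext ?_
    funext p q
    exact h q (x.1 p q)

/-- A retraction of precocyclic modules induces an isomorphism in cyclic cohomology when the columns
of its kernel are exact. -/
theorem mapHC_rightInverse (Ψ : PrecocyclicHom M N) (Φ : PrecocyclicHom N M)
    (h : ∀ q f, Φ.app q (Ψ.app q f) = f)
    (h0 : ∀ p (f : N.C 0), Φ.app 0 f = 0 → N.vert p 0 f = 0 → f = 0)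
    (hs : ∀ p q (f : N.C (q + 1)), Φ.app (q + 1) f = 0 → N.vert p (q + 1) f = 0 →
      ∃ g, N.vert p q g = f) (n : ℕ) :
    Function.RightInverse (Φ.mapHC n) (Ψ.mapHC n) := by
  intro z
  induction z using Submodule.Quotient.induction_on with
  | H y =>
    refine (Submodule.Quotient.eq ((N.coboundaries n).submoduleOf (N.cocycles n))).2 ?_
    change Ψ.bigraded (Φ.bigraded y.1) - y.1 ∈ N.coboundaries n
    -- The difference between `Ψ Φ y` and `y` is a cocycle in the kernel of `Φ`, because `Φ Ψ = 1`.
    refine N.mem_coboundaries_of_exact Φ h0 (fun p q f hf hv => ?_)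
      (sub_mem (Ψ.bigraded_cocycles (Φ.bigraded_cocycles y.2)) y.2) fun p q => ?_
    · obtain ⟨g, hg⟩ := hs p q f hf hv
      -- Projecting `g` to the kernel of `Φ` does not change its coboundary: the subtracted term has
      -- coboundary `Ψ Φ f = 0`.
      refine ⟨g - Ψ.app q (Φ.app q g), by rw [map_sub, h, sub_self], ?_⟩
      rw [map_sub, ← Ψ.app_vert, ← Φ.app_vert, hg, hf, map_zero, sub_zero]
    · change Φ.app q (Ψ.app q (Φ.app q (y.1 p q)) - y.1 p q) = 0
      rw [map_sub, h, sub_self]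
end PrecocyclicHom

/-! ### The homotopy between the identity and `Ψ Φ_p` -/

section Morita
variable {H : Type*} [Ring H] [HopfAlgebra ℂ H] [InvertibleAntipode H]
  {X : Type*} [AddCommGroup X] [Module ℂ X] {B : Type*} [Ring B] [Algebra ℂ B]
  (β : RightModuleAlgebra H B)

/-- For the trivial action the leg of `ω` inside the trace contributes only its counit, so `Ψ` is
the tensor product with the ordinary trace. -/
theorem toFunctional_psi (n : ℕ) (f : (equivariantCochains β).C n) (ω : H)
    (T : Fin (n + 1) → Module.End ℂ X) (b : Fin (n + 1) → B) :
    toFunctional _ n ((psi (RightModule.trivial H X) β).app n f) ω (fun i => T i ⊗ₜ b i) =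
      LinearMap.trace ℂ X (List.ofFn T).prod * toFunctional β n f ω b := by
  refine (psiFun_tmul _ n (toFunctional β n f) ω T b).trans ?_
  have : ∀ u v : H, toFunctional β n f u b * LinearMap.trace ℂ X
      ((RightModule.trivial H X).piS v * (List.ofFn T).prod) = Coalgebra.counit (R := ℂ) v •
        (LinearMap.trace ℂ X (List.ofFn T).prod * toFunctional β n f u b) := fun u v => by
    rw [trivial_piS, smul_mul_assoc, one_mul, map_smul, smul_eq_mul, smul_eq_mul]
    ring
  simp only [this]
  refine sw_counit_right
    (L := fun u => LinearMap.trace ℂ X (List.ofFn T).prod * toFunctional β n f u b) ?_ ω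
  constructor <;> intros <;> simp [mul_add, mul_left_comm]

theorem toFunctional_phi (χ : RightModule H X) (p : Module.End ℂ X) (hp : IsIdempotentElem p)
    (hl : ∀ ω, χ.pi ω * p = Coalgebra.counit (R := ℂ) ω • p)
    (hr : ∀ ω, p * χ.pi ω = Coalgebra.counit (R := ℂ) ω • p) (n : ℕ)
    (f : (equivariantCochains (endModuleAlgebra χ β)).C n) (ω : H) (b : Fin (n + 1) → B) :
    toFunctional β n ((phi β χ p hp hl hr).app n f) ω b =
      toFunctional _ n f ω (fun i => p ⊗ₜ b i) := rfl

variable {ι : Type*} (e : Module.Basis ι ℂ X) {x : X} {ξ : Module.Dual ℂ X}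

theorem unitCol_act (l : ι) (ω : H) :
    (endModuleAlgebra (RightModule.trivial H X) β).act (unitCol e ξ B l) ω =
      Coalgebra.counit (R := ℂ) ω • unitCol e ξ B l :=
  endModuleAlgebra_trivial_act_one β _ ω

theorem unitRow_act (l : ι) (ω : H) :
    (endModuleAlgebra (RightModule.trivial H X) β).act (unitRow e x B l) ω =
      Coalgebra.counit (R := ℂ) ω • unitRow e x B l :=
  endModuleAlgebra_trivial_act_one β _ ω

variable [Fintype ι]

theorem trace_eq_sum_repr (T : Module.End ℂ X) :
    LinearMap.trace ℂ X T = ∑ m, e.repr (T (e m)) m := by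
  classical
  rw [LinearMap.trace_eq_matrix_trace ℂ e, Matrix.trace]
  simp [LinearMap.toMatrix_apply]

/-- After all arguments have been conjugated, a row element `vₘ` stands in the last slot. The last
coface carries it to the front, up to `ε(ω)` by invariance, and multiplies it into `(T₀ ⊗ b₀) uₗ`.
The open chain of matrix entries thus becomes a closed one, and its sum is the trace of `T₀ ⋯ Tₙ`.
-/
theorem ins_rotate_face_tmul (n : ℕ) (g : RMulti (Module.End ℂ X ⊗[ℂ] B) (n + 1) ℂ)
    (ω : H) (T : Fin (n + 1) → Module.End ℂ X) (b : Fin (n + 1) → B) :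
    ins (unitCol e ξ B) (unitRow e x B) (n + 1) (n + 1) 1
      (rotate (endModuleAlgebra (RightModule.trivial H X) β).toRightModule (n + 1) (face n 0 g) ω)
        (fun i => T i ⊗ₜ b i) = Coalgebra.counit (R := ℂ) ω •
      (LinearMap.trace ℂ X (List.ofFn T).prod * g (fun i => ξ.smulRight x ⊗ₜ b i)) := by
  rw [← Fin.cons_self_tail (fun i => T i ⊗ₜ[ℂ] b i), apply_cons, ins_succ_curryLeft, sum_apply]
  change ∑ l, ins _ _ n n _ _ (fun i => Fin.tail T i ⊗ₜ[ℂ] Fin.tail b i) = _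
  have hc : ∀ l m : ι, fixLast n ((rotate (endModuleAlgebra (RightModule.trivial H X)
      β).toRightModule (n + 1) (face n 0 g) ω).curryLeft (1 * (T 0 ⊗ₜ[ℂ] b 0 * unitCol e ξ B l)))
      (unitRow e x B m) = Coalgebra.counit (R := ℂ) ω • e.repr (T 0 (e l)) m •
        g.curryLeft (ξ.smulRight x ⊗ₜ b 0) := fun l m => by
    rw [← fixLast_curryLeft, fixLast_rotate, unitRow_act, map_smul, one_mul,
      curryLeft_smul, LinearMap.smul_apply, face_zero_curryLeft, unitRow_mul_mul_unitCol, map_smul]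
  simp only [ins_unit_tmul, hc, smul_apply, smul_eq_mul]
  -- The index `m` of the row element that wraps around is summed last: the inner sum over `l` is
  -- the diagonal entry at `m` of `T₀ ⋯ Tₙ`.
  rw [Finset.sum_comm, List.ofFn_succ, List.prod_cons, trace_eq_sum_repr e, Finset.sum_mul,
    Finset.mul_sum]
  refine Finset.sum_congr rfl fun m _ => ?_
  rw [Module.End.mul_apply, ← sum_repr_mul_repr e, Finset.sum_mul, Finset.mul_sum]
  refine Finset.sum_congr rfl fun l _ => ?_
  rw [← Fin.cons_self_tail (fun i => ξ.smulRight x ⊗ₜ[ℂ] b i), apply_cons]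
  change e.repr ((List.ofFn fun i => T i.succ).prod (e m)) l *
    (_ * (_ * g.curryLeft _ fun i => ξ.smulRight x ⊗ₜ[ℂ] b i.succ)) = _ * (_ * _ *
      g.curryLeft _ fun i => ξ.smulRight x ⊗ₜ[ℂ] b i.succ)
  ring

variable (hp : IsIdempotentElem (ξ.smulRight x : Module.End ℂ X))

/-- The morphism `Φ_p` for the trivial action and `p = ξ(·) x`. -/
noncomputable def phiRankOne : PrecocyclicHom
    (equivariantCochains (endModuleAlgebra (RightModule.trivial H X) β)) (equivariantCochains β) :=
  phi β (RightModule.trivial H X) (ξ.smulRight x) hp (RightModule.trivial_pi_mul _)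
    (RightModule.mul_trivial_pi _)

/-- The far end of the homotopy. It suffices to compare on elementary tensors, where the trace of
`T₀ ⋯ Tₙ` times the value of `f` at the `p ⊗ bᵢ` is what `Ψ Φ_p` gives; the counit of the second leg
restores `ω`. -/
theorem insOp_last_dn_last (n : ℕ)
    (f : (equivariantCochains (endModuleAlgebra (RightModule.trivial H X) β)).C n) :
    insOp _ (unitCol_act β e (ξ := ξ)) (unitRow_act β e (x := x)) n (n + 1)
      ((equivariantCochains _).dn n (n + 1) f) =
      (psi (RightModule.trivial H X) β).app n ((phiRankOne β hp).app n f) := by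
  refine ext_toFunctional _ fun ω => ext_multi_tmul _ fun T b => ?_
  rw [toFunctional_psi, phiRankOne, toFunctional_phi, toFunctional_insOp, toFunctional_dn_last,
    map_sw, sw_multiApply]
  simp only [ins_rotate_face_tmul]
  refine sw_counit_right (L := fun a => LinearMap.trace ℂ X (List.ofFn T).prod *
    toFunctional _ n f a fun i => ξ.smulRight x ⊗ₜ b i) ?_ ω
  constructor <;> intros <;> simp [mul_add, mul_left_comm]

/-- The composite multiplies `f` by `Tr(p^(n+1)) = Tr p`, and the trace of `ξ(·) x` is `ξ x = 1`. -/
theorem phiRankOne_psi (e : Module.Basis ι ℂ X) (h : ξ x = 1) (n : ℕ) (f : (equivariantCochains β).C n) :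
    (phiRankOne β hp).app n ((psi (RightModule.trivial H X) β).app n f) = f := by
  refine ext_toFunctional _ fun ω => ?_
  ext b
  rw [phiRankOne, toFunctional_phi, toFunctional_psi, List.ofFn_const, List.prod_replicate,
    hp.pow_succ_eq, trace_eq_sum_repr e]
  have := congrArg ξ (e.sum_repr x)
  simp only [map_sum, map_smul, h, smul_eq_mul] at this
  simp [mul_comm (ξ _), this]

theorem phiRankOne_inverse (e : Module.Basis ι ℂ X) (h : ξ x = 1) (n : ℕ) :
    Function.LeftInverse ((phiRankOne β hp).mapHC n)
      ((psi (RightModule.trivial H X) β).mapHC n) ∧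
    Function.RightInverse ((phiRankOne β hp).mapHC n)
      ((psi (RightModule.trivial H X) β).mapHC n) := by
  have hsec := phiRankOne_psi β hp e h
  refine ⟨PrecocyclicHom.mapHC_leftInverse _ _ hsec n, ?_⟩
  have hu := sum_unitCol_mul_unitRow (B := B) e h
  set γ := endModuleAlgebra (RightModule.trivial H X) β
  let K := insOp γ (unitCol_act β e (ξ := ξ)) (unitRow_act β e (x := x))
  obtain ⟨hb0, hb⟩ := (equivariantCochains γ).b_homotopy K
    (fun n => (psi (RightModule.trivial H X) β).app n ∘ₗ (phiRankOne β hp).app n)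
    (fun n f => insOp_zero_dn γ _ _ n f)
    (fun n i f hi => insOp_succ_dn γ _ _ hu n i f hi)
    (fun n i j f hi hj => insOp_dn_of_lt γ _ _ hu n i j f hi hj)
    (fun n i j f hj hi => by
      -- The face `d_{i+1}` merges neighbours for `i ≤ n` and is the cyclic last coface for `i = n +
      -- 1`. The two kinds commute with the insertion for different reasons.
      rcases Nat.lt_succ_iff_lt_or_eq.1 hi with hi | rfl
      · exact insOp_dn_of_le γ _ _ n i (j + 1) f hj hi
      · exact insOp_dn_last γ _ _ n j f (by omega))
    (fun n f => insOp_last_dn_last β e hp n f)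
  -- `K n 0` inserts `1` in front of the arguments and involves no matrix units.
  obtain ⟨hc0, hc⟩ := (equivariantCochains γ).b'_contraction (fun n => K n 0)
    (fun n f => insOp_zero_dn γ _ _ n f)
    (fun n i f hi => insOp_dn_of_le γ _ _ n i 0 f (Nat.zero_le i) hi)
  refine PrecocyclicHom.mapHC_rightInverse _ _ hsec (fun p f hf hv => ?_)
    (fun p q f hf hv => ?_) n
  -- Row `0`: in an even column `f = Ψ Φ f = 0`, in an odd one the contraction already shows that
  -- `b'` is injective.
  · by_cases hp : Even p
    · simp only [PrecocyclicModule.vert, hp, if_true] at hv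
      rw [hb0 f hv, LinearMap.comp_apply, hf, map_zero]
    · simp only [PrecocyclicModule.vert, hp, if_false, LinearMap.neg_apply, neg_eq_zero] at hv
      rw [← hc0 f, hv, map_zero]
  · by_cases hp : Even p
    · simp only [PrecocyclicModule.vert, hp, if_true] at hv ⊢
      obtain ⟨g, hg⟩ := hb q f hv
      refine ⟨g, ?_⟩
      -- On the kernel of `Φ` the term `Ψ Φ f` drops out of the homotopy formula.
      rw [LinearMap.comp_apply, hf, map_zero, zero_add] at hg
      exact hg.symm
    · simp only [PrecocyclicModule.vert, hp, if_false, LinearMap.neg_apply, neg_eq_zero] at hv ⊢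
      have := hc q f
      rw [hv, map_zero, eq_comm, sub_eq_zero] at this
      -- The sign compensates for the vertical differential `-b'` of the odd columns.
      exact ⟨-K q 0 f, by rw [map_neg, neg_neg, ← this]⟩
end Morita

end HopfCyclic

/-! ### The theorem -/

/-- Morita invariance: `[Ψ^n] : HC^n_H(B) → HC^n_H(End(X) ⊗ B)` is an isomorphism, and `[Φ_p^n]` is
its inverse for every one-dimensional idempotent `p`. -/
theorem theorem2p4 {H : Type*} [Ring H] [HopfAlgebra ℂ H] [HopfCyclic.InvertibleAntipode H]
    {B : Type*} [Ring B] [Algebra ℂ B] (β : HopfCyclic.RightModuleAlgebra H B)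
    {X : Type*} [AddCommGroup X] [Module ℂ X] [FiniteDimensional ℂ X] [Nontrivial X] (n : ℕ) :
    Function.Bijective ((HopfCyclic.psi (HopfCyclic.RightModule.trivial H X) β).mapHC n) ∧
    ∀ (p : Module.End ℂ X) (hp : IsIdempotentElem p),
      Module.finrank ℂ (LinearMap.range p) = 1 →
      Function.LeftInverse
        ((HopfCyclic.phi β (HopfCyclic.RightModule.trivial H X) p hp
          (HopfCyclic.RightModule.trivial_pi_mul p)
          (HopfCyclic.RightModule.mul_trivial_pi p)).mapHC n)
        ((HopfCyclic.psi (HopfCyclic.RightModule.trivial H X) β).mapHC n) ∧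
      Function.RightInverse
        ((HopfCyclic.phi β (HopfCyclic.RightModule.trivial H X) p hp
          (HopfCyclic.RightModule.trivial_pi_mul p)
          (HopfCyclic.RightModule.mul_trivial_pi p)).mapHC n)
        ((HopfCyclic.psi (HopfCyclic.RightModule.trivial H X) β).mapHC n) := by
  have key : ∀ (p : Module.End ℂ X) (hp : IsIdempotentElem p),
      (∃ (x : X) (ξ : Module.Dual ℂ X), ξ x = 1 ∧ p = ξ.smulRight x) →
      Function.LeftInverse
        ((HopfCyclic.phi β (HopfCyclic.RightModule.trivial H X) p hp
          (HopfCyclic.RightModule.trivial_pi_mul p)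
          (HopfCyclic.RightModule.mul_trivial_pi p)).mapHC n)
        ((HopfCyclic.psi (HopfCyclic.RightModule.trivial H X) β).mapHC n) ∧
      Function.RightInverse
        ((HopfCyclic.phi β (HopfCyclic.RightModule.trivial H X) p hp
          (HopfCyclic.RightModule.trivial_pi_mul p)
          (HopfCyclic.RightModule.mul_trivial_pi p)).mapHC n)
        ((HopfCyclic.psi (HopfCyclic.RightModule.trivial H X) β).mapHC n) := by
    rintro p hp ⟨x, ξ, h, rfl⟩
    exact HopfCyclic.phiRankOne_inverse β hp (Module.finBasis ℂ X) h n
  refine ⟨?_, fun p hp hr => key p hp (HopfCyclic.exists_rank_one hp hr)⟩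
  let e := Module.finBasis ℂ X
  -- Bijectivity requires at least one rank one idempotent. As `X` is nonzero, a basis vector
  -- together with its own coordinate provides it.
  obtain ⟨i⟩ := e.index_nonempty
  have hi : e.coord i (e i) = 1 := by simp
  have hp : IsIdempotentElem ((e.coord i).smulRight (e i) : Module.End ℂ X) := by
    refine LinearMap.ext fun y => ?_
    simp
  have := key _ hp ⟨e i, e.coord i, hi, rfl⟩
  exact ⟨this.1.injective, this.2.surjective⟩
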